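/- Let $N\ge 1$ and let $a=[a_{ij}]\in\mathbb R^{N\times N}$ be the weighted adjacency matrix ($a_{ij}=a_{ji}\ge 0$, $a_{ii}=0$) of an undirected connected graph, $d_i=\sum_j a_{ji}$ the degrees, $L=\mathrm{diag}(d_1,\dots,d_N)-a$ the Laplacian and $\lambda_N$ its largest eigenvalue. Consider $N$ linear agents $$\dot x_i=A_ix_i+B_iu_i,\qquad y_i=C_ix_i,\qquad x_i\in\mathbb R^{n_i},\ u_i\in\mathbb R^{p_i},\ y_i\in\mathbb R^q,$$ with $(A_i,B_i)$ controllable and $\operatorname{rank}(C_iB_i)=q$. Let $f_i:\mathbb R^q\to\mathbb R$ be differentiable such that, for all $u,v\in\mathbb R^q$, $\|\nabla f_i(u)-\nabla f_i(v)\|\le w_i\|u-v\|$ and $(u-v)^\top(\nabla f_i(u)-\nabla f_i(v))\ge m_i\|u-v\|^2$, where $w_i,m_i>0$; put $\overline w=\max_i w_i$ and $\underline m=\min_i m_i$. Let $K_{\alpha_i},K_{\beta_i}$ satisfy $C_iB_iK_{\alpha_i}=C_iA_i$ and $C_iB_iK_{\beta_i}=I_q$. Let $$\xi>\frac{4\overline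 w^2+2\lambda_N^2+1}{8\underline m},\quad \epsilon=\frac1{2\sqrt{2(\xi^2+(\xi-1)^2)}},\quad \tau_0=\frac1{\overline w+1}\ln\Bigl(1+\frac{(\overline w+1)\epsilon}{\overline w+1+\sqrt2\lambda_N+\sqrt2\lambda_N\epsilon}\Bigr),$$ $$\Delta\in(0,\tau_0],\qquad \kappa>\max\Bigl\{\frac{\overline w^2}{4\underline m},\frac12\Bigr\}.$$ Agent $i$ broadcasts its output at instants $0=t_0^i<t_1^i<\cdots$ (finitely or infinitely many); $\hat y_i(t)=y_i(t_k^i)$ for $t\in[t_k^i,t_{k+1}^i)$ is its last broadcast value and $e_i=\hat y_i-y_i$. The agents are driven by $$u_i=-K_{\alpha_i}x_i+K_{\beta_i}\Bigl(-\nabla f_i(y_i)-\sum_j a_{ij}(\hat y_i-\hat y_j)-\eta_i\Bigr),\qquad \dot\eta_i=\sum_j a_{ij}(\hat y_i-\hat y_j),\quad \eta_i(0)=0,$$ and the broadcast instants obey $t_{k+1}^i=t_k^i+\max\{\tau_k^i,\Delta\}$, where $t_k^i+\tau_k^i$ is the first time after $t_k^i$ at which $\|e_i\|^2$ (with $\hat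 y_i=y_i(t_k^i)$ kept fixed) reaches or exceeds the threshold $$\frac1{4(d_i+\kappa)}\sum_{j}a_{ij}\|\hat y_i-\hat y_j\|^2 .$$ Here $\tau_k^i=0$ if the threshold vanishes at $t_k^i$, $\tau_k^i=\infty$ (no further broadcast) if the threshold is never reached, and at an instant at which some neighbors broadcast, each of them may be counted in the threshold with its old or with its new value. Then the problem $\min\sum_i f_i(y_i)$ subject to $y_1=\dots=y_N$ has a unique solution $y_1=\dots=y_N=y^*$, and there is a rate $c>0$, independent of the initial states, such that for every solution of the closed loop on $[0,\infty)$ there is a constant $M$ with $\|y_i(t)-y^*\|\le Me^{-ct}$ for all $t\ge0$ and all $i$. Moreover consecutive broadcasts of every agent are at least $\Delta$ apart, so that each agent broadcasts only finitely often in any bounded time interval (no Zeno behavior). -/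

import Mathlib

open Filter Topology
open scoped ENNReal

noncomputable section

namespace OptimalConsensus

/-- `ℝ^n` with its Euclidean norm. -/
abbrev Vec (n : ℕ) : Type := EuclideanSpace ℝ (Fin n)

/-! ### The communication graph -/

/-- `a` is the adjacency matrix of an undirected connected graph with positive edge weights and
without self-loops; `i` and `j` are joined by an edge iff `0 < a i j`. -/
structure IsConnectedAdjacency {N : ℕ} (a : Matrix (Fin N) (Fin N) ℝ) : Prop where
  symm : a.IsSymm
  nonneg : ∀ i j, 0 ≤ a i j
  no_loop : ∀ i, a i i = 0
  connected : (SimpleGraph.fromRel fun i j => 0 < a i j).Connected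

/-- Out-degree `d_i = ∑_j a_ji`. -/
def outDegree {N : ℕ} (a : Matrix (Fin N) (Fin N) ℝ) (i : Fin N) : ℝ := ∑ j, a j i

/-- Laplacian `L = D - a`. -/
def laplacian {N : ℕ} (a : Matrix (Fin N) (Fin N) ℝ) : Matrix (Fin N) (Fin N) ℝ :=
  Matrix.diagonal (outDegree a) - a

/-- The largest eigenvalue `λ_N` of the (symmetric) Laplacian. -/
def maxLaplacianEigenvalue {N : ℕ} (a : Matrix (Fin N) (Fin N) ℝ) : ℝ :=
  sSup (spectrum ℝ (laplacian a))

/-! ### The agents -/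

/-- The data of `N` heterogeneous linear agents `x_i' = A_i x_i + B_i u_i`, `y_i = C_i x_i` with
outputs in `ℝ^q`. -/
structure Agents (N q : ℕ) where
  n : Fin N → ℕ
  p : Fin N → ℕ
  A : (i : Fin N) → Matrix (Fin (n i)) (Fin (n i)) ℝ
  B : (i : Fin N) → Matrix (Fin (n i)) (Fin (p i)) ℝ
  C : (i : Fin N) → Matrix (Fin q) (Fin (n i)) ℝ

/-- Kalman's controllability matrix `[B, AB, …, A^{n-1}B]`. -/
def controllabilityMatrix {n p : ℕ} (A : Matrix (Fin n) (Fin n) ℝ) (B : Matrix (Fin n) (Fin p) ℝ) :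
    Matrix (Fin n) (Fin n × Fin p) ℝ :=
  Matrix.of fun r kc => (A ^ (kc.1 : ℕ) * B) r kc.2

/-- `(A, B)` is controllable. -/
def IsControllable {n p : ℕ} (A : Matrix (Fin n) (Fin n) ℝ) (B : Matrix (Fin n) (Fin p) ℝ) : Prop :=
  (controllabilityMatrix A B).rank = n

/-- Output `C_i x_i(t)`. -/
def Agents.output {N q : ℕ} (S : Agents N q) (x : (i : Fin N) → ℝ → Vec (S.n i)) (i : Fin N)
    (t : ℝ) : Vec q :=
  Matrix.toEuclideanLin (S.C i) (x i t)

/-! ### The optimization problem -/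

/-- `Y = (y_1, …, y_N)` minimizes `∑ f_i(y_i)` subject to `y_1 = ⋯ = y_N`. -/
def IsOptimalConsensus {N q : ℕ} (f : Fin N → Vec q → ℝ) (Y : Fin N → Vec q) : Prop :=
  IsMinOn (fun Z : Fin N → Vec q => ∑ i, f i (Z i)) {Z | ∀ i j, Z i = Z j} Y ∧ ∀ i j, Y i = Y j

/-! ### The parameters -/

/-- `ε = 1 / (2 √(2 (ξ² + (ξ - 1)²)))`. -/
def epsilon (ξ : ℝ) : ℝ := 1 / (2 * √(2 * (ξ ^ 2 + (ξ - 1) ^ 2)))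

/-- `τ₀ = (w + 1)⁻¹ ln (1 + (w + 1) ε / (w + 1 + √2 Λ + √2 Λ ε))`. -/
def tauZero (w Λ ε : ℝ) : ℝ :=
  1 / (w + 1) * Real.log (1 + (w + 1) * ε / (w + 1 + √2 * Λ + √2 * Λ * ε))

/-! ### Event-triggered closed loop -/

/-- `∑_j a_ij (ŷ_i(t) - ŷ_j(t))`. -/
def disagreement {N q : ℕ} (a : Matrix (Fin N) (Fin N) ℝ) (yhat : Fin N → ℝ → Vec q)
    (i : Fin N) (t : ℝ) : Vec q :=
  ∑ j, a i j • (yhat i t - yhat j t)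

/-- The control input
`u_i = -K_{α_i} x_i + K_{β_i} (-∇f_i(y_i) - ∑_j a_ij (ŷ_i - ŷ_j) - η_i)`. -/
def control {N q : ℕ} (S : Agents N q) (f : Fin N → Vec q → ℝ) (a : Matrix (Fin N) (Fin N) ℝ)
    (Kα : (i : Fin N) → Matrix (Fin (S.p i)) (Fin (S.n i)) ℝ)
    (Kβ : (i : Fin N) → Matrix (Fin (S.p i)) (Fin q) ℝ)
    (x : (i : Fin N) → ℝ → Vec (S.n i)) (η yhat : Fin N → ℝ → Vec q) (i : Fin N) (t : ℝ) :
    Vec (S.p i) :=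
  -Matrix.toEuclideanLin (Kα i) (x i t) +
    Matrix.toEuclideanLin (Kβ i)
      (-gradient (f i) (S.output x i t) - disagreement a yhat i t - η i t)

/-- The threshold `(4 (d_i + κ))⁻¹ ∑_j a_ij ‖v - c_j‖²`, where `v` is the value that agent `i`
broadcast last and `c_j` the value that agent `j` broadcast last. -/
def threshold {N q : ℕ} (a : Matrix (Fin N) (Fin N) ℝ) (κ : ℝ) (i : Fin N) (v : Vec q)
    (c : Fin N → Vec q) : ℝ :=
  1 / (4 * (outDegree a i + κ)) * ∑ j, a i j * ‖v - c j‖ ^ 2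

/-- Agent `i`, which broadcast last at time `s`, sees its squared error `‖y_i(s) - y_i(t)‖²` reach
the threshold at time `t`. If some neighbors broadcast exactly at time `t`, then the threshold jumps
at `t`, and each of these neighbors may be counted with its value just before `t` or with its new
value. -/
def ReachesThreshold {N q : ℕ} (a : Matrix (Fin N) (Fin N) ℝ) (κ : ℝ)
    (y yhat : Fin N → ℝ → Vec q) (i : Fin N) (s t : ℝ) : Prop :=
  ∃ c : Fin N → Vec q,
    (∀ j, c j = yhat j t ∨ (s < t ∧ Tendsto (yhat j) (𝓝[<] t) (𝓝 (c j)))) ∧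
      threshold a κ i (y i s) c ≤ ‖y i s - y i t‖ ^ 2

/-- `τ` is the time that elapses after the broadcast of agent `i` at time `s` until its squared
error first reaches the threshold (`τ = ∞` if it never does; `τ = 0` if the threshold is `0` at
time `s`). -/
def IsFirstReach {N q : ℕ} (a : Matrix (Fin N) (Fin N) ℝ) (κ : ℝ)
    (y yhat : Fin N → ℝ → Vec q) (i : Fin N) (s : ℝ) (τ : ℝ≥0∞) : Prop :=
  (∀ t, s < t → ENNReal.ofReal (t - s) < τ →
      ‖y i s - y i t‖ ^ 2 < threshold a κ i (y i s) fun j => yhat j t) ∧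
    (τ ≠ ∞ → ReachesThreshold a κ y yhat i s (s + τ.toReal))

/-- `(x, η, ŷ)` with broadcast instants `T i 0, T i 1, …` is a run of the event-triggered closed
loop on `[0, ∞)`; `T i k = ∞` means that agent `i` broadcasts fewer than `k + 1` times. As `ŷ` is
right-continuous and piecewise constant, the differential equations hold for the right
derivatives at every time. -/
structure IsEventTriggeredRun {N q : ℕ} (S : Agents N q) (f : Fin N → Vec q → ℝ)
    (a : Matrix (Fin N) (Fin N) ℝ)
    (Kα : (i : Fin N) → Matrix (Fin (S.p i)) (Fin (S.n i)) ℝ)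
    (Kβ : (i : Fin N) → Matrix (Fin (S.p i)) (Fin q) ℝ) (κ Δ : ℝ)
    (x : (i : Fin N) → ℝ → Vec (S.n i)) (η yhat : Fin N → ℝ → Vec q)
    (T : Fin N → ℕ → ℝ≥0∞) : Prop where
  x_cont : ∀ i, ContinuousOn (x i) (Set.Ici 0)
  η_cont : ∀ i, ContinuousOn (η i) (Set.Ici 0)
  x_deriv : ∀ i t, 0 ≤ t →
    HasDerivWithinAt (x i)
      (Matrix.toEuclideanLin (S.A i) (x i t) +
        Matrix.toEuclideanLin (S.B i) (control S f a Kα Kβ x η yhat i t)) (Set.Ici t) t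
  η_deriv : ∀ i t, 0 ≤ t → HasDerivWithinAt (η i) (disagreement a yhat i t) (Set.Ici t) t
  η_zero : ∀ i, η i 0 = 0
  T_zero : ∀ i, T i 0 = 0
  hold : ∀ i k t, 0 ≤ t → T i k ≤ ENNReal.ofReal t → ENNReal.ofReal t < T i (k + 1) →
    yhat i t = S.output x i (T i k).toReal
  T_top : ∀ i k, T i k = ∞ → T i (k + 1) = ∞
  T_succ : ∀ i k, T i k ≠ ∞ →
    ∃ τ : ℝ≥0∞, IsFirstReach a κ (S.output x) yhat i (T i k).toReal τ ∧
      T i (k + 1) = T i k + max τ (ENNReal.ofReal Δ)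

end OptimalConsensus

end

/-! The gain conditions cancel the agents' own dynamics: the outputs obey y' = -∇f(y) - Lŷ - η and
the integrators η' = Lŷ. Shift to the optimum y*, where the gradients sum to zero: Y = y - y*, E = η
+ ∇f(y*), z = ŷ - y*. For a constant m slightly below the given convexity constant, H = ∇f(y) -
∇f(y*) - mY obeys the sector bound ‖H‖² ≤ p⟨Y, H⟩ with p = w - m > 0 (`gradient_sector`).

The broadcast error splits as z = Y + A + B (`exists_errorSplit`). A lives on the intervals between
broadcasts whose length is exactly Δ, where the threshold may be exceeded; B lives on all others,
where the trigger keeps it below the threshold. A storage φ(t - s)‖A‖², s being the last broadcast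
time and φ solving a Riccati inequality, dissipates ρ‖A‖² at the price ν‖Y'‖², with ρ = 5/(8Δ) and ν
= Δ/3; its jumps are harmless because A vanishes after a broadcast. Summed over the agents and
combined with L ≤ 2D, the threshold becomes a bound of ∑ (κ + μ/2) B² by ∑ (μ/2) z² over the
Laplacian modes with eigenvalues μ.

All these bounds are quadratic and diagonal in the Laplacian modes, so the Lyapunov function may be
chosen mode by mode, as Y²/2 + bYE + (c/μ + b)E²/2 plus the storages. Its decay reduces to negative
definiteness of `modeForm` + c·ηz (`network_dissipation`). The weight b is explicit, but c is not: a
quadratic form that is negative definite on the two hyperplanes η = 0 and z = 0 becomes negative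
definite everywhere after adding a suitable multiple of ηz (`exists_add_mul_le_neg`). On each
hyperplane, eliminating h and e leaves a binary form, and only two discriminants have to be
estimated; the bounds on ξ, Δ and κ enter there, as polynomial inequalities collected in
`GainBounds`. Positivity of the Lyapunov function then follows from its decay
(`exists_mode_lower_bound`). In the zero mode E vanishes, since the weights are symmetric and the
gradients at y* sum to zero.

The optimum exists because the sum of the gradients is strongly monotone and Lipschitz; the spacing
of the broadcasts is immediate from the trigger rule. -/

namespace OptimalConsensus

/-! ### The quadratic form that governs one Laplacian mode -/

/-- The part of the dissipation in one mode with eigenvalue `l` that does not depend on the weight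
of `η ŷ` in the Lyapunov function. Here `y, η, z` are the components of the output, of the
integrator state and of the broadcast output, `h` that of the gradient minus `m y`, and `e` that of
the broadcast error of the agents below their threshold. -/
noncomputable def modeForm (m p K ρ ν b l y h η e z : ℝ) : ℝ :=
  -m * y ^ 2 - h ^ 2 / p - (1 - b) * l * y * z - (1 + b * m) * y * η - b * η * h - b * η ^ 2
    + l / 2 * z ^ 2 - K * e ^ 2 - ρ * (z - y - e) ^ 2 + ν * (h + m * y + η + l * z) ^ 2

theorem binary_form_pos {A B C x y : ℝ} (hA : 0 < A) (hB : B ^ 2 < 4 * A * C)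
    (h : A * y ^ 2 + B * x * y + C * x ^ 2 ≤ 0) : y = 0 ∧ x = 0 := by
  have key : (2 * A * y + B * x) ^ 2 + (4 * A * C - B ^ 2) * x ^ 2 ≤ 0 := by nlinarith
  have hx : x = 0 := by
    by_contra hx
    have : 0 < x ^ 2 := by positivity
    nlinarith [sq_nonneg (2 * A * y + B * x), mul_pos (sub_pos.2 hB) this]
  subst hx
  refine ⟨?_, rfl⟩
  by_contra hy
  have : 0 < y ^ 2 := by positivity
  nlinarith

/-- Elimination of `h` and `e` from the mode form on the hyperplane `z = 0`. -/
theorem modeForm_integrator_neg {m p K ρ ν b l q Kh : ℝ} (hp : 0 < p) (hm : 0 < m) (hK : 0 < K)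
    (hρ : 0 < ρ) (hν : 0 < ν) (hνp : ν * p < 1) (hq : q * (1 - ν * p) = p)
    (hKh : Kh * (K + ρ) = K * ρ) (hbν : 2 * ν ≤ b) (hqb : q * b ≤ 2)
    (hA : 0 < m - ν * m ^ 2 * (1 + q * ν) + Kh)
    (hdisc : (1 + b * m) ^ 2 <
      (m - ν * m ^ 2 * (1 + q * ν) + Kh) * (4 * b - 4 * ν - q * b ^ 2))
    {y h η e : ℝ} (h0 : 0 ≤ modeForm m p K ρ ν b l y h η e 0) :
    y = 0 ∧ h = 0 ∧ η = 0 ∧ e = 0 := by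
  have hqpos : 0 < q := by
    have : 0 < 1 - ν * p := by linarith
    by_contra hc
    push Not at hc
    nlinarith
  have hq' : 1 / p - ν = 1 / q := by
    field_simp
    linarith
  have hKρ : 0 < K + ρ := by positivity
  have hb : 0 < b := by linarith
  -- The form is concave in e and h, so squares are completed. In e this turns the weights K and ρ
  -- into their parallel sum `Kh`; in h it turns 1/p - ν into 1/q, and `s` is the coefficient of -h.
  set s := b * η - 2 * ν * (m * y + η) with hs
  have eid : K * e ^ 2 + ρ * (0 - y - e) ^ 2
      = (K + ρ) * (e + ρ * y / (K + ρ)) ^ 2 + Kh * y ^ 2 := by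
    have : Kh = K * ρ / (K + ρ) := by field_simp; linarith
    rw [this]; field_simp; ring
  have hid : h ^ 2 / p - ν * h ^ 2 + s * h = (h + q * s / 2) ^ 2 / q - q / 4 * s ^ 2 := by
    have : h ^ 2 / p - ν * h ^ 2 = h ^ 2 * (1 / q) := by rw [← hq']; ring
    rw [this]; field_simp; ring
  have main : modeForm m p K ρ ν b l y h η e 0 =
      -((K + ρ) * (e + ρ * y / (K + ρ)) ^ 2) - (h + q * s / 2) ^ 2 / q -
      ((m - ν * m ^ 2 * (1 + q * ν) + Kh) * y ^ 2 +
        (1 + b * m - ν * m * (2 - q * (b - 2 * ν))) * η * y +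
        (b - ν - q / 4 * (b - 2 * ν) ^ 2) * η ^ 2) := by
    unfold modeForm
    have e1 := eid
    have e2 := hid
    simp only [hs] at e2 ⊢
    linear_combination -e1 - e2
  have h1 : 0 ≤ (K + ρ) * (e + ρ * y / (K + ρ)) ^ 2 := by positivity
  have h2 : 0 ≤ (h + q * s / 2) ^ 2 / q := by positivity
  -- The ν-correction only shrinks the cross term: it is nonnegative by qb ≤ 2 and at most bm by 2ν
  -- ≤ b.
  have hcross : (1 + b * m - ν * m * (2 - q * (b - 2 * ν))) ^ 2 ≤ (1 + b * m) ^ 2 := by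
    have hqν : 0 < q * ν := by positivity
    have a1 : 0 ≤ 2 - q * (b - 2 * ν) := by linarith
    have a2 : 0 ≤ q * (b - 2 * ν) := mul_nonneg hqpos.le (by linarith)
    have a3 : 0 ≤ ν * m * (2 - q * (b - 2 * ν)) := by positivity
    have a4 : ν * m * (2 - q * (b - 2 * ν)) ≤ ν * m * 2 :=
      mul_le_mul_of_nonneg_left (by linarith) (by positivity)
    have a5 : 2 * ν * m ≤ b * m := mul_le_mul_of_nonneg_right hbν hm.le
    apply pow_le_pow_left₀ <;> linarith
  have hsq : (b - 2 * ν) ^ 2 ≤ b ^ 2 := pow_le_pow_left₀ (by linarith) (by linarith) 2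
  have hC : 4 * b - 4 * ν - q * b ^ 2 ≤ 4 * (b - ν - q / 4 * (b - 2 * ν) ^ 2) := by
    have := mul_le_mul_of_nonneg_left hsq hqpos.le
    linarith
  obtain ⟨rfl, rfl⟩ := binary_form_pos (A := m - ν * m ^ 2 * (1 + q * ν) + Kh)
    (B := 1 + b * m - ν * m * (2 - q * (b - 2 * ν)))
    (C := b - ν - q / 4 * (b - 2 * ν) ^ 2) (x := η) (y := y) hA
    (by
      have := mul_le_mul_of_nonneg_left hC hA.le
      refine hcross.trans_lt (hdisc.trans_le (this.trans (le_of_eq (by ring))))) (by linarith)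
  have hs0 : s = 0 := by simp [hs]
  rw [hs0] at main h2
  simp only [mul_zero, zero_div, add_zero] at main h2 h1
  have hh : h ^ 2 / q = 0 := by linarith
  have he : (K + ρ) * e ^ 2 = 0 := by linarith
  refine ⟨rfl, ?_, rfl, ?_⟩
  · simpa [hqpos.ne'] using hh
  · simpa [hKρ.ne'] using he

/-- Elimination of `h` and `e` from the mode form on the hyperplane `η = 0`. -/
theorem modeForm_broadcast_neg {m p K ρ ν b l q Kh : ℝ} (hp : 0 < p) (hK : 0 < K)
    (hρ : 0 < ρ) (hνp : ν * p < 1) (hq : q * (1 - ν * p) = p)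
    (hKh : Kh * (K + ρ) = K * ρ)
    (hA : 0 < m + l / 2 - b * l - ν * (1 + q * ν) * (m + l) ^ 2)
    (hdisc : (b * l + 2 * (ν * (1 + q * ν)) * l * (m + l)) ^ 2 <
      4 * (m + l / 2 - b * l - ν * (1 + q * ν) * (m + l) ^ 2) *
        (Kh - l / 2 - ν * (1 + q * ν) * l ^ 2))
    {y h e z : ℝ} (h0 : 0 ≤ modeForm m p K ρ ν b l y h 0 e z) :
    y = 0 ∧ h = 0 ∧ e = 0 ∧ z = 0 := by
  have hqpos : 0 < q := by
    have : 0 < 1 - ν * p := by linarith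
    by_contra hc
    push Not at hc
    nlinarith
  have hq' : 1 / p - ν = 1 / q := by
    field_simp
    linarith
  have hKρ : 0 < K + ρ := by positivity
  have eid : K * e ^ 2 + ρ * (z - y - e) ^ 2
      = (K + ρ) * (e - ρ * (z - y) / (K + ρ)) ^ 2 + Kh * (z - y) ^ 2 := by
    have : Kh = K * ρ / (K + ρ) := by field_simp; linarith
    rw [this]; field_simp; ring
  set s := m * y + l * z with hs
  have hid : h ^ 2 / p - ν * h ^ 2 - 2 * ν * s * h
      = (h - q * ν * s) ^ 2 / q - q * ν ^ 2 * s ^ 2 := by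
    have : h ^ 2 / p - ν * h ^ 2 = h ^ 2 * (1 / q) := by rw [← hq']; ring
    rw [this]; field_simp; ring
  have main : modeForm m p K ρ ν b l y h 0 e z =
      -((K + ρ) * (e - ρ * (z - y) / (K + ρ)) ^ 2) - (h - q * ν * s) ^ 2 / q -
      ((m + l / 2 - b * l - ν * (1 + q * ν) * (m + l) ^ 2) * y ^ 2 +
        (-(b * l + 2 * (ν * (1 + q * ν)) * l * (m + l))) * (z - y) * y +
        (Kh - l / 2 - ν * (1 + q * ν) * l ^ 2) * (z - y) ^ 2) := by
    unfold modeForm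
    have e1 := eid
    have e2 := hid
    simp only [hs] at e2 ⊢
    linear_combination -e1 - e2
  have h1 : 0 ≤ (K + ρ) * (e - ρ * (z - y) / (K + ρ)) ^ 2 := by positivity
  have h2 : 0 ≤ (h - q * ν * s) ^ 2 / q := by positivity
  obtain ⟨rfl, hz⟩ := binary_form_pos (x := z - y) (y := y) hA
    (by rw [neg_sq]; exact hdisc) (by linarith)
  rw [sub_zero] at hz
  subst hz
  have hs0 : s = 0 := by simp [hs]
  rw [hs0] at main h2
  simp only [mul_zero, zero_div, sub_zero] at main h2 h1
  have hh : h ^ 2 / q = 0 := by linarith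
  have he : (K + ρ) * e ^ 2 = 0 := by linarith
  refine ⟨rfl, ?_, ?_, rfl⟩
  · simpa [hqpos.ne'] using hh
  · simpa [hKρ.ne'] using he

end OptimalConsensus

namespace OptimalConsensus

/-! ### Admissible parameters make the mode form negative definite -/

/-- The relations between the convexity constants `m < w`, the trigger parameter `κ`, an eigenvalue
`l` and the dwell time `Δ` that the stability proof uses. -/
structure GainBounds (m w κ l Δ : ℝ) : Prop where
  m_pos : 0 < m
  m_lt : m < w
  half_le : 1 / 2 ≤ κ
  sq_le : w ^ 2 ≤ 4 * m * κ
  tight : κ = 1 / 2 ∨ 4 * m * κ = w ^ 2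
  l_nonneg : 0 ≤ l
  Δ_pos : 0 < Δ
  dwell : Δ * ((1 + 4 * w ^ 2 + 2 * l ^ 2) * (1 + w + 1.4 * l)) ≤ 2.83 * m

/-- Reciprocal of the cross weight of the Lyapunov function in the limit `Δ → 0`. -/
noncomputable def crossGain (m w κ l : ℝ) : ℝ := 4 * κ + 2 * l - 0.4 * (w - m)

theorem drift_poly {w l : ℝ} (hw : 0 ≤ w) (hl : 0 ≤ l) :
    2.83 * (0.85 * l + 0.342 * (w + l) ^ 2) ≤
      0.59 * ((1 + 4 * w ^ 2 + 2 * l ^ 2) * (1 + w + 1.4 * l)) := by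
  nlinarith [mul_nonneg hw (sq_nonneg (w - 0.56)), mul_nonneg hl (sq_nonneg (w - 0.56)),
    mul_nonneg hw (sq_nonneg (l - 0.5)), mul_nonneg hl (sq_nonneg (l - 0.5)), mul_nonneg hl hw,
    sq_nonneg (w - 0.56), sq_nonneg (l - 0.5), sq_nonneg (w - 0.8 * l),
    mul_nonneg hl (sq_nonneg w), mul_nonneg hw (sq_nonneg l)]

namespace GainBounds

variable {m w κ l Δ : ℝ}

theorem w_pos (H : GainBounds m w κ l Δ) : 0 < w := H.m_pos.trans H.m_lt

theorem Q_pos (H : GainBounds m w κ l Δ) :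
    0 < (1 + 4 * w ^ 2 + 2 * l ^ 2) * (1 + w + 1.4 * l) := by
  have := H.w_pos; have := H.l_nonneg; positivity

/-- Eliminates Δ: the dwell bound reduces every estimate Δa ≤ c to a polynomial inequality in m, w,
l and κ. -/
theorem le_of_mul (H : GainBounds m w κ l Δ) {a c : ℝ} (ha : 0 ≤ a)
    (h : 2.83 * (m * a) ≤ c * ((1 + 4 * w ^ 2 + 2 * l ^ 2) * (1 + w + 1.4 * l))) :
    Δ * a ≤ c := by
  have h1 := mul_le_mul_of_nonneg_right H.dwell ha
  refine le_of_mul_le_mul_right ?_ H.Q_pos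
  linarith

/-- By the arithmetic-geometric mean inequality 4m(w - m) ≤ w², and w² ≤ 4mκ. -/
theorem sub_le (H : GainBounds m w κ l Δ) : w - m ≤ κ := by
  have h1 := H.sq_le
  have h2 : 4 * m * (w - m) ≤ 4 * m * κ := by nlinarith [sq_nonneg (w - 2 * m)]
  exact le_of_mul_le_mul_left h2 (by linarith [H.m_pos])

theorem crossGain_ge (H : GainBounds m w κ l Δ) : 3.6 * κ + 2 * l ≤ crossGain m w κ l := by
  have := H.sub_le
  unfold crossGain
  linarith

theorem crossGain_pos (H : GainBounds m w κ l Δ) : 0 < crossGain m w κ l := by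
  have := H.crossGain_ge; have := H.half_le; have := H.l_nonneg
  linarith

theorem w_le_crossGain (H : GainBounds m w κ l Δ) : w ≤ crossGain m w κ l := by
  have h0 := H.m_pos
  have h1 : m * w ≤ m * (4 * κ - 0.4 * (w - m)) := by
    nlinarith [H.sq_le, mul_pos H.w_pos (sub_pos.2 H.m_lt),
      mul_pos (sub_pos.2 H.m_lt) (sub_pos.2 H.m_lt)]
  have h2 := le_of_mul_le_mul_left h1 h0
  have := H.l_nonneg
  unfold crossGain
  linarith

theorem sub_mul_Δ_le (H : GainBounds m w κ l Δ) : Δ * (w - m) ≤ 0.073 := by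
  have hw := H.w_pos.le
  have hl := H.l_nonneg
  apply H.le_of_mul (sub_nonneg.2 H.m_lt.le)
  have h1 : 2.83 * (m * (w - m)) ≤ 0.7075 * w ^ 2 := by nlinarith [sq_nonneg (w - 2 * m)]
  have h2 : 0.7075 * w ^ 2 ≤ 0.073 * ((1 + 4 * w ^ 2) * (1 + w)) := by
    nlinarith [mul_nonneg hw (sq_nonneg (w - 0.88)), sq_nonneg (w - 0.88)]
  have h3 : (1 + 4 * w ^ 2) * (1 + w) ≤ (1 + 4 * w ^ 2 + 2 * l ^ 2) * (1 + w + 1.4 * l) := by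
    exact mul_le_mul (by nlinarith [sq_nonneg l]) (by linarith) (by positivity) (by positivity)
  linarith

theorem w_mul_Δ_le (H : GainBounds m w κ l Δ) : Δ * w ≤ 0.29 := by
  have hw := H.w_pos.le
  have hl := H.l_nonneg
  apply H.le_of_mul hw
  have h1 : m * w ≤ w ^ 2 := by nlinarith [H.m_lt]
  -- The quotient (1 + 4w²)(1 + w)/w² has its minimum, about 9.95, near w = 0.9; the squares in the
  -- hint are centred close to it.
  have h2 : 2.83 * w ^ 2 ≤ 0.29 * ((1 + 4 * w ^ 2) * (1 + w)) := by
    nlinarith [mul_nonneg hw (sq_nonneg (w - 0.88)), sq_nonneg (w - 0.88)]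
  have h3 : (1 + 4 * w ^ 2) * (1 + w) ≤ (1 + 4 * w ^ 2 + 2 * l ^ 2) * (1 + w + 1.4 * l) := by
    exact mul_le_mul (by nlinarith [sq_nonneg l]) (by linarith) (by positivity) (by positivity)
  linarith

theorem l_mul_Δ_le (H : GainBounds m w κ l Δ) : Δ * l ≤ 0.14 := by
  have hw := H.w_pos.le
  have hl := H.l_nonneg
  apply H.le_of_mul hl
  have h1 : m * l ≤ w * l := by nlinarith [H.m_lt]
  have h2 : 2.83 * w * l ≤ 0.14 * ((1 + 4 * w ^ 2 + 2 * l ^ 2) * (1 + w + 1.4 * l)) := by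
    nlinarith [mul_nonneg hw (sq_nonneg (w - 0.56)), mul_nonneg hl (sq_nonneg (w - 0.56)),
      mul_nonneg hw (sq_nonneg (l - 0.7)), mul_nonneg hl (sq_nonneg (l - 0.7)), mul_nonneg hl hw,
      sq_nonneg (w - 0.56), sq_nonneg (l - 0.7), sq_nonneg (w - 0.8 * l)]
  linarith

/-- `m · crossGain` in the two regimes of `κ`. -/
theorem m_mul_crossGain_le (H : GainBounds m w κ l Δ) :
    (w ≤ 2 ∧ m * crossGain m w κ l ≤ 2 * m * (1 + l)) ∨
      m * crossGain m w κ l ≤ w ^ 2 + 2 * w * l := by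
  have h0 := H.m_pos
  have h1 := H.m_lt
  have h2 := H.l_nonneg
  have h3 := H.sq_le
  have h5 : 0 ≤ m * (w - m) := mul_nonneg h0.le (by linarith)
  unfold crossGain
  rcases H.tight with hk | hk
  · left
    -- With κ = 1/2 the sector condition reads w² ≤ 2m < 2w, whence w ≤ 2.
    subst hk
    constructor
    · by_contra hc
      nlinarith
    · nlinarith
  · right
    nlinarith [mul_nonneg (sub_nonneg.2 h1.le) h2]

theorem crossGain_mul_Δ_le (H : GainBounds m w κ l Δ) : Δ * crossGain m w κ l ≤ 1 := by
  have hw := H.w_pos.le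
  have hl := H.l_nonneg
  apply H.le_of_mul H.crossGain_pos.le
  rcases H.m_mul_crossGain_le with ⟨-, h⟩ | h
  · have h1 : m * (1 + l) ≤ w * (1 + l) := by nlinarith [H.m_lt]
    have : 5.66 * w * (1 + l) ≤ (1 + 4 * w ^ 2 + 2 * l ^ 2) * (1 + w + 1.4 * l) := by
      nlinarith [mul_nonneg hw (sq_nonneg (w - 0.42)), sq_nonneg (w - 0.42),
        mul_nonneg hl (sq_nonneg (w - 0.42)), mul_nonneg hw (sq_nonneg (l - 0.5)),
        mul_nonneg hl (sq_nonneg (l - 0.5)), mul_nonneg hl hw, sq_nonneg (w - l),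
        sq_nonneg (w - 0.42 - l), mul_nonneg hl (sq_nonneg (w - 0.6))]
    linarith
  · have : 2.83 * (w ^ 2 + 2 * w * l) ≤ (1 + 4 * w ^ 2 + 2 * l ^ 2) * (1 + w + 1.4 * l) := by
      nlinarith [mul_nonneg hw (sq_nonneg (w - 0.42)), sq_nonneg (w - l),
        mul_nonneg hl (sq_nonneg (w - 0.5)), mul_nonneg hw (sq_nonneg (l - 1)),
        mul_nonneg hl (sq_nonneg (l - 0.5)), mul_nonneg hl hw]
    linarith

/-- This is the hypothesis u·e ≤ 1.3 of `secant_bound`, with u = Δ·`crossGain` and e the relative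
growth rate of the cross term on the hyperplane η = 0. -/
theorem crossGain_mul_Δ_mul_le (H : GainBounds m w κ l Δ) :
    Δ * crossGain m w κ l * (0.85 + 0.684 * (m + l)) ≤ 1.3 := by
  have hw := H.w_pos.le
  have hl := H.l_nonneg
  have hm := H.m_pos
  rw [mul_assoc]
  have e1 : 0 ≤ 0.85 + 0.684 * (m + l) := by positivity
  have e2 : 0.85 + 0.684 * (m + l) ≤ 0.85 + 0.684 * (w + l) := by linarith [H.m_lt]
  apply H.le_of_mul (mul_nonneg H.crossGain_pos.le e1)
  rcases H.m_mul_crossGain_le with ⟨-, h⟩ | h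
  · have h1 : m * (1 + l) ≤ w * (1 + l) := by nlinarith [H.m_lt]
    have h2 : (m * crossGain m w κ l) * (0.85 + 0.684 * (m + l)) ≤
        (2 * w * (1 + l)) * (0.85 + 0.684 * (w + l)) :=
      mul_le_mul (by linarith) e2 e1 (by positivity)
    have : 5.66 * w * (1 + l) * (0.85 + 0.684 * (w + l)) ≤
        1.3 * ((1 + 4 * w ^ 2 + 2 * l ^ 2) * (1 + w + 1.4 * l)) := by
      nlinarith [mul_nonneg hw (sq_nonneg (w - 0.5)), sq_nonneg (w - 0.45),
        mul_nonneg hl (sq_nonneg (w - 0.42)), mul_nonneg hw (sq_nonneg (l - 0.5)),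
        mul_nonneg hl (sq_nonneg (l - 0.5)), mul_nonneg hl hw, sq_nonneg (w - l),
        sq_nonneg (w - 0.42 - l), mul_nonneg hl (sq_nonneg (w - l)),
        mul_nonneg hl (sq_nonneg (w - 0.6)), mul_nonneg hw (sq_nonneg (w - l)),
        mul_nonneg hw (sq_nonneg (w - 0.5 - l)), mul_nonneg hl (sq_nonneg (w - 0.5 - l))]
    linarith
  · have h2 : (m * crossGain m w κ l) * (0.85 + 0.684 * (m + l)) ≤
        (w ^ 2 + 2 * w * l) * (0.85 + 0.684 * (w + l)) :=
      mul_le_mul h e2 e1 (by positivity)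
    have : 2.83 * (w ^ 2 + 2 * w * l) * (0.85 + 0.684 * (w + l)) ≤
        1.3 * ((1 + 4 * w ^ 2 + 2 * l ^ 2) * (1 + w + 1.4 * l)) := by
      nlinarith [mul_nonneg hw (sq_nonneg (w - 0.5)), sq_nonneg (w - 0.45),
        mul_nonneg hl (sq_nonneg (w - 0.42)), mul_nonneg hw (sq_nonneg (l - 0.5)),
        mul_nonneg hl (sq_nonneg (l - 0.5)), mul_nonneg hl hw, sq_nonneg (w - l),
        sq_nonneg (w - 0.42 - l), mul_nonneg hl (sq_nonneg (w - l)),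
        mul_nonneg hl (sq_nonneg (w - 0.6)), mul_nonneg hw (sq_nonneg (w - l)),
        mul_nonneg hw (sq_nonneg (w - 0.5 - l)), mul_nonneg hl (sq_nonneg (w - 0.5 - l))]
    linarith

/-- On the hyperplane η = 0 a positive dwell time lowers the coefficient of y² by at most the
left-hand side, so 0.41·m of the damping m survives. -/
theorem drift_loss_le (H : GainBounds m w κ l Δ) :
    Δ * (0.85 * l + 0.342 * (m + l) ^ 2) ≤ 0.59 * m := by
  have hw := H.w_pos.le
  have hl := H.l_nonneg
  have hm := H.m_pos
  apply H.le_of_mul (by positivity)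
  have h1 : (m + l) ^ 2 ≤ (w + l) ^ 2 := by gcongr; exact H.m_lt.le
  have h2 := drift_poly hw hl
  have h3 : 2.83 * (0.85 * l + 0.342 * (m + l) ^ 2) ≤
      0.59 * ((1 + 4 * w ^ 2 + 2 * l ^ 2) * (1 + w + 1.4 * l)) := by linarith
  have := mul_le_mul_of_nonneg_left h3 hm.le
  linarith

/-- On the hyperplane η = 0 the coefficient of (z - y)², multiplied by 1 + 1.6KΔ with K = κ + l/2,
tends to κ as Δ → 0. The left-hand side bounds what the dwell time takes away, so 0.6·κ survives. -/
theorem error_loss_le (H : GainBounds m w κ l Δ) :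
    0.877 * κ * (Δ * l) + 0.7805 * (Δ * l ^ 2) ≤ 0.4 * κ := by
  have hw := H.w_pos.le
  have hl := H.l_nonneg
  have hm := H.m_pos
  have hk := H.half_le
  have hmw := H.m_lt
  have : Δ * (0.877 * κ * l + 0.7805 * l ^ 2) ≤ 0.4 * κ := by
    apply H.le_of_mul (by positivity)
    have hml : m * l ≤ w * l := by nlinarith
    rcases le_total w 2 with h2 | h2
    · have h1 : 2.83 * (0.877 * w * l + 0.7805 * l ^ 2 * (2 * w)) ≤
          0.4 * ((1 + 4 * w ^ 2 + 2 * l ^ 2) * (1 + w + 1.4 * l)) := by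
        nlinarith [mul_nonneg hl (sq_nonneg (w - 0.5 * l)), mul_nonneg hw (sq_nonneg (w - 0.5 * l)),
          mul_nonneg hl hw, mul_nonneg (mul_nonneg hl hw) (sub_nonneg.2 h2),
          mul_nonneg (mul_nonneg hl hl) (sub_nonneg.2 h2), mul_nonneg hl (sq_nonneg (l - 4)),
          mul_nonneg hl (sq_nonneg (w - 2)), sq_nonneg (w - 0.5 * l)]
      have h3 := mul_le_mul_of_nonneg_left h1 (by linarith : (0 : ℝ) ≤ κ)
      have h4 : m * l ^ 2 ≤ κ * (l ^ 2 * (2 * w)) := by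
        have : m ≤ κ * (2 * w) := by nlinarith
        nlinarith [mul_le_mul_of_nonneg_right this (sq_nonneg l)]
      have h5 := mul_le_mul_of_nonneg_left hml (by linarith : (0 : ℝ) ≤ κ)
      linarith
    · have h1 : 2.83 * (0.877 * w * l + 0.7805 * l ^ 2 * 4) ≤
          0.4 * ((1 + 4 * w ^ 2 + 2 * l ^ 2) * (1 + w + 1.4 * l)) := by
        nlinarith [mul_nonneg hl (sq_nonneg (w - 0.5 * l)), mul_nonneg hw (sq_nonneg (w - 0.5 * l)),
          mul_nonneg hl hw, mul_nonneg (mul_nonneg hl hw) (sub_nonneg.2 h2),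
          mul_nonneg (mul_nonneg hl hl) (sub_nonneg.2 h2), mul_nonneg hl (sq_nonneg (l - 4)),
          mul_nonneg hl (sq_nonneg (w - 2)), sq_nonneg (w - 0.5 * l)]
      have h3 := mul_le_mul_of_nonneg_left h1 (by linarith : (0 : ℝ) ≤ κ)
      have h4 : m * l ^ 2 ≤ κ * (l ^ 2 * 4) := by
        have : m ≤ κ * 4 := by
          have : m * m ≤ m * (κ * 4) := by nlinarith [H.sq_le]
          exact le_of_mul_le_mul_left this hm
        nlinarith [mul_le_mul_of_nonneg_right this (sq_nonneg l)]
      have h5 := mul_le_mul_of_nonneg_left hml (by linarith : (0 : ℝ) ≤ κ)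
      linarith
  linarith

end GainBounds

end OptimalConsensus

/-! ### Numerical estimates for the discriminant on the hyperplane η = 0 -/

namespace OptimalConsensus

/-- Polynomial core of `secant_le` for w ≤ 2. The factor 5.66·w(1 + l) is the bound of
Δ·`crossGain`·(1 + 4w² + 2l²)(1 + w + 1.4l) available in that range. -/
theorem broadcast_poly_small {w l : ℝ} (hw : 0 ≤ w) (hl : 0 ≤ l) :
    (4.5 + 3.27 * (w + l)) * l ^ 2 * (5.66 * w * (1 + l)) ≤
      (0.3 * (0.9 + l) * (5.66 * w * (1 + l)) + (0.728 + 1.92 * l) * l ^ 2) *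
        ((1 + 4 * w ^ 2 + 2 * l ^ 2) * (1 + w + 1.4 * l)) := by
  have hlw := mul_nonneg hl hw
  have hl2 := mul_nonneg hl hl
  have hl3 := mul_nonneg hl2 hl
  nlinarith [mul_nonneg hlw (sq_nonneg (l - 0.7)), mul_nonneg hlw (sq_nonneg (w - 0.33)),
    mul_nonneg hl3 (sq_nonneg (w - 0.33)), mul_nonneg hl2 (sq_nonneg (w - 0.33)),
    mul_nonneg hl2 (sq_nonneg (l - 0.7)), mul_nonneg (mul_nonneg hl2 hw) (sq_nonneg (l - 0.7)),
    mul_nonneg (mul_nonneg hl3 hw) (sq_nonneg (l - 0.7)), mul_nonneg hl2 (sq_nonneg (w - 0.5 * l)),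
    mul_nonneg hl3 (sq_nonneg (w - 0.5 * l)), mul_nonneg hlw (sq_nonneg (w - 0.5 * l)),
    mul_nonneg hl2 hw, mul_nonneg hl3 hw, mul_nonneg hlw hlw, mul_nonneg hlw hw,
    mul_nonneg hw (sq_nonneg (l - 0.7)), mul_nonneg hw (sq_nonneg (w - 0.33)),
    mul_nonneg (mul_nonneg hl3 hw) (sq_nonneg (w - 0.5 * l)),
    mul_nonneg (mul_nonneg hl2 hw) (sq_nonneg (w - 0.5 * l)),
    mul_nonneg hl3 (mul_nonneg hlw hw), mul_nonneg hl2 (mul_nonneg hlw hw)]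

theorem broadcast_poly_large {w l : ℝ} (hl : 0 ≤ l) (h2 : 2 ≤ w) :
    (4.5 + 3.27 * (w + l)) * l ^ 2 ≤
      0.3 * (0.9 + l) * ((1 + 4 * w ^ 2 + 2 * l ^ 2) * (1 + w + 1.4 * l)) := by
  have hw : 0 ≤ w := by linarith
  nlinarith [mul_nonneg hl (sq_nonneg (w - 0.5 * l)), mul_nonneg hw (sq_nonneg (w - 0.5 * l)),
    mul_nonneg hl hw, mul_nonneg (mul_nonneg hl hw) (sub_nonneg.2 h2),
    mul_nonneg (mul_nonneg hl hl) (sub_nonneg.2 h2),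
    mul_nonneg (mul_nonneg hl hl) (sq_nonneg (l - 3.2)), mul_nonneg hl (sq_nonneg (l - 3.2)),
    mul_nonneg hl (sq_nonneg (w - 2)), sq_nonneg (w - 0.5 * l),
    mul_nonneg (mul_nonneg hl hl) (mul_nonneg hl hw),
    mul_nonneg (mul_nonneg hl hw) (mul_nonneg hl hw)]

/-- A cubic in `u` is at most its secant. -/
theorem secant_bound {u e : ℝ} (hu : 0 ≤ u) (hu1 : u ≤ 1) (he : 0 ≤ e) (heu : u * e ≤ 1.3) :
    (1 + 0.4445 * u) * (1 + u * e) ^ 2 ≤ 1 + u * (0.4445 + 4.768 * e) := by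
  -- After expansion the factor of u·e is 2 + 0.889u + ue + 0.4445u·ue, which is at most 4.768 when
  -- u ≤ 1 and ue ≤ 1.3.
  have h0 : 0 ≤ u * e := mul_nonneg hu he
  have h1 : (u * e) * (u * e) ≤ 1.3 * (u * e) := mul_le_mul_of_nonneg_right heu h0
  have h2 : (u * e) * u ≤ (u * e) * 1 := mul_le_mul_of_nonneg_left hu1 h0
  have h3 : (u * e) * (u * e) * u ≤ 1.3 * (u * e) * u := mul_le_mul_of_nonneg_right h1 hu
  nlinarith

namespace GainBounds

variable {m w κ l Δ : ℝ}

theorem secant_le (H : GainBounds m w κ l Δ) :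
    Δ * crossGain m w κ l * ((4.5 + 3.27 * (m + l)) * l ^ 2) ≤
      0.3 * (0.9 + l) * (Δ * crossGain m w κ l *
        ((1 + 4 * w ^ 2 + 2 * l ^ 2) * (1 + w + 1.4 * l))) + (0.728 + 1.92 * l) * l ^ 2 := by
  have hw := H.w_pos
  have hl := H.l_nonneg
  have hm := H.m_pos
  have hmw := H.m_lt
  have hg := H.crossGain_pos
  have hu : 0 < Δ * crossGain m w κ l := mul_pos H.Δ_pos hg
  have hS : (4.5 + 3.27 * (m + l)) * l ^ 2 ≤ (4.5 + 3.27 * (w + l)) * l ^ 2 :=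
    mul_le_mul_of_nonneg_right (by linarith) (sq_nonneg l)
  have huS := mul_le_mul_of_nonneg_left hS hu.le
  refine huS.trans ?_
  rcases le_total w 2 with h2 | h2
  · have hmg : m * crossGain m w κ l ≤ 2 * w * (1 + l) := by
      -- For w ≤ 2 both regimes of κ give the same bound, as w² + 2wl ≤ 2w(1 + l).
      rcases H.m_mul_crossGain_le with ⟨-, h⟩ | h
      · nlinarith
      · nlinarith
    have hX : 0 < 5.66 * w * (1 + l) := by positivity
    have huQ : Δ * crossGain m w κ l * ((1 + 4 * w ^ 2 + 2 * l ^ 2) * (1 + w + 1.4 * l)) ≤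
        5.66 * w * (1 + l) := by
      have := mul_le_mul_of_nonneg_right H.dwell hg.le
      linarith
    have h3 := mul_le_mul_of_nonneg_left (broadcast_poly_small hw.le hl) hu.le
    have h4 := mul_le_mul_of_nonneg_left huQ
      (by positivity : (0 : ℝ) ≤ (0.728 + 1.92 * l) * l ^ 2)
    refine le_of_mul_le_mul_right ?_ hX
    linarith
  · have h3 := mul_le_mul_of_nonneg_left (broadcast_poly_large hl h2) hu.le
    have : 0 ≤ (0.728 + 1.92 * l) * l ^ 2 := by positivity
    linarith

/-- The discriminant condition on η = 0, multiplied by (1 + 1.6KΔ)·`crossGain`², after all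
coefficients have been replaced by their bounds. It comes from `secant_le`: the dwell bound gives
0.8496·m·`crossGain`, where 0.8496 = 2.4·0.354, and 0.728 + 1.92l is 2.4·0.8·(0.9 + l) - 1. -/
theorem weighted_secant_lt (H : GainBounds m w κ l Δ) :
    (1 + Δ * crossGain m w κ l * (4.5 + 3.27 * (m + l))) * l ^ 2 <
      2.4 * (0.9 + l) * (0.354 * (m * crossGain m w κ l) + 0.8 * l ^ 2) := by
  have hl := H.l_nonneg
  have hg := H.crossGain_pos
  have hu : 0 < Δ * crossGain m w κ l := mul_pos H.Δ_pos hg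
  have h1 := H.secant_le
  have h2 := mul_le_mul_of_nonneg_right H.dwell hg.le
  have h3 : 0 < Δ * crossGain m w κ l * ((1 + 4 * w ^ 2 + 2 * l ^ 2) * (1 + w + 1.4 * l)) :=
    mul_pos hu H.Q_pos
  have h4 : 0.3 * (Δ * crossGain m w κ l *
      ((1 + 4 * w ^ 2 + 2 * l ^ 2) * (1 + w + 1.4 * l))) < 0.8496 * (m * crossGain m w κ l) := by
    linarith
  have h5 := mul_lt_mul_of_pos_left h4 (by linarith : 0 < 0.9 + l)
  linarith

end GainBounds

end OptimalConsensus

/-! ### The cross weight and negativity on the two hyperplanes -/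

namespace OptimalConsensus

/-- The cross weight of the Lyapunov function in a mode with eigenvalue `l`. -/
noncomputable def crossWeight (m w κ l Δ : ℝ) : ℝ := 1 / crossGain m w κ l + 0.85 * Δ

namespace GainBounds

variable {m w κ l Δ : ℝ}

theorem inv_mul_sub_le (H : GainBounds m w κ l Δ) :
    (w - m) * (1 / crossGain m w κ l) ≤ 0.278 := by
  rw [mul_one_div, div_le_iff₀ H.crossGain_pos]
  have := H.crossGain_ge; have := H.sub_le; have := H.l_nonneg; have := H.half_le
  linarith

theorem Δ_le_inv (H : GainBounds m w κ l Δ) : Δ ≤ 1 / crossGain m w κ l := by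
  rw [le_div_iff₀ H.crossGain_pos]
  exact H.crossGain_mul_Δ_le

/-- The sector slack `q = p / (1 - ν p)` with `p = w - m` and `ν = Δ / 3`. -/
theorem sector_slack (H : GainBounds m w κ l Δ) {q : ℝ}
    (hq : q * (1 - Δ / 3 * (w - m)) = w - m) :
    0 < q ∧ q ≤ 1.025 * (w - m) ∧ q * (Δ / 3) ≤ 0.025 ∧
      q ≤ (w - m) + 0.342 * Δ * (w - m) ^ 2 := by
  have h1 := H.sub_mul_Δ_le
  have hp : 0 < w - m := sub_pos.2 H.m_lt
  have hΔ := H.Δ_pos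
  have hden : 0 < 1 - Δ / 3 * (w - m) := by linarith
  have hqpos : 0 < q := by
    by_contra hc
    push Not at hc
    nlinarith
  have h2 : q ≤ 1.025 * (w - m) := by nlinarith
  have h3 : q * Δ ≤ 1.025 * (w - m) * Δ := mul_le_mul_of_nonneg_right h2 hΔ.le
  refine ⟨hqpos, h2, by nlinarith, ?_⟩
  have h4 : q * Δ * (w - m) ≤ 1.025 * (w - m) * Δ * (w - m) :=
    mul_le_mul_of_nonneg_right h3 hp.le
  have h5 : 0 ≤ Δ * (w - m) ^ 2 := by positivity
  linarith

/-- The left-hand side is the reciprocal of the parallel sum of K = κ + l/2 and 5/(8Δ). For Δ → 0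
the claim is 1/K < 4b - pb². With g = 1/b = 4K - 0.4p it becomes pK < g(4K - g) = 0.4pg, which holds
since g > 2.5K; a smaller b is preferable on the other hyperplane. For Δ > 0 the summand 0.85Δ of
the cross weight gains 3.4Δ, which covers 1.6Δ, 4Δ/3 and the remaining corrections. -/
theorem integrator_gain_lt (H : GainBounds m w κ l Δ) {q : ℝ}
    (hq : q * (1 - Δ / 3 * (w - m)) = w - m) :
    1 / (κ + l / 2) + 1.6 * Δ <
      4 * crossWeight m w κ l Δ - 4 * (Δ / 3) - q * crossWeight m w κ l Δ ^ 2 := by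
  obtain ⟨hq0, hq1, hq2, hq3⟩ := H.sector_slack hq
  have hz := H.inv_mul_sub_le
  have hbΔ := H.Δ_le_inv
  have hp : 0 < w - m := sub_pos.2 H.m_lt
  have hΔ := H.Δ_pos
  have hg := H.crossGain_pos
  have hK : 0 < κ + l / 2 := by linarith [H.half_le, H.l_nonneg]
  set b := 1 / crossGain m w κ l with hb
  set k := 1 / (κ + l / 2) with hk
  have hbpos : 0 < b := by positivity
  have hkpos : 0 < k := by positivity
  have hrel : k = 4 * b - 0.4 * ((w - m) * b) * k := by
    have e1 : (κ + l / 2) * k = 1 := mul_one_div_cancel hK.ne'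
    have e2 : crossGain m w κ l * b = 1 := mul_one_div_cancel hg.ne'
    unfold crossGain at e2
    linear_combination 4 * b * e1 - k * e2
  set z := (w - m) * b with hzdef
  have hz0 : 0 < z := by positivity
  have hk36 : 3.59 * b ≤ k := by nlinarith
  have t1 : 1.436 * z * b ≤ 4 * b - k := by nlinarith
  have t2 : q * b ^ 2 ≤ z * b + 0.342 * Δ * z ^ 2 := by
    have := mul_le_mul_of_nonneg_right hq3 (sq_nonneg b)
    have e : (w - m + 0.342 * Δ * (w - m) ^ 2) * b ^ 2 = z * b + 0.342 * Δ * z ^ 2 := by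
      rw [hzdef]; ring
    linarith
  have t3 : q * b ≤ 1.025 * z := by
    have := mul_le_mul_of_nonneg_right hq1 hbpos.le
    rw [hzdef]; linarith
  have t4 : q * b * Δ ≤ 1.025 * z * Δ := mul_le_mul_of_nonneg_right t3 hΔ.le
  have t5 : q * Δ ^ 2 ≤ 0.075 * Δ := by
    have := mul_le_mul_of_nonneg_right hq2 hΔ.le
    linarith
  have t6 : Δ * z ^ 2 ≤ 0.0773 * Δ := by
    have : z ^ 2 ≤ 0.0773 := by nlinarith
    nlinarith
  have t7 : z * Δ ≤ z * b := mul_le_mul_of_nonneg_left hbΔ hz0.le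
  have t8 : z * Δ ≤ 0.278 * Δ := mul_le_mul_of_nonneg_right hz hΔ.le
  have hexp : q * crossWeight m w κ l Δ ^ 2 =
      q * b ^ 2 + 1.7 * (q * b * Δ) + 0.7225 * (q * Δ ^ 2) := by
    rw [crossWeight, ← hb]; ring
  rw [hexp, crossWeight, ← hb]
  linarith

theorem crossWeight_pos (H : GainBounds m w κ l Δ) : 0 < crossWeight m w κ l Δ := by
  have := H.crossGain_pos; have := H.Δ_pos
  unfold crossWeight; positivity

/-- After multiplication by m, this says that the m-dependent terms of the discriminant on z = 0 do
no harm. What remains to check there is that the parallel sum times the gain of `integrator_gain_lt`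
exceeds 1. -/
theorem crossWeight_loss_le (H : GainBounds m w κ l Δ) {q : ℝ}
    (hq : q * (1 - Δ / 3 * (w - m)) = w - m) :
    4 * (Δ / 3) ≤ crossWeight m w κ l Δ *
      (2 - crossWeight m w κ l Δ * (m + q) - 4 * (Δ / 3) * (1 + q * (Δ / 3)) * m) := by
  obtain ⟨hq0, hq1, hq2, hq3⟩ := H.sector_slack hq
  have hz := H.inv_mul_sub_le
  have hbΔ := H.Δ_le_inv
  have hp : 0 < w - m := sub_pos.2 H.m_lt
  have hΔ := H.Δ_pos
  have hg := H.crossGain_pos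
  have hm := H.m_pos
  have hw := H.w_pos
  have hΔp := H.sub_mul_Δ_le
  have hΔw := H.w_mul_Δ_le
  have hs : 1 / crossGain m w κ l * w ≤ 1 := by
    rw [one_div_mul_eq_div, div_le_one hg]; exact H.w_le_crossGain
  have hcw : crossWeight m w κ l Δ = 1 / crossGain m w κ l + 0.85 * Δ := rfl
  set b := 1 / crossGain m w κ l with hb
  have hbpos : 0 < b := by positivity
  set B := crossWeight m w κ l Δ
  have hBpos : 0 < B := H.crossWeight_pos
  have t1 : B * (m + q) ≤ b * w + 0.2465 + 0.0086 := by
    have a1 : B * (m + q) ≤ B * (w + 0.342 * Δ * (w - m) ^ 2) :=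
      mul_le_mul_of_nonneg_left (by linarith) hBpos.le
    have a2 : B * (w - m) ≤ 0.3401 := by rw [hcw]; nlinarith
    have a3 : B * (w - m) * (Δ * (w - m)) ≤ 0.3401 * 0.073 :=
      mul_le_mul a2 hΔp (by positivity) (by norm_num)
    have a4 : B * w ≤ b * w + 0.2465 := by rw [hcw]; nlinarith
    nlinarith
  have t2 : 4 * (Δ / 3) * (1 + q * (Δ / 3)) * m ≤ 0.3965 := by
    have a1 : Δ * m ≤ 0.29 := by nlinarith [H.m_lt]
    have a2 : (Δ * m) * (1 + q * (Δ / 3)) ≤ 0.29 * 1.025 :=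
      mul_le_mul a1 (by linarith) (by positivity) (by norm_num)
    nlinarith
  have t3 : B * (1.348 - b * w) ≤ B * (2 - B * (m + q) - 4 * (Δ / 3) * (1 + q * (Δ / 3)) * m) :=
    mul_le_mul_of_nonneg_left (by linarith) hBpos.le
  refine le_trans ?_ t3
  rw [hcw]
  have t4 : 0 ≤ (1 - b * w) * (b - Δ) := mul_nonneg (by linarith) (by linarith)
  have t5 : b * (Δ * w) ≤ b * 0.29 := mul_le_mul_of_nonneg_left hΔw hbpos.le
  nlinarith

/-- The discriminant condition splits into `integrator_gain_lt`, which supplies the strict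
inequality, and `crossWeight_loss_le`. -/
theorem modeForm_neg_of_broadcast_eq_zero (H : GainBounds m w κ l Δ) {y h η e : ℝ}
    (h0 : 0 ≤ modeForm m (w - m) (κ + l / 2) (5 / (8 * Δ)) (Δ / 3) (crossWeight m w κ l Δ) l
      y h η e 0) : y = 0 ∧ h = 0 ∧ η = 0 ∧ e = 0 := by
  have hΔ := H.Δ_pos
  have hm := H.m_pos
  have hw := H.w_pos
  have hp : 0 < w - m := sub_pos.2 H.m_lt
  have hK : 0 < κ + l / 2 := by linarith [H.half_le, H.l_nonneg]
  have hΔp := H.sub_mul_Δ_le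
  have hΔw := H.w_mul_Δ_le
  have hden : 0 < 1 - Δ / 3 * (w - m) := by linarith
  obtain ⟨q, hq⟩ : ∃ q, q * (1 - Δ / 3 * (w - m)) = w - m :=
    ⟨(w - m) / (1 - Δ / 3 * (w - m)), div_mul_cancel₀ _ hden.ne'⟩
  obtain ⟨hq0, hq1, hq2, hq3⟩ := H.sector_slack hq
  have hJ := H.integrator_gain_lt hq
  have hL := H.crossWeight_loss_le hq
  have hBpos := H.crossWeight_pos
  have hbz := H.inv_mul_sub_le
  have hg := H.crossGain_pos
  have hcw : crossWeight m w κ l Δ = 1 / crossGain m w κ l + 0.85 * Δ := rfl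
  have hbpos : 0 < 1 / crossGain m w κ l := by positivity
  set B := crossWeight m w κ l Δ
  set K := κ + l / 2
  set Kh := K / (1 + 1.6 * (K * Δ)) with hKh
  have hx : 0 < 1 + 1.6 * (K * Δ) := by positivity
  have hKh0 : 0 < Kh := by positivity
  have hmν : Δ / 3 * m ^ 2 * (1 + q * (Δ / 3)) ≤ m := by
    have a1 : Δ * m ≤ 0.29 := by nlinarith [H.m_lt]
    have a2 : (Δ * m) * (1 + q * (Δ / 3)) ≤ 0.29 * 1.025 :=
      mul_le_mul a1 (by linarith) (by positivity) (by norm_num)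
    nlinarith
  set J := 4 * B - 4 * (Δ / 3) - q * B ^ 2 with hJdef
  have hJ4 : J ≤ 4 * B := by
    have : 0 ≤ q * B ^ 2 := by positivity
    linarith
  have hKJ : 1 < Kh * J := by
    have h1 : Kh * (1 / K + 1.6 * Δ) = 1 := by rw [hKh]; field_simp
    have := mul_lt_mul_of_pos_left hJ hKh0
    linarith
  refine modeForm_integrator_neg (q := q) (Kh := Kh) hp hm hK (by positivity) (by positivity)
    (by linarith) hq ?_ (by linarith) ?_ (by linarith) ?_ h0
  · rw [hKh]; field_simp; ring
  · have : B * (w - m) ≤ 0.3401 := by rw [hcw]; nlinarith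
    nlinarith
  · have hW : (1 + B * m) ^ 2 - m * J + Δ / 3 * m ^ 2 * (1 + q * (Δ / 3)) * J ≤ 1 := by
      have a1 : Δ / 3 * m ^ 2 * (1 + q * (Δ / 3)) * J ≤
          Δ / 3 * m ^ 2 * (1 + q * (Δ / 3)) * (4 * B) :=
        mul_le_mul_of_nonneg_left hJ4 (by positivity)
      have a2 := mul_le_mul_of_nonneg_left hL hm.le
      rw [hJdef] at a1 ⊢
      linarith
    change _ < (m - Δ / 3 * m ^ 2 * (1 + q * (Δ / 3)) + Kh) * J
    linarith

-- In the variables y and z - y the remaining form has, as Δ → 0, the coefficients m + l/2 - bl, bl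
-- and κ. The discriminant is scaled by (1 + x)g², with x = 1.6KΔ and g = `crossGain`, to clear the
-- denominators of b = 1/g + 0.85Δ and of the parallel sum K/(1 + x); each factor is then estimated
-- separately and `weighted_secant_lt` concludes.
set_option maxHeartbeats 600000 in
theorem modeForm_neg_of_integrator_eq_zero (H : GainBounds m w κ l Δ) {y h e z : ℝ}
    (h0 : 0 ≤ modeForm m (w - m) (κ + l / 2) (5 / (8 * Δ)) (Δ / 3) (crossWeight m w κ l Δ) l
      y h 0 e z) : y = 0 ∧ h = 0 ∧ e = 0 ∧ z = 0 := by
  have hΔ := H.Δ_pos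
  have hm := H.m_pos
  have hw := H.w_pos
  have hl := H.l_nonneg
  have hκ := H.half_le
  have hp : 0 < w - m := sub_pos.2 H.m_lt
  have hpκ := H.sub_le
  have hΔp := H.sub_mul_Δ_le
  have hden : 0 < 1 - Δ / 3 * (w - m) := by linarith
  obtain ⟨q, hq⟩ : ∃ q, q * (1 - Δ / 3 * (w - m)) = w - m :=
    ⟨(w - m) / (1 - Δ / 3 * (w - m)), div_mul_cancel₀ _ hden.ne'⟩
  obtain ⟨hq0, hq1, hq2, hq3⟩ := H.sector_slack hq
  have hg := H.crossGain_pos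
  have hg36 := H.crossGain_ge
  have hfin := H.weighted_secant_lt
  have hu1 := H.crossGain_mul_Δ_le
  have hue := H.crossGain_mul_Δ_mul_le
  have hdrift := H.drift_loss_le
  have herr := H.error_loss_le
  have hlΔ := H.l_mul_Δ_le
  have hcw : crossWeight m w κ l Δ = 1 / crossGain m w κ l + 0.85 * Δ := rfl
  have hgdef : crossGain m w κ l = 4 * κ + 2 * l - 0.4 * (w - m) := rfl
  set g := crossGain m w κ l
  set B := crossWeight m w κ l Δ
  have hBg : B * g = 1 + 0.85 * (Δ * g) := by rw [hcw]; field_simp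
  have hK : 0 < κ + l / 2 := by linarith
  set K := κ + l / 2 with hKdef
  set x := 1.6 * (K * Δ) with hx
  have hx0 : 0 < x := by positivity
  set Kh := K / (1 + x) with hKh
  set D := Δ / 3 * (1 + q * (Δ / 3)) with hD
  have hD0 : 0 < D := by positivity
  have hD1 : D ≤ 0.342 * Δ := by
    have := mul_le_mul_of_nonneg_left hq2 hΔ.le
    rw [hD]; linarith
  set A := m + l / 2 - B * l - D * (m + l) ^ 2 with hA
  set C := Kh - l / 2 - D * l ^ 2 with hC
  have hgA : 0.354 * (m * g) + 0.8 * l ^ 2 ≤ g * A := by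
    have a1 : 0.41 * m + l / 2 - 1 / g * l ≤ A := by
      have := mul_le_mul_of_nonneg_right hD1 (sq_nonneg (m + l))
      rw [hA, hcw]
      linarith
    have a2 := mul_le_mul_of_nonneg_left a1 hg.le
    have a3 : g * (0.41 * m + l / 2 - 1 / g * l) = 0.41 * (m * g) + l * (g / 2 - 1) := by
      field_simp
      ring
    have a4 : l * (l - 0.2 * (w - m)) ≤ l * (g / 2 - 1) :=
      mul_le_mul_of_nonneg_left (by rw [hgdef]; linarith) hl
    have a5 : (w - m) ^ 2 ≤ 4 * m * κ :=
      (pow_le_pow_left₀ hp.le (by linarith) 2).trans H.sq_le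
    have a6 : m * (3.6 * κ) ≤ m * g := mul_le_mul_of_nonneg_left (by linarith) hm.le
    have a7 := sq_nonneg (l - 0.5 * (w - m))
    have a8 : 0 < m * g := mul_pos hm hg
    linarith
  have hApos : 0 < A := by
    have : 0 < m * g := mul_pos hm hg
    have : 0 < g * A := by linarith [sq_nonneg l]
    exact pos_of_mul_pos_right this hg.le
  have hC' : 0.6 * κ ≤ (1 + x) * C := by
    have c1 : (1 + x) * C = κ - 0.8 * (K * Δ) * l - (1 + x) * (D * l ^ 2) := by
      have : (1 + x) * Kh = K := by rw [hKh]; field_simp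
      rw [hC, mul_sub, mul_sub, this, hKdef, hx, hKdef]; ring
    have c2 : (1 + x) * (D * l ^ 2) ≤ (1 + x) * (0.342 * Δ * l ^ 2) :=
      mul_le_mul_of_nonneg_left (mul_le_mul_of_nonneg_right hD1 (sq_nonneg l)) (by positivity)
    have c3 : K * Δ * l * (Δ * l) ≤ K * Δ * l * 0.14 :=
      mul_le_mul_of_nonneg_left hlΔ (by positivity)
    have c4 : x * (0.342 * Δ * l ^ 2) = 0.5472 * (K * Δ * l * (Δ * l)) := by rw [hx]; ring
    have c5 : K * Δ * l = κ * (Δ * l) + Δ * l ^ 2 / 2 := by rw [hKdef]; ring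
    have c6 : 0 ≤ κ * (Δ * l) := by positivity
    have c7 : 0 ≤ Δ * l ^ 2 := by positivity
    linarith
  have hBB : (B * l + 2 * D * l * (m + l)) * g ≤ l * (1 + Δ * g * (0.85 + 0.684 * (m + l))) := by
    have b1 : D * (l * (m + l) * g) ≤ 0.342 * Δ * (l * (m + l) * g) :=
      mul_le_mul_of_nonneg_right hD1 (by positivity)
    have b2 : B * l * g = l * (1 + 0.85 * (Δ * g)) := by rw [← hBg]; ring
    linarith
  have hxu : x ≤ 0.4445 * (Δ * g) := by
    have : 3.6 * K ≤ g := by rw [hKdef]; linarith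
    have := mul_le_mul_of_nonneg_right this hΔ.le
    have : 0 < Δ * g := by positivity
    rw [hx]; linarith
  have hsec := secant_bound (u := Δ * g) (e := 0.85 + 0.684 * (m + l)) (by positivity) hu1
    (by positivity) hue
  have hu0 : 0 < Δ * g := by positivity
  have hBpos : 0 < B := H.crossWeight_pos
  have lhs : (1 + x) * ((B * l + 2 * D * l * (m + l)) * g) ^ 2 ≤
      (1 + Δ * g * (4.5 + 3.27 * (m + l))) * l ^ 2 := by
    have s1 : ((B * l + 2 * D * l * (m + l)) * g) ^ 2 ≤
        (l * (1 + Δ * g * (0.85 + 0.684 * (m + l)))) ^ 2 :=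
      pow_le_pow_left₀ (by positivity) hBB 2
    have s2 : (1 + x) * ((B * l + 2 * D * l * (m + l)) * g) ^ 2 ≤
        (1 + 0.4445 * (Δ * g)) * (l * (1 + Δ * g * (0.85 + 0.684 * (m + l)))) ^ 2 :=
      mul_le_mul (by linarith) s1 (by positivity) (by positivity)
    have s3 := mul_le_mul_of_nonneg_right hsec (sq_nonneg l)
    have s4 : Δ * g * (0.4445 + 4.768 * (0.85 + 0.684 * (m + l))) ≤
        Δ * g * (4.5 + 3.27 * (m + l)) := mul_le_mul_of_nonneg_left (by linarith) hu0.le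
    have s5 := mul_le_mul_of_nonneg_right s4 (sq_nonneg l)
    linarith
  have hκg : 0.9 + l ≤ κ * g := by
    have k1 : κ * (3.6 * κ + 2 * l) ≤ κ * g := mul_le_mul_of_nonneg_left hg36 (by linarith)
    have k2 : 1 / 2 * (3.6 * κ + 2 * l) ≤ κ * (3.6 * κ + 2 * l) :=
      mul_le_mul_of_nonneg_right hκ (by linarith)
    linarith
  have hF : 0 ≤ 0.354 * (m * g) + 0.8 * l ^ 2 := by positivity
  have rhs : 2.4 * (0.9 + l) * (0.354 * (m * g) + 0.8 * l ^ 2) ≤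
      4 * (g * A) * (g * ((1 + x) * C)) := by
    have r1 : 2.4 * (0.9 + l) ≤ 4 * (g * ((1 + x) * C)) := by
      have := mul_le_mul_of_nonneg_left hC' hg.le
      linarith
    have := mul_le_mul r1 hgA hF (by linarith)
    linarith
  have hdisc : (B * l + 2 * D * l * (m + l)) ^ 2 < 4 * A * C := by
    have hpos : 0 < (1 + x) * g ^ 2 := by positivity
    refine lt_of_mul_lt_mul_left ?_ hpos.le
    calc (1 + x) * g ^ 2 * (B * l + 2 * D * l * (m + l)) ^ 2
        = (1 + x) * ((B * l + 2 * D * l * (m + l)) * g) ^ 2 := by ring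
      _ < 4 * (g * A) * (g * ((1 + x) * C)) := lhs.trans_lt (hfin.trans_le rhs)
      _ = (1 + x) * g ^ 2 * (4 * A * C) := by ring
  refine modeForm_broadcast_neg (q := q) (Kh := Kh) hp hK (by positivity) (by linarith) hq ?_
    hApos hdisc h0
  rw [hKh, hx]; field_simp; ring

end GainBounds

end OptimalConsensus

namespace OptimalConsensus

/-! ### Choosing the weight of a product of two linear functionals -/

/-- The identity by which quadratic forms are used below. -/
def IsQuadratic {E : Type*} [AddCommGroup E] [Module ℝ E] (Q : E → ℝ) : Prop :=
  ∀ (x y : E) (t s : ℝ), Q (t • x + s • y) + t * s * Q (x - y) = (t + s) * (t * Q x + s * Q y)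

theorem IsQuadratic.smul {E : Type*} [AddCommGroup E] [Module ℝ E] {Q : E → ℝ}
    (hQ : IsQuadratic Q) (t : ℝ) (x : E) : Q (t • x) = t ^ 2 * Q x := by
  have := hQ x 0 t 0
  simp only [zero_smul, add_zero, mul_zero, zero_mul] at this
  rw [this]; ring

/-- An admissible -c must lie above Q/(uv) wherever uv > 0 and below it wherever uv < 0, so it
suffices to compare the quotients at two points x, y of opposite type. Scale both to u = 1, with
v(x) = s > 0 and v(y) = -t < 0. Then v kills tx + sy and u kills x - y, so the quadratic identity
gives tQ(x) + sQ(y) ≤ 0, which is the comparison. -/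
theorem exists_add_mul_nonpos {E : Type*} [AddCommGroup E] [Module ℝ E] {Q : E → ℝ}
    (hQ : IsQuadratic Q) (u v : E →ₗ[ℝ] ℝ) (hu : ∀ x, u x = 0 → Q x ≤ 0)
    (hv : ∀ x, v x = 0 → Q x ≤ 0) (hpos : ∃ x, 0 < u x * v x) (hneg : ∃ x, u x * v x < 0) :
    ∃ c : ℝ, ∀ x, Q x + c * (u x * v x) ≤ 0 := by
  obtain ⟨a, ha1, ha2⟩ := exists_between_of_forall_le
    (s := (fun x => Q x / (u x * v x)) '' {x | 0 < u x * v x})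
    (t := (fun x => Q x / (u x * v x)) '' {x | u x * v x < 0})
    (by obtain ⟨x, hx⟩ := hpos; exact ⟨_, x, hx, rfl⟩)
    (by obtain ⟨x, hx⟩ := hneg; exact ⟨_, x, hx, rfl⟩)
    (by
      rintro _ ⟨x, hx, rfl⟩ _ ⟨y, hy, rfl⟩
      simp only [Set.mem_ofPred_eq] at hx hy
      have hux : u x ≠ 0 := by rintro h; simp [h] at hx
      have huy : u y ≠ 0 := by rintro h; simp [h] at hy
      have h1 := hv ((u x)⁻¹ • ((-(v y / u y)) • x) + ((v x / u x) * (u y)⁻¹) • y) (by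
        simp only [map_add, map_smul, smul_eq_mul]
        field_simp
        ring)
      have h2 := hu ((u x)⁻¹ • x - (u y)⁻¹ • y) (by
        simp only [map_sub, map_smul, smul_eq_mul]
        field_simp
        ring)
      have h3 := hQ ((u x)⁻¹ • x) ((u y)⁻¹ • y) (-(v y / u y)) (v x / u x)
      rw [hQ.smul, hQ.smul, smul_smul, smul_smul] at h3
      rw [smul_smul, mul_comm (u x)⁻¹] at h1
      have hs : 0 < v x / u x := by
        have : v x / u x = (u x * v x) / u x ^ 2 := by field_simp
        rw [this]; positivity
      have ht : 0 < -(v y / u y) := by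
        have : -(v y / u y) = -(u y * v y) / u y ^ 2 := by field_simp
        rw [this]
        have : 0 < -(u y * v y) := by linarith
        positivity
      have h4 : -(v y / u y) * ((u x)⁻¹ ^ 2 * Q x) + v x / u x * ((u y)⁻¹ ^ 2 * Q y) ≤ 0 := by
        by_contra hc
        push Not at hc
        have := mul_pos (add_pos ht hs) hc
        nlinarith [mul_nonneg (mul_pos ht hs).le (neg_nonneg.2 h2)]
      have hvx : v x ≠ 0 := by rintro h; simp [h] at hx
      have hvy : v y ≠ 0 := by rintro h; simp [h] at hy
      have h5 : Q x / (u x * v x) - Q y / (u y * v y) =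
          (-(v y / u y) * ((u x)⁻¹ ^ 2 * Q x) + v x / u x * ((u y)⁻¹ ^ 2 * Q y)) /
            (-(v y / u y) * (v x / u x)) := by
        field_simp
        ring
      have h6 : Q x / (u x * v x) - Q y / (u y * v y) ≤ 0 := by
        rw [h5]; exact div_nonpos_of_nonpos_of_nonneg h4 (mul_pos ht hs).le
      simpa using h6)
  refine ⟨-a, fun x => ?_⟩
  rcases lt_trichotomy (u x * v x) 0 with h | h | h
  · have := ha2 ⟨x, h, rfl⟩
    simp only at this
    rw [le_div_iff_of_neg h] at this
    linarith
  · rw [h]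
    rcases mul_eq_zero.1 h with h | h
    · linarith [hu x h]
    · linarith [hv x h]
  · have := ha1 ⟨x, h, rfl⟩
    simp only at this
    rw [div_le_iff₀ h] at this
    linarith

theorem isQuadratic_norm_sq {E : Type*} [NormedAddCommGroup E] [InnerProductSpace ℝ E] :
    IsQuadratic fun x : E => ‖x‖ ^ 2 := by
  intro x y t s
  simp only [norm_add_sq_real, norm_sub_sq_real, norm_smul, inner_smul_left, inner_smul_right,
    mul_pow, Real.norm_eq_abs, sq_abs, RCLike.conj_to_real]
  ring

/-- By compactness Q ≤ -δ on the part of the unit sphere where uv = 0; the nonstrict version applied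
to Q + δ‖x‖² yields the rest. -/
theorem exists_add_mul_le_neg {E : Type*} [NormedAddCommGroup E] [InnerProductSpace ℝ E]
    [FiniteDimensional ℝ E] {Q : E → ℝ} (hQ : IsQuadratic Q) (hcont : Continuous Q)
    (u v : E →ₗ[ℝ] ℝ) (hu : ∀ x, u x = 0 → 0 ≤ Q x → x = 0) (hv : ∀ x, v x = 0 → 0 ≤ Q x → x = 0)
    (hpos : ∃ x, 0 < u x * v x) (hneg : ∃ x, u x * v x < 0) :
    ∃ c : ℝ, ∃ δ > 0, ∀ x, Q x + c * (u x * v x) ≤ -δ * ‖x‖ ^ 2 := by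
  have : ProperSpace E := FiniteDimensional.proper_real E
  set S : Set E := Metric.sphere 0 1 ∩ {x | u x * v x = 0} with hS
  have hSc : IsCompact S := by
    refine (isCompact_sphere 0 1).inter_right ?_
    have hu' : Continuous u := u.continuous_of_finiteDimensional
    have hv' : Continuous v := v.continuous_of_finiteDimensional
    exact isClosed_eq (hu'.mul hv') continuous_const
  obtain ⟨δ, hδ, hδS⟩ : ∃ δ > 0, ∀ x ∈ S, Q x ≤ -δ := by
    rcases S.eq_empty_or_nonempty with h | h
    · exact ⟨1, one_pos, by simp [h]⟩
    · obtain ⟨x, hx, hmax⟩ := hSc.exists_isMaxOn h hcont.continuousOn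
      refine ⟨-Q x, ?_, fun z hz => by simpa using hmax hz⟩
      by_contra hc
      have h0 : 0 ≤ Q x := by linarith
      have : x = 0 := by
        rcases mul_eq_zero.1 hx.2 with h | h
        · exact hu x h h0
        · exact hv x h h0
      have h1 := hx.1
      simp [this] at h1
  have hall : ∀ x, u x * v x = 0 → Q x + δ * ‖x‖ ^ 2 ≤ 0 := by
    intro x hx
    by_cases h0 : x = 0
    · have := hQ.smul 0 x
      simp [h0] at this ⊢
      linarith
    · have hn : 0 < ‖x‖ := norm_pos_iff.2 h0
      have h1 := hδS (‖x‖⁻¹ • x) ⟨by simp [norm_smul, hn.ne'], by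
        simp only [Set.mem_ofPred_eq, map_smul, smul_eq_mul]
        rw [mul_mul_mul_comm, hx, mul_zero]⟩
      rw [hQ.smul] at h1
      have : ‖x‖ ^ 2 * ((‖x‖⁻¹) ^ 2 * Q x) ≤ ‖x‖ ^ 2 * (-δ) :=
        mul_le_mul_of_nonneg_left h1 (sq_nonneg _)
      have e : ‖x‖ ^ 2 * ((‖x‖⁻¹) ^ 2 * Q x) = Q x := by field_simp
      linarith
  obtain ⟨c, hc⟩ := exists_add_mul_nonpos (Q := fun x => Q x + δ * ‖x‖ ^ 2)
    (by
      intro x y t s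
      have h1 := hQ x y t s
      have h2 := isQuadratic_norm_sq x y t s
      simp only at h2 ⊢
      linear_combination h1 + δ * h2) u v
    (fun x hx => hall x (by rw [hx, zero_mul])) (fun x hx => hall x (by rw [hx, mul_zero]))
    hpos hneg
  exact ⟨c, δ, hδ, fun x => by have := hc x; linarith⟩

end OptimalConsensus

/-! ### Decay and positivity of the Lyapunov function of one mode -/

namespace OptimalConsensus

theorem isQuadratic_modeForm (m p K ρ ν b l : ℝ) :
    IsQuadratic fun x : EuclideanSpace ℝ (Fin 5) =>
      modeForm m p K ρ ν b l (x 0) (x 1) (x 2) (x 3) (x 4) := by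
  intro x y t s
  simp only [modeForm, PiLp.add_apply, PiLp.sub_apply, PiLp.smul_apply, smul_eq_mul]
  ring

theorem modeForm_le_of_le {m p K K' ρ ν b l y h η e z : ℝ} (hK : K ≤ K') :
    modeForm m p K' ρ ν b l y h η e z ≤ modeForm m p K ρ ν b l y h η e z := by
  have := mul_le_mul_of_nonneg_right hK (sq_nonneg e)
  unfold modeForm
  linarith

namespace GainBounds

variable {m w κ l Δ : ℝ}

/-- The weight `c` of `η ŷ` can be chosen such that the Lyapunov function of the mode decreases. -/
theorem exists_mode_decrease (H : GainBounds m w κ l Δ) {κ' : ℝ} (hκ : κ ≤ κ') :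
    ∃ c δ : ℝ, 0 < δ ∧ ∀ y h η e z,
      modeForm m (w - m) (κ' + l / 2) (5 / (8 * Δ)) (Δ / 3) (crossWeight m w κ l Δ) l y h η e z
        + c * (η * z) ≤ -δ * (y ^ 2 + h ^ 2 + η ^ 2 + e ^ 2 + z ^ 2) := by
  obtain ⟨c, δ, hδ, hc⟩ := exists_add_mul_le_neg
    (isQuadratic_modeForm m (w - m) (κ + l / 2) (5 / (8 * Δ)) (Δ / 3) (crossWeight m w κ l Δ) l)
    (by unfold modeForm; fun_prop)
    (LinearMap.proj 2 ∘ₗ (WithLp.linearEquiv 2 ℝ (Fin 5 → ℝ)).toLinearMap)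
    (LinearMap.proj 4 ∘ₗ (WithLp.linearEquiv 2 ℝ (Fin 5 → ℝ)).toLinearMap)
    (fun x hx h0 => by
      have hx : x 2 = 0 := hx
      rw [hx] at h0
      obtain ⟨h1, h2, h3, h4⟩ := H.modeForm_neg_of_integrator_eq_zero h0
      ext i; fin_cases i <;> assumption)
    (fun x hx h0 => by
      have hx : x 4 = 0 := hx
      rw [hx] at h0
      obtain ⟨h1, h2, h3, h4⟩ := H.modeForm_neg_of_broadcast_eq_zero h0
      ext i; fin_cases i <;> assumption)
    ⟨!₂[0, 0, 1, 0, 1], by simp⟩ ⟨!₂[0, 0, 1, 0, -1], by simp⟩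
  refine ⟨c, δ, hδ, fun y h η e z => ?_⟩
  have h1 := hc !₂[y, h, η, e, z]
  have h2 : ‖!₂[y, h, η, e, z]‖ ^ 2 = y ^ 2 + h ^ 2 + η ^ 2 + e ^ 2 + z ^ 2 := by
    rw [EuclideanSpace.real_norm_sq_eq]; simp [Fin.sum_univ_five]
  rw [h2] at h1
  refine le_trans ?_ h1
  have h3 := modeForm_le_of_le (m := m) (p := w - m) (ρ := 5 / (8 * Δ)) (ν := Δ / 3)
    (b := crossWeight m w κ l Δ) (l := l) (y := y) (h := h) (η := η) (e := e) (z := z)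
    (by linarith : κ + l / 2 ≤ κ' + l / 2)
  simpa using h3

end GainBounds

/-- If the mode form with weight `c` is negative definite, then the Lyapunov function of the mode is
positive definite. -/
theorem exists_mode_lower_bound {m p K ρ ν b l c δ : ℝ} (hl : 0 < l) (hδ : 0 < δ) (hν : 0 ≤ ν)
    (H : ∀ y h η e z, modeForm m p K ρ ν b l y h η e z + c * (η * z) ≤
      -δ * (y ^ 2 + h ^ 2 + η ^ 2 + e ^ 2 + z ^ 2)) :
    ∃ μ > 0, ∀ y η : ℝ, μ * (y ^ 2 + η ^ 2) ≤ y ^ 2 / 2 + b * y * η + (c / l + b) / 2 * η ^ 2 := by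
  have key : ∀ y η : ℝ, δ * (y ^ 2 + η ^ 2) ≤
      (m + (1 - b) * l) * y ^ 2 + (1 + b * m - c) * y * η + b * η ^ 2 := by
    intro y η
    -- Without broadcast error (z = y, e = 0) and with h = 0, the decay inequality becomes a
    -- positive definite binary form.
    have h1 := H y 0 η 0 y
    have h2 : 0 ≤ ν * (0 + m * y + η + l * y) ^ 2 := by positivity
    have h3 : 0 ≤ l / 2 * y ^ 2 := by positivity
    have h4 : 0 ≤ δ * y ^ 2 := by positivity
    unfold modeForm at h1
    simp only [zero_pow two_ne_zero, zero_div, mul_zero, sub_self, sub_zero, add_zero] at h1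
    linarith
  set a := m + (1 - b) * l with ha
  set s := 1 + b * m - c with hs
  have ha0 : 0 < a := by have := key 1 0; linarith
  have hb0 : 0 < b := by have := key 0 1; linarith
  have hdisc : s ^ 2 < 4 * a * b := by
    have h1 := key (2 * b) (-s)
    have h2 : 0 < δ * ((2 * b) ^ 2 + (-s) ^ 2) := by positivity
    have h3 : 0 < b * (4 * a * b - s ^ 2) := by nlinarith
    have := pos_of_mul_pos_right h3 hb0.le
    linarith
  -- Otherwise s ≥ 1 + ab, whence s² ≥ (1 + ab)² ≥ 4ab, against the discriminant.
  have hP : b ^ 2 < c / l + b := by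
    by_contra hc
    push Not at hc
    have h1 : c ≤ (b ^ 2 - b) * l := by
      rw [← div_le_iff₀ hl]; linarith
    have h2 : 1 + a * b ≤ s := by rw [ha, hs]; nlinarith
    have h3 : 0 < a * b := by positivity
    nlinarith [sq_nonneg (1 - a * b)]
  set P := c / l + b
  have hPb : 0 < P - b ^ 2 := by linarith
  refine ⟨1 / (4 + (4 * b ^ 2 + 2) / (P - b ^ 2)), by positivity, fun y η => ?_⟩
  rw [one_div_mul_eq_div, div_le_iff₀ (by positivity)]
  have e1 : y ^ 2 / 2 + b * y * η + P / 2 * η ^ 2 =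
      (y + b * η) ^ 2 / 2 + (P - b ^ 2) * η ^ 2 / 2 := by ring
  have e2 : ((y + b * η) ^ 2 / 2 + (P - b ^ 2) * η ^ 2 / 2) *
      (4 + (4 * b ^ 2 + 2) / (P - b ^ 2)) = 2 * (y + b * η) ^ 2 + (2 * b ^ 2 + 1) * η ^ 2
      + (2 * (P - b ^ 2) * η ^ 2 + (y + b * η) ^ 2 / 2 * ((4 * b ^ 2 + 2) / (P - b ^ 2))) := by
    field_simp
    ring
  rw [e1, e2]
  have h1 : 0 ≤ 2 * (P - b ^ 2) * η ^ 2 +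
      (y + b * η) ^ 2 / 2 * ((4 * b ^ 2 + 2) / (P - b ^ 2)) := by positivity
  nlinarith [sq_nonneg (y + 2 * b * η)]

end OptimalConsensus

/-! ### From the given parameters to `GainBounds` -/

namespace OptimalConsensus

theorem epsilon_mul_le {ξ : ℝ} (hξ : 0 < ξ) : epsilon ξ * (2 * √2 * ξ) ≤ 1 := by
  have h1 : √2 * ξ ≤ √(2 * (ξ ^ 2 + (ξ - 1) ^ 2)) := by
    apply Real.le_sqrt_of_sq_le
    rw [mul_pow, Real.sq_sqrt (by norm_num)]
    nlinarith [sq_nonneg (ξ - 1)]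
  have h2 : 0 < √2 * ξ := by positivity
  unfold epsilon
  rw [one_div_mul_eq_div, div_le_one (by linarith)]
  linarith

theorem tauZero_mul_le {w Λ ε : ℝ} (hw : 0 < w) (hΛ : 0 ≤ Λ) (hε : 0 ≤ ε) :
    tauZero w Λ ε * (1 + w + √2 * Λ) ≤ ε := by
  have h0 : 0 ≤ √2 * Λ := by positivity
  have h1 : 0 ≤ √2 * Λ * ε := by positivity
  have hden : 0 < w + 1 + √2 * Λ + √2 * Λ * ε := by positivity
  have hx : 0 ≤ (w + 1) * ε / (w + 1 + √2 * Λ + √2 * Λ * ε) := by positivity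
  have hlog := Real.log_le_sub_one_of_pos (by linarith :
    0 < 1 + (w + 1) * ε / (w + 1 + √2 * Λ + √2 * Λ * ε))
  have h2 : tauZero w Λ ε ≤ ε / (w + 1 + √2 * Λ + √2 * Λ * ε) := by
    unfold tauZero
    calc _ ≤ 1 / (w + 1) * ((w + 1) * ε / (w + 1 + √2 * Λ + √2 * Λ * ε)) :=
          mul_le_mul_of_nonneg_left (by linarith) (by positivity)
      _ = _ := by field_simp
  calc _ ≤ ε / (w + 1 + √2 * Λ + √2 * Λ * ε) * (1 + w + √2 * Λ) :=
        mul_le_mul_of_nonneg_right h2 (by positivity)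
    _ ≤ ε := by
        rw [div_mul_eq_mul_div, div_le_iff₀ hden]
        nlinarith [mul_nonneg hε h1]

/-- By log(1 + x) ≤ x the dwell bound gives Δ(1 + w + √2Λ) ≤ ε. Since ε ≤ 1/(2√2ξ) and 4w² + 2Λ² + 1
≤ 8mξ, multiplying by the latter quantity gives 2√2·m ≤ 2.83·m. -/
theorem exists_gainBounds {w m₀ Λ ξ Δ κ : ℝ} (hm₀ : 0 < m₀) (hmw : m₀ ≤ w) (hΛ : 0 ≤ Λ)
    (hξ : (4 * w ^ 2 + 2 * Λ ^ 2 + 1) / (8 * m₀) < ξ) (hΔ : 0 < Δ)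
    (hΔ' : Δ ≤ tauZero w Λ (epsilon ξ)) (hκ : max (w ^ 2 / (4 * m₀)) (1 / 2) < κ) :
    ∃ m κ₀, m < m₀ ∧ κ₀ ≤ κ ∧ ∀ l, 0 ≤ l → l ≤ Λ → GainBounds m w κ₀ l Δ := by
  have hw : 0 < w := hm₀.trans_le hmw
  obtain ⟨hκ1, hκ2⟩ := max_lt_iff.1 hκ
  have hκ0 : 0 < κ := by linarith
  have hξ0 : 0 < ξ := lt_trans (by positivity) hξ
  rw [div_lt_iff₀ (by positivity)] at hκ1 hξ
  -- The least m compatible with κ and ξ. The strict bounds on κ and ξ make it smaller than m₀, so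
  -- that w - m > 0 even if w = m₀.
  set m := max (w ^ 2 / (4 * κ)) ((4 * w ^ 2 + 2 * Λ ^ 2 + 1) / (8 * ξ)) with hm
  have hm1 : w ^ 2 ≤ 4 * m * κ := by
    have : w ^ 2 / (4 * κ) ≤ m := le_max_left _ _
    rw [div_le_iff₀ (by positivity)] at this
    linarith
  have hm2 : 4 * w ^ 2 + 2 * Λ ^ 2 + 1 ≤ 8 * m * ξ := by
    have : (4 * w ^ 2 + 2 * Λ ^ 2 + 1) / (8 * ξ) ≤ m := le_max_right _ _
    rw [div_le_iff₀ (by positivity)] at this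
    linarith
  have hmpos : 0 < m := lt_of_lt_of_le (by positivity) (le_max_left _ _)
  have hmm₀ : m < m₀ := by
    refine max_lt ?_ ?_
    · rw [div_lt_iff₀ (by positivity)]; linarith
    · rw [div_lt_iff₀ (by positivity)]; linarith
  refine ⟨m, max (1 / 2) (w ^ 2 / (4 * m)), hmm₀, max_le hκ2.le ?_, fun l hl hlΛ => ?_⟩
  · rw [div_le_iff₀ (by positivity)]; linarith
  have hε0 : 0 ≤ epsilon ξ := by unfold epsilon; positivity
  have h2a : √2 ≤ 1.415 := by
    rw [Real.sqrt_le_left (by norm_num)]; norm_num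
  have h2b : 1.4 ≤ √2 := Real.le_sqrt_of_sq_le (by norm_num)
  have d1 : Δ * (1 + w + √2 * Λ) ≤ epsilon ξ :=
    (mul_le_mul_of_nonneg_right hΔ' (by positivity)).trans (tauZero_mul_le hw hΛ hε0)
  have d2 := epsilon_mul_le hξ0
  have d3 : epsilon ξ * (4 * w ^ 2 + 2 * Λ ^ 2 + 1) ≤ 2.83 * m := by
    have s2 : √2 * √2 = 2 := Real.mul_self_sqrt (by norm_num)
    calc epsilon ξ * (4 * w ^ 2 + 2 * Λ ^ 2 + 1) ≤ epsilon ξ * (8 * m * ξ) :=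
          mul_le_mul_of_nonneg_left hm2 hε0
      _ = (epsilon ξ * (2 * √2 * ξ)) * (2 * √2 * m) := by
          linear_combination (-4 * epsilon ξ * m * ξ) * s2
      _ ≤ 1 * (2 * √2 * m) := mul_le_mul_of_nonneg_right d2 (by positivity)
      _ ≤ 2.83 * m := by nlinarith
  refine ⟨hmpos, hmm₀.trans_le hmw, le_max_left _ _, ?_, ?_, hl, hΔ, ?_⟩
  · have : w ^ 2 / (4 * m) ≤ max (1 / 2) (w ^ 2 / (4 * m)) := le_max_right _ _
    rw [div_le_iff₀ (by positivity)] at this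
    linarith
  · rcases max_choice (1 / 2) (w ^ 2 / (4 * m)) with h | h
    · exact Or.inl h
    · right; rw [h]; field_simp
  · have e1 : 1 + w + 1.4 * l ≤ 1 + w + √2 * Λ := by
      have := mul_le_mul h2b hlΛ hl (by positivity)
      linarith
    have e2 : 1 + 4 * w ^ 2 + 2 * l ^ 2 ≤ 4 * w ^ 2 + 2 * Λ ^ 2 + 1 := by
      have := pow_le_pow_left₀ hl hlΛ 2
      linarith
    calc Δ * ((1 + 4 * w ^ 2 + 2 * l ^ 2) * (1 + w + 1.4 * l))
        ≤ Δ * ((4 * w ^ 2 + 2 * Λ ^ 2 + 1) * (1 + w + √2 * Λ)) := by gcongr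
      _ = Δ * (1 + w + √2 * Λ) * (4 * w ^ 2 + 2 * Λ ^ 2 + 1) := by ring
      _ ≤ epsilon ξ * (4 * w ^ 2 + 2 * Λ ^ 2 + 1) := by gcongr
      _ ≤ _ := d3

end OptimalConsensus

namespace OptimalConsensus

/-! ### Strongly convex functions with Lipschitz gradient -/

section Gradient

variable {E : Type*} [NormedAddCommGroup E] [InnerProductSpace ℝ E]

/-- A function whose directional derivatives are given by a monotone map lies above its tangents. -/
theorem tangent_le_of_monotone {F : E → ℝ} {G : E → E}
    (hF : ∀ (x d : E) (t : ℝ),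
      HasDerivAt (fun t : ℝ => F (x + t • d)) (inner ℝ d (G (x + t • d))) t)
    (hG : ∀ u v, 0 ≤ inner ℝ (u - v) (G u - G v)) (x d : E) :
    F x + inner ℝ d (G x) ≤ F (x + d) := by
  have hmono : MonotoneOn (fun t : ℝ => F (x + t • d) - t * inner ℝ d (G x)) (Set.Ici 0) := by
    refine monotoneOn_of_hasDerivWithinAt_nonneg (convex_Ici 0)
      (f' := fun t => inner ℝ d (G (x + t • d)) - 1 * inner ℝ d (G x)) ?_ ?_ ?_
    · exact fun t _ => ((hF x d t).sub
        ((hasDerivAt_id t).mul_const _)).continuousAt.continuousWithinAt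
    · exact fun t _ => ((hF x d t).sub ((hasDerivAt_id t).mul_const _)).hasDerivWithinAt
    · intro t ht
      rw [interior_Ici] at ht
      have ht : 0 < t := ht
      have h1 := hG (x + t • d) x
      rw [add_sub_cancel_left, inner_smul_left] at h1
      have h2 : 0 ≤ inner ℝ d (G (x + t • d) - G x) := nonneg_of_mul_nonneg_right h1 ht
      rw [inner_sub_right] at h2
      linarith
  have := hmono (Set.mem_Ici.2 le_rfl)
    (Set.mem_Ici.2 zero_le_one) (zero_le_one' ℝ)
  simp only [zero_smul, add_zero, zero_mul, sub_zero, one_smul, one_mul] at this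
  linarith

theorem hasDerivAt_norm_sq_line (x d : E) (t : ℝ) :
    HasDerivAt (fun t : ℝ => ‖x + t • d‖ ^ 2) (2 * inner ℝ (x + t • d) d) t := by
  have h : HasDerivAt (fun t : ℝ => x + t • d) d t := by
    simpa using ((hasDerivAt_id t).smul_const d).const_add x
  exact h.norm_sq

/-- Cocoercivity of a monotone gradient with one-sided Lipschitz constant `p`. -/
theorem norm_sq_le_of_monotone_gradient {F : E → ℝ} {G : E → E} {p : ℝ} (hp : 0 < p)
    (hF : ∀ (x d : E) (t : ℝ),
      HasDerivAt (fun t : ℝ => F (x + t • d)) (inner ℝ d (G (x + t • d))) t)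
    (hG : ∀ u v, 0 ≤ inner ℝ (u - v) (G u - G v))
    (hG' : ∀ u v, inner ℝ (u - v) (G u - G v) ≤ p * ‖u - v‖ ^ 2) (u v : E) :
    ‖G u - G v‖ ^ 2 ≤ p * inner ℝ (u - v) (G u - G v) := by
  have upper : ∀ x d, F (x + d) ≤ F x + inner ℝ d (G x) + p / 2 * ‖d‖ ^ 2 := by
    intro x d
    have := tangent_le_of_monotone (F := fun x => p / 2 * ‖x‖ ^ 2 - F x) (G := fun x => p • x - G x)
      (fun x d t => by
        have h1 := ((hasDerivAt_norm_sq_line x d t).const_mul (p / 2)).sub (hF x d t)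
        refine h1.congr_deriv ?_
        rw [inner_sub_right, inner_smul_right, real_inner_comm]; ring)
      (fun u v => by
        have e : p • u - G u - (p • v - G v) = p • (u - v) - (G u - G v) := by
          rw [smul_sub]; abel
        rw [e, inner_sub_right, inner_smul_right, real_inner_self_eq_norm_sq]
        linarith [hG' u v]) x d
    simp only [inner_sub_right, inner_smul_right, norm_add_sq_real, real_inner_comm x d] at this
    nlinarith
  -- Compare the tangent at v with the quadratic upper bound at u in the point u - r/p, the
  -- minimizer of the difference of the two bounds.
  have half : ∀ u v, ‖G u - G v‖ ^ 2 / (2 * p) ≤ F u - F v - inner ℝ (u - v) (G v) := by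
    intro u v
    set r := G u - G v with hr
    have h1 := tangent_le_of_monotone hF hG v (u + (-(1 / p)) • r - v)
    have h2 := upper u ((-(1 / p)) • r)
    rw [add_sub_cancel] at h1
    rw [show u + (-(1 / p)) • r - v = (u - v) + (-(1 / p)) • r by abel, inner_add_left,
      inner_smul_left] at h1
    rw [inner_smul_left, norm_smul, mul_pow, Real.norm_eq_abs, sq_abs] at h2
    have h3 : inner ℝ r (G u) - inner ℝ r (G v) = ‖r‖ ^ 2 := by
      rw [← inner_sub_right, ← hr, real_inner_self_eq_norm_sq]
    simp only [RCLike.conj_to_real] at h1 h2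
    have h4 : ‖r‖ ^ 2 / (2 * p) = 1 / p * ‖r‖ ^ 2 - p / 2 * ((-(1 / p)) ^ 2 * ‖r‖ ^ 2) := by
      field_simp; ring
    have h5 : 1 / p * ‖r‖ ^ 2 = 1 / p * inner ℝ r (G u) - 1 / p * inner ℝ r (G v) := by
      rw [← h3]; ring
    linarith
  have h1 := half u v
  have h2 := half v u
  rw [norm_sub_rev, ← neg_sub u v, inner_neg_left] at h2
  have h3 : ‖G u - G v‖ ^ 2 / p ≤ inner ℝ (u - v) (G u - G v) := by
    rw [inner_sub_right]
    have : ‖G u - G v‖ ^ 2 / p = ‖G u - G v‖ ^ 2 / (2 * p) + ‖G u - G v‖ ^ 2 / (2 * p) := by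
      field_simp; ring
    linarith
  rw [div_le_iff₀ hp] at h3
  linarith

variable [CompleteSpace E]

theorem hasDerivAt_gradient_line {f : E → ℝ} (hf : Differentiable ℝ f) (x d : E) (t : ℝ) :
    HasDerivAt (fun t : ℝ => f (x + t • d)) (inner ℝ d (gradient f (x + t • d))) t := by
  have h : HasDerivAt (fun t : ℝ => x + t • d) d t := by
    simpa using ((hasDerivAt_id t).smul_const d).const_add x
  have h1 := (hf (x + t • d)).hasGradientAt.hasFDerivAt.comp_hasDerivAt t h
  refine h1.congr_deriv ?_
  rw [real_inner_comm]
  simp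

/-- Sector condition for the gradient of a strongly convex function with Lipschitz gradient. -/
theorem gradient_sector {f : E → ℝ} {m w : ℝ} (hf : Differentiable ℝ f) (hmw : m < w)
    (hLip : ∀ u v, ‖gradient f u - gradient f v‖ ≤ w * ‖u - v‖)
    (hconv : ∀ u v, m * ‖u - v‖ ^ 2 ≤ inner ℝ (u - v) (gradient f u - gradient f v)) (u v : E) :
    ‖gradient f u - gradient f v - m • (u - v)‖ ^ 2 ≤
      (w - m) * inner ℝ (u - v) (gradient f u - gradient f v - m • (u - v)) := by
  have e : ∀ u v, gradient f u - m • u - (gradient f v - m • v) =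
      gradient f u - gradient f v - m • (u - v) := fun u v => by rw [smul_sub]; abel
  have e2 : ∀ u v : E, inner ℝ (u - v) (gradient f u - gradient f v - m • (u - v)) =
      inner ℝ (u - v) (gradient f u - gradient f v) - m * ‖u - v‖ ^ 2 := fun u v => by
    rw [inner_sub_right _ _ (m • (u - v)), inner_smul_right, real_inner_self_eq_norm_sq]
  have := norm_sq_le_of_monotone_gradient (F := fun x => f x - m / 2 * ‖x‖ ^ 2)
    (G := fun x => gradient f x - m • x) (sub_pos.2 hmw)
    (fun x d t => by
      have h1 := (hasDerivAt_gradient_line hf x d t).sub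
        ((hasDerivAt_norm_sq_line x d t).const_mul (m / 2))
      refine h1.congr_deriv ?_
      rw [inner_sub_right, inner_smul_right, real_inner_comm (x + t • d) d]; ring)
    (fun u v => by
      rw [e, e2]; linarith [hconv u v])
    (fun u v => by
      rw [e, e2]
      have h1 := real_inner_le_norm (u - v) (gradient f u - gradient f v)
      have h2 := mul_le_mul_of_nonneg_left (hLip u v) (norm_nonneg (u - v))
      nlinarith) u v
  simpa only [e] using this

/-- Strong monotonicity of the gradient implies a quadratic lower bound. -/
theorem quadratic_lower_bound {f : E → ℝ} {m : ℝ} (hf : Differentiable ℝ f)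
    (hconv : ∀ u v, m * ‖u - v‖ ^ 2 ≤ inner ℝ (u - v) (gradient f u - gradient f v)) (x d : E) :
    f x + inner ℝ d (gradient f x) + m / 2 * ‖d‖ ^ 2 ≤ f (x + d) := by
  have := tangent_le_of_monotone (F := fun x => f x - m / 2 * ‖x‖ ^ 2)
    (G := fun x => gradient f x - m • x)
    (fun x d t => by
      have h1 := (hasDerivAt_gradient_line hf x d t).sub
        ((hasDerivAt_norm_sq_line x d t).const_mul (m / 2))
      refine h1.congr_deriv ?_
      rw [inner_sub_right, inner_smul_right, real_inner_comm (x + t • d) d]; ring)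
    (fun u v => by
      have e : gradient f u - m • u - (gradient f v - m • v) =
        gradient f u - gradient f v - m • (u - v) := by rw [smul_sub]; abel
      rw [e, inner_sub_right _ _ (m • (u - v)), inner_smul_right, real_inner_self_eq_norm_sq]
      linarith [hconv u v]) x d
  simp only [inner_sub_right, inner_smul_right, norm_add_sq_real, real_inner_comm x d] at this
  nlinarith

/-- A strongly monotone Lipschitz map has a zero. -/
theorem exists_zero_of_strongly_monotone {G : E → E} {M W : ℝ} (hM : 0 < M)
    (hLip : ∀ u v, ‖G u - G v‖ ≤ W * ‖u - v‖)
    (hmono : ∀ u v, M * ‖u - v‖ ^ 2 ≤ inner ℝ (u - v) (G u - G v)) : ∃ x, G x = 0 := by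
  -- Enlarging the Lipschitz constant ensures M ≤ W'. The step s = M/W'² minimizes 1 - 2sM + s²W'²,
  -- the bound on the squared contraction factor.
  set W' := |W| + M with hW'
  have hW0 : 0 < W' := by positivity
  have hLip' : ∀ u v, ‖G u - G v‖ ^ 2 ≤ W' ^ 2 * ‖u - v‖ ^ 2 := by
    intro u v
    rw [← mul_pow]
    refine pow_le_pow_left₀ (norm_nonneg _) ((hLip u v).trans ?_) 2
    exact mul_le_mul_of_nonneg_right (by linarith [le_abs_self W]) (norm_nonneg _)
  set s := M / W' ^ 2 with hs
  have hs0 : 0 < s := by positivity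
  have hk0 : 0 ≤ 1 - M ^ 2 / W' ^ 2 := by
    rw [sub_nonneg, div_le_one (by positivity)]
    exact pow_le_pow_left₀ hM.le (by linarith [abs_nonneg W]) 2
  have hk1 : 1 - M ^ 2 / W' ^ 2 < 1 := by
    have : 0 < M ^ 2 / W' ^ 2 := by positivity
    linarith
  have hc : ContractingWith (Real.toNNReal √(1 - M ^ 2 / W' ^ 2)) (fun x => x - s • G x) := by
    refine ⟨?_, LipschitzWith.of_dist_le_mul fun u v => ?_⟩
    · rw [Real.toNNReal_lt_one, Real.sqrt_lt' one_pos, one_pow]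
      exact hk1
    · rw [Real.coe_toNNReal _ (Real.sqrt_nonneg _), dist_eq_norm, dist_eq_norm]
      refine abs_le_of_sq_le_sq' ?_ (by positivity) |>.2
      rw [mul_pow, Real.sq_sqrt hk0]
      have e : u - s • G u - (v - s • G v) = (u - v) - s • (G u - G v) := by
        rw [smul_sub]; abel
      rw [e, norm_sub_sq_real, inner_smul_right, norm_smul, mul_pow, Real.norm_eq_abs, sq_abs]
      have h1 := mul_le_mul_of_nonneg_left (hmono u v) hs0.le
      have h2 := mul_le_mul_of_nonneg_left (hLip' u v) (sq_nonneg s)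
      have h3 : s ^ 2 * (W' ^ 2 * ‖u - v‖ ^ 2) = M ^ 2 / W' ^ 2 * ‖u - v‖ ^ 2 := by
        rw [hs]; field_simp
      have h4 : s * (M * ‖u - v‖ ^ 2) = M ^ 2 / W' ^ 2 * ‖u - v‖ ^ 2 := by
        rw [hs]; field_simp
      linarith
  have hfix := hc.fixedPoint_isFixedPt
  refine ⟨hc.fixedPoint, ?_⟩
  have h1 : s • G hc.fixedPoint = 0 := by
    have h : hc.fixedPoint - s • G hc.fixedPoint = hc.fixedPoint := hfix
    simpa using h
  exact (smul_eq_zero.1 h1).resolve_left hs0.ne'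

end Gradient

/-- The consensus problem has a unique solution, characterized by a vanishing sum of gradients. -/
theorem exists_unique_optimalConsensus {N q : ℕ} (hN : 0 < N) {f : Fin N → Vec q → ℝ}
    {w m : Fin N → ℝ} (hf : ∀ i, Differentiable ℝ (f i))
    (hLip : ∀ i u v, ‖gradient (f i) u - gradient (f i) v‖ ≤ w i * ‖u - v‖)
    (hm : ∀ i, 0 < m i)
    (hconv : ∀ i u v, m i * ‖u - v‖ ^ 2 ≤ inner ℝ (u - v) (gradient (f i) u - gradient (f i) v)) :
    ∃ ystar : Vec q, ∑ i, gradient (f i) ystar = 0 ∧ IsOptimalConsensus f (fun _ => ystar) ∧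
      ∀ Y, IsOptimalConsensus f Y → Y = fun _ => ystar := by
  have : Nonempty (Fin N) := ⟨⟨0, hN⟩⟩
  have hMpos : 0 < ∑ i, m i := Finset.sum_pos (fun i _ => hm i) Finset.univ_nonempty
  obtain ⟨ys, hys⟩ := exists_zero_of_strongly_monotone (G := fun x => ∑ i, gradient (f i) x)
    (M := ∑ i, m i) (W := ∑ i, w i) hMpos
    (fun u v => by
      rw [← Finset.sum_sub_distrib, Finset.sum_mul]
      exact (norm_sum_le _ _).trans (Finset.sum_le_sum fun i _ => hLip i u v))
    (fun u v => by
      rw [← Finset.sum_sub_distrib, inner_sum, Finset.sum_mul]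
      exact Finset.sum_le_sum fun i _ => hconv i u v)
  have low : ∀ z, ∑ i, f i ys + (∑ i, m i) / 2 * ‖z - ys‖ ^ 2 ≤ ∑ i, f i z := by
    intro z
    have h1 : ∑ i, (f i ys + inner ℝ (z - ys) (gradient (f i) ys) + m i / 2 * ‖z - ys‖ ^ 2) ≤
        ∑ i, f i z := Finset.sum_le_sum fun i _ => by
      have := quadratic_lower_bound (hf i) (hconv i) ys (z - ys)
      rwa [add_sub_cancel] at this
    rw [Finset.sum_add_distrib, Finset.sum_add_distrib, ← inner_sum, hys, inner_zero_right,
      ← Finset.sum_mul, ← Finset.sum_div] at h1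
    linarith
  refine ⟨ys, hys, ⟨fun Z hZ => ?_, fun _ _ => rfl⟩, fun Y hY => ?_⟩
  · have hZ' : ∀ i, Z i = Z ⟨0, hN⟩ := fun i => hZ i _
    have h1 := low (Z ⟨0, hN⟩)
    have h2 : 0 ≤ (∑ i, m i) / 2 * ‖Z ⟨0, hN⟩ - ys‖ ^ 2 := by positivity
    change ∑ i, f i ys ≤ ∑ i, f i (Z i)
    simp only [hZ']
    linarith
  · obtain ⟨hmin, hcons⟩ := hY
    have hY' : ∀ i, Y i = Y ⟨0, hN⟩ := fun i => hcons i _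
    have h1 := low (Y ⟨0, hN⟩)
    have h2 : ∑ i, f i (Y i) ≤ ∑ i, f i ys := hmin (show (fun _ => ys) ∈ _ from fun _ _ => rfl)
    simp only [hY'] at h2
    have h3 : ‖Y ⟨0, hN⟩ - ys‖ ^ 2 ≤ 0 := by
      by_contra hc
      push Not at hc
      have : 0 < (∑ i, m i) / 2 * ‖Y ⟨0, hN⟩ - ys‖ ^ 2 := by positivity
      linarith
    have h4 : Y ⟨0, hN⟩ - ys = 0 := by
      rw [← norm_eq_zero]; exact pow_eq_zero_iff two_ne_zero |>.1 (le_antisymm h3 (sq_nonneg _))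
    funext i
    rw [hY' i]; exact sub_eq_zero.1 h4

end OptimalConsensus

namespace OptimalConsensus

/-! ### Functions with right derivatives and downward jumps -/

/-- Continuous induction against the line g(0) + εt: the jump hypothesis carries the bound to the
supremum of the good times, the right derivative carries it beyond. -/
theorem le_initial_of_right_deriv_nonpos {g g' : ℝ → ℝ}
    (hd : ∀ t, 0 ≤ t → HasDerivWithinAt g (g' t) (Set.Ici t) t)
    (hneg : ∀ t, 0 ≤ t → g' t ≤ 0)
    (hjump : ∀ t, 0 < t → ∀ ε > 0, ∀ᶠ s in 𝓝[<] t, g t ≤ g s + ε) {T : ℝ} (hT : 0 ≤ T) :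
    g T ≤ g 0 := by
  suffices h : ∀ ε > 0, g T ≤ g 0 + ε * T by
    refine le_of_forall_pos_le_add fun δ hδ => ?_
    have h1 := h (δ / (T + 1)) (by positivity)
    have h2 : δ / (T + 1) * T ≤ δ := by
      rw [div_mul_eq_mul_div, div_le_iff₀ (by positivity)]; nlinarith
    linarith
  intro ε hε
  by_contra hcon
  set S : Set ℝ := {t | t ∈ Set.Icc 0 T ∧ ∀ s ∈ Set.Icc 0 t, g s ≤ g 0 + ε * s} with hS
  have h0S : (0 : ℝ) ∈ S := by
    refine ⟨⟨le_rfl, hT⟩, fun s hs => ?_⟩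
    have : s = 0 := le_antisymm hs.2 hs.1
    simp [this]
  have hbdd : BddAbove S := ⟨T, fun t ht => ht.1.2⟩
  set τ := sSup S with hτ
  have hτ0 : 0 ≤ τ := le_csSup hbdd h0S
  have hτT : τ ≤ T := csSup_le ⟨0, h0S⟩ fun t ht => ht.1.2
  have hbelow : ∀ s, 0 ≤ s → s < τ → g s ≤ g 0 + ε * s := by
    intro s hs hsτ
    obtain ⟨t, ht, hst⟩ := exists_lt_of_lt_csSup ⟨0, h0S⟩ hsτ
    exact ht.2 s ⟨hs, hst.le⟩
  have hat : g τ ≤ g 0 + ε * τ := by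
    rcases hτ0.eq_or_lt with h | h
    · rw [← h]; simp
    · refine le_of_forall_pos_le_add fun δ hδ => ?_
      have hev : ∀ᶠ s in 𝓝[<] τ, s ∈ Set.Ioo 0 τ := Ioo_mem_nhdsLT h
      obtain ⟨s, hs1, hs2⟩ := ((hjump τ h δ hδ).and hev).exists
      have := hbelow s hs2.1.le hs2.2
      nlinarith [hs2.2]
  have hτlt : τ < T := by
    rcases hτT.eq_or_lt with h | h
    · rw [h] at hat; exact absurd hat hcon
    · exact h
  have hslope := (hasDerivWithinAt_iff_tendsto_slope' (by simp)).1 (hd τ hτ0).Ioi_of_Ici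
  have hev : ∀ᶠ s in 𝓝[>] τ, slope g τ s < ε :=
    hslope.eventually_lt_const (lt_of_le_of_lt (hneg τ hτ0) hε)
  obtain ⟨b, hb, hbs⟩ := (mem_nhdsGT_iff_exists_Ioc_subset).1 hev
  have hb : τ < b := hb
  have hmem : min b T ∈ S := by
    refine ⟨⟨le_min (hτ0.trans hb.le) hT, min_le_right _ _⟩, fun s hs => ?_⟩
    rcases lt_trichotomy s τ with h | h | h
    · exact hbelow s hs.1 h
    · rw [h]; exact hat
    · have h1 : slope g τ s < ε := hbs ⟨h, hs.2.trans (min_le_left _ _)⟩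
      rw [slope_def_field, div_lt_iff₀ (by linarith)] at h1
      linarith
  have := le_csSup hbdd hmem
  rw [← hτ] at this
  exact absurd this (not_le.2 (lt_min hb hτlt))

/-! ### The weight of the error during a dwell interval -/

/-- The weight at time `s` after a broadcast that is followed by a dwell time `Δ`. -/
noncomputable def dwellWeight (Δ s : ℝ) : ℝ := 5 / 8 * ((1 - s / Δ) / (1 - 0.9 * (1 - s / Δ) ^ 2))

noncomputable def dwellWeightDeriv (Δ s : ℝ) : ℝ :=
  -(5 / (8 * Δ)) * ((1 + 0.9 * (1 - s / Δ) ^ 2) / (1 - 0.9 * (1 - s / Δ) ^ 2) ^ 2)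

theorem dwell_fraction_mem {Δ s : ℝ} (hΔ : 0 < Δ) (h0 : 0 ≤ s) (h1 : s ≤ Δ) :
    0 ≤ 1 - s / Δ ∧ 1 - s / Δ ≤ 1 ∧ 0.1 ≤ 1 - 0.9 * (1 - s / Δ) ^ 2 := by
  have a : 0 ≤ s / Δ := by positivity
  have b : s / Δ ≤ 1 := (div_le_one hΔ).2 h1
  refine ⟨by linarith, by linarith, ?_⟩
  nlinarith

theorem dwellWeight_nonneg {Δ s : ℝ} (hΔ : 0 < Δ) (h0 : 0 ≤ s) (h1 : s ≤ Δ) :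
    0 ≤ dwellWeight Δ s := by
  obtain ⟨a, b, c⟩ := dwell_fraction_mem hΔ h0 h1
  unfold dwellWeight
  have : 0 < 1 - 0.9 * (1 - s / Δ) ^ 2 := by linarith
  positivity

theorem dwellWeight_le {Δ s : ℝ} (hΔ : 0 < Δ) (h0 : 0 ≤ s) (h1 : s ≤ Δ) :
    dwellWeight Δ s ≤ 7 := by
  obtain ⟨a, b, c⟩ := dwell_fraction_mem hΔ h0 h1
  unfold dwellWeight
  have : (1 - s / Δ) / (1 - 0.9 * (1 - s / Δ) ^ 2) ≤ 10 := by
    rw [div_le_iff₀ (by linarith)]; linarith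
  linarith

theorem hasDerivAt_dwellWeight {Δ s : ℝ} (hΔ : 0 < Δ) (h0 : 0 ≤ s) (h1 : s ≤ Δ) :
    HasDerivAt (dwellWeight Δ) (dwellWeightDeriv Δ s) s := by
  obtain ⟨a, b, c⟩ := dwell_fraction_mem hΔ h0 h1
  have hne : 1 - 0.9 * (1 - s / Δ) ^ 2 ≠ 0 := by linarith
  have hu : HasDerivAt (fun s => 1 - s / Δ) (-(1 / Δ)) s := by
    simpa using ((hasDerivAt_id s).div_const Δ).const_sub 1
  have hden := ((hu.pow 2).const_mul 0.9).const_sub 1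
  have := (hu.div hden hne).const_mul (5 / 8)
  refine this.congr_deriv ?_
  unfold dwellWeightDeriv
  simp only [Pi.pow_apply]
  clear this hden hu a b c
  generalize 1 - s / Δ = u at hne ⊢
  push_cast
  field_simp
  ring

/-- The equation φ' = -ρ - φ²/ν has a bounded solution on [0, Δ] vanishing at Δ exactly if Δ√(ρ/ν) <
π/2. Here this number is √(15/8), and the rational weight replaces the tangent. With u = 1 - s/Δ the
inequality reduces to 0.81u⁴ ≤ 0.825u². -/
theorem dwellWeightDeriv_add_le {Δ s : ℝ} (hΔ : 0 < Δ) (h0 : 0 ≤ s) (h1 : s ≤ Δ) :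
    dwellWeightDeriv Δ s + dwellWeight Δ s ^ 2 / (Δ / 3) ≤ -(5 / (8 * Δ)) := by
  obtain ⟨a, b, c⟩ := dwell_fraction_mem hΔ h0 h1
  unfold dwellWeightDeriv dwellWeight
  set u := 1 - s / Δ
  have hpos : 0 < 1 - 0.9 * u ^ 2 := by linarith
  have key : 1 + 15 / 8 * (u / (1 - 0.9 * u ^ 2)) ^ 2 ≤
      (1 + 0.9 * u ^ 2) / (1 - 0.9 * u ^ 2) ^ 2 := by
    rw [div_pow, le_div_iff₀ (by positivity), add_mul, mul_assoc (15 / 8),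
      div_mul_cancel₀ _ (by positivity)]
    have hu2 : u ^ 2 ≤ 1 := by nlinarith
    nlinarith [mul_nonneg (sq_nonneg u) (sub_nonneg.2 hu2)]
  have e : -(5 / (8 * Δ)) * ((1 + 0.9 * u ^ 2) / (1 - 0.9 * u ^ 2) ^ 2) +
      (5 / 8 * (u / (1 - 0.9 * u ^ 2))) ^ 2 / (Δ / 3) =
      -(5 / (8 * Δ)) * ((1 + 0.9 * u ^ 2) / (1 - 0.9 * u ^ 2) ^ 2 -
        15 / 8 * (u / (1 - 0.9 * u ^ 2)) ^ 2) := by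
    field_simp
    ring
  rw [e]
  have : 0 < 5 / (8 * Δ) := by positivity
  nlinarith

/-- The weighted squared error during a dwell interval dissipates. -/
theorem dwell_dissipation {E : Type*} [NormedAddCommGroup E] [InnerProductSpace ℝ E] {Δ s : ℝ}
    (hΔ : 0 < Δ) (h0 : 0 ≤ s) (h1 : s ≤ Δ) (e v : E) :
    dwellWeightDeriv Δ s * ‖e‖ ^ 2 + dwellWeight Δ s * (2 * inner ℝ e (-v)) ≤
      -(5 / (8 * Δ)) * ‖e‖ ^ 2 + Δ / 3 * ‖v‖ ^ 2 := by
  have h2 := mul_le_mul_of_nonneg_right (dwellWeightDeriv_add_le hΔ h0 h1) (sq_nonneg ‖e‖)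
  set φ := dwellWeight Δ s
  have hν : 0 < Δ / 3 := by positivity
  have h3 : φ * (2 * inner ℝ e (-v)) ≤ φ ^ 2 / (Δ / 3) * ‖e‖ ^ 2 + Δ / 3 * ‖v‖ ^ 2 := by
    have h4 : 0 ≤ ‖(φ / (Δ / 3)) • e + v‖ ^ 2 := sq_nonneg _
    rw [norm_add_sq_real, inner_smul_left, norm_smul, mul_pow, Real.norm_eq_abs, sq_abs] at h4
    simp only [RCLike.conj_to_real] at h4
    have h5 := mul_le_mul_of_nonneg_left h4 hν.le
    rw [inner_neg_right]
    have e1 : Δ / 3 * ((φ / (Δ / 3)) ^ 2 * ‖e‖ ^ 2 + 2 * (φ / (Δ / 3) * inner ℝ e v) + ‖v‖ ^ 2) =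
        φ ^ 2 / (Δ / 3) * ‖e‖ ^ 2 + 2 * (φ * inner ℝ e v) + Δ / 3 * ‖v‖ ^ 2 := by
      field_simp
    rw [mul_zero, e1] at h5
    linarith
  linarith

end OptimalConsensus

namespace OptimalConsensus

/-! ### The Laplacian -/

section Laplacian

variable {N : ℕ} {a : Matrix (Fin N) (Fin N) ℝ}

theorem outDegree_eq_row_sum (ha : IsConnectedAdjacency a) (i : Fin N) :
    outDegree a i = ∑ j, a i j :=
  Finset.sum_congr rfl fun j _ => ha.symm.apply i j

theorem laplacian_mulVec (ha : IsConnectedAdjacency a) (y : Fin N → ℝ) (i : Fin N) :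
    (laplacian a).mulVec y i = ∑ j, a i j * (y i - y j) := by
  rw [laplacian, Matrix.sub_mulVec, Pi.sub_apply, Matrix.mulVec_diagonal, outDegree_eq_row_sum ha,
    Finset.sum_mul, Matrix.mulVec, dotProduct, ← Finset.sum_sub_distrib]
  exact Finset.sum_congr rfl fun j _ => by ring

theorem laplacian_isHermitian (ha : IsConnectedAdjacency a) : (laplacian a).IsHermitian := by
  refine (Matrix.isHermitian_diagonal _).sub ?_
  rw [Matrix.IsHermitian, Matrix.conjTranspose_eq_transpose_of_trivial]
  exact ha.symm

theorem sum_mul_laplacian (ha : IsConnectedAdjacency a) (x y : Fin N → ℝ) :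
    ∑ i, x i * ∑ j, a i j * (y i - y j) =
      1 / 2 * ∑ i, ∑ j, a i j * ((x i - x j) * (y i - y j)) := by
  have h1 : ∑ i, x i * ∑ j, a i j * (y i - y j) = ∑ i, ∑ j, a i j * (x i * (y i - y j)) := by
    refine Finset.sum_congr rfl fun i _ => ?_
    rw [Finset.mul_sum]
    exact Finset.sum_congr rfl fun j _ => by ring
  have h2 : ∑ i, ∑ j, a i j * (x i * (y i - y j)) = ∑ i, ∑ j, a i j * (x j * (y j - y i)) := by
    rw [Finset.sum_comm]
    refine Finset.sum_congr rfl fun i _ => Finset.sum_congr rfl fun j _ => ?_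
    rw [ha.symm.apply]
  have h3 : ∑ i, ∑ j, a i j * ((x i - x j) * (y i - y j)) =
      ∑ i, ∑ j, a i j * (x i * (y i - y j)) + ∑ i, ∑ j, a i j * (x j * (y j - y i)) := by
    rw [← Finset.sum_add_distrib]
    refine Finset.sum_congr rfl fun i _ => ?_
    rw [← Finset.sum_add_distrib]
    exact Finset.sum_congr rfl fun j _ => by ring
  rw [h3, ← h2, h1]; ring

/-- Each summand vanishes, so x agrees across edges and hence along walks; this is where
connectedness enters. -/
theorem eq_of_sum_sq_eq_zero (ha : IsConnectedAdjacency a) {x : Fin N → ℝ}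
    (h : ∑ i, ∑ j, a i j * ((x i - x j) * (x i - x j)) = 0) (i j : Fin N) : x i = x j := by
  have hnn : ∀ i j, 0 ≤ a i j * ((x i - x j) * (x i - x j)) := fun i j =>
    mul_nonneg (ha.nonneg i j) (mul_self_nonneg _)
  have hedge : ∀ i j, 0 < a i j → x i = x j := by
    intro i j hij
    have h1 := (Finset.sum_eq_zero_iff_of_nonneg fun i _ =>
      Finset.sum_nonneg fun j _ => hnn i j).1 h i (Finset.mem_univ i)
    have h2 := (Finset.sum_eq_zero_iff_of_nonneg fun j _ => hnn i j).1 h1 j (Finset.mem_univ j)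
    have h3 := (mul_eq_zero.1 h2).resolve_left hij.ne'
    exact sub_eq_zero.1 (mul_self_eq_zero.1 h3)
  obtain ⟨p⟩ := ha.connected.preconnected i j
  induction p with
  | nil => rfl
  | cons hadj _ ih =>
    rw [SimpleGraph.fromRel_adj] at hadj
    rcases hadj.2 with h' | h'
    · rw [hedge _ _ h', ih]
    · rw [← hedge _ _ h', ih]

/-- An orthonormal basis of eigenvectors `φ k` of the Laplacian, in coordinates. -/
theorem exists_laplacian_modes (ha : IsConnectedAdjacency a) :
    ∃ (μ : Fin N → ℝ) (φ : Fin N → Fin N → ℝ),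
      (∀ x y : Fin N → ℝ, ∑ k, (∑ i, φ k i * x i) * (∑ i, φ k i * y i) = ∑ i, x i * y i) ∧
      (∀ k (y : Fin N → ℝ), ∑ i, φ k i * ∑ j, a i j * (y i - y j) = μ k * ∑ i, φ k i * y i) ∧
      (∀ k, 0 ≤ μ k ∧ μ k ≤ maxLaplacianEigenvalue a) ∧
      ∀ k, μ k = 0 → ∀ i j, φ k i = φ k j := by
  set hL := laplacian_isHermitian ha
  have hvec : ∀ k i, ∑ j, a i j * (hL.eigenvectorBasis k i - hL.eigenvectorBasis k j) =
      hL.eigenvalues k * hL.eigenvectorBasis k i := by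
    intro k i
    have := congrFun (hL.mulVec_eigenvectorBasis k) i
    rw [laplacian_mulVec ha] at this
    simpa using this
  have hsymm : ∀ x y : Fin N → ℝ, ∑ i, x i * ∑ j, a i j * (y i - y j) =
      ∑ i, y i * ∑ j, a i j * (x i - x j) := by
    intro x y
    rw [sum_mul_laplacian ha, sum_mul_laplacian ha]
    congr 1
    exact Finset.sum_congr rfl fun i _ => Finset.sum_congr rfl fun j _ => by ring
  have hnorm : ∀ k, ∑ i, hL.eigenvectorBasis k i * hL.eigenvectorBasis k i = 1 := by
    intro k
    have h1 := hL.eigenvectorBasis.orthonormal.1 k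
    have h2 : ‖hL.eigenvectorBasis k‖ ^ 2 = 1 := by rw [h1]; norm_num
    rw [EuclideanSpace.real_norm_sq_eq] at h2
    simpa [sq] using h2
  have hquad : ∀ k, hL.eigenvalues k = 1 / 2 * ∑ i, ∑ j, a i j *
      ((hL.eigenvectorBasis k i - hL.eigenvectorBasis k j) *
        (hL.eigenvectorBasis k i - hL.eigenvectorBasis k j)) := by
    intro k
    rw [← sum_mul_laplacian ha]
    simp only [hvec]
    have := congrArg (fun z => hL.eigenvalues k * z) (hnorm k)
    simp only [Finset.mul_sum, mul_one] at this
    exact this.symm.trans (Finset.sum_congr rfl fun i _ => by ring)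
  refine ⟨hL.eigenvalues, fun k i => hL.eigenvectorBasis k i, ?_, ?_, ?_, ?_⟩
  · intro x y
    have h := hL.eigenvectorBasis.sum_inner_mul_inner (WithLp.toLp 2 x) (WithLp.toLp 2 y)
    simp only [PiLp.inner_apply, RCLike.inner_apply, conj_trivial] at h
    calc _ = ∑ k, (∑ i, hL.eigenvectorBasis k i * x i) * ∑ i, y i * hL.eigenvectorBasis k i :=
          Finset.sum_congr rfl fun k _ => by
            congr 1; exact Finset.sum_congr rfl fun i _ => mul_comm _ _
      _ = ∑ i, y i * x i := h
      _ = _ := Finset.sum_congr rfl fun i _ => mul_comm _ _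
  · intro k y
    rw [hsymm]
    simp only [hvec]
    rw [Finset.mul_sum]
    exact Finset.sum_congr rfl fun i _ => by ring
  · intro k
    constructor
    · rw [hquad k]
      exact mul_nonneg (by norm_num) (Finset.sum_nonneg fun i _ => Finset.sum_nonneg fun j _ =>
        mul_nonneg (ha.nonneg i j) (mul_self_nonneg _))
    · exact le_csSup (Matrix.finite_real_spectrum).bddAbove (hL.eigenvalues_mem_spectrum_real k)
  · intro k hk
    have := hquad k
    rw [hk] at this
    exact eq_of_sum_sq_eq_zero ha (by linarith)

/-- Every Laplacian is at most twice the degree matrix. -/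
theorem sum_edges_le_degree (ha : IsConnectedAdjacency a) {E : Type*} [NormedAddCommGroup E]
    [InnerProductSpace ℝ E] (x : Fin N → E) :
    ∑ i, ∑ j, a i j * ‖x i - x j‖ ^ 2 ≤ 4 * ∑ i, outDegree a i * ‖x i‖ ^ 2 := by
  have h1 : ∀ i j, a i j * ‖x i - x j‖ ^ 2 ≤ a i j * (2 * ‖x i‖ ^ 2) + a i j * (2 * ‖x j‖ ^ 2) := by
    intro i j
    rw [← mul_add]
    refine mul_le_mul_of_nonneg_left ?_ (ha.nonneg i j)
    have := parallelogram_law_with_norm ℝ (x i) (x j)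
    nlinarith [sq_nonneg ‖x i + x j‖]
  have h2 : ∑ i, ∑ j, a i j * (2 * ‖x i‖ ^ 2) = 2 * ∑ i, outDegree a i * ‖x i‖ ^ 2 := by
    rw [Finset.mul_sum]
    refine Finset.sum_congr rfl fun i _ => ?_
    rw [← Finset.sum_mul, ← outDegree_eq_row_sum ha]; ring
  have h3 : ∑ i, ∑ j, a i j * (2 * ‖x j‖ ^ 2) = 2 * ∑ i, outDegree a i * ‖x i‖ ^ 2 := by
    rw [Finset.sum_comm, Finset.mul_sum]
    refine Finset.sum_congr rfl fun i _ => ?_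
    rw [← Finset.sum_mul, outDegree]; ring
  calc _ ≤ ∑ i, ∑ j, (a i j * (2 * ‖x i‖ ^ 2) + a i j * (2 * ‖x j‖ ^ 2)) :=
        Finset.sum_le_sum fun i _ => Finset.sum_le_sum fun j _ => h1 i j
    _ = _ := by simp only [Finset.sum_add_distrib]; rw [h2, h3]; ring

end Laplacian

end OptimalConsensus

namespace OptimalConsensus

/-! ### Runs of the closed loop -/

namespace IsEventTriggeredRun

variable {N q : ℕ} {S : Agents N q} {f : Fin N → Vec q → ℝ} {a : Matrix (Fin N) (Fin N) ℝ}
  {Kα : (i : Fin N) → Matrix (Fin (S.p i)) (Fin (S.n i)) ℝ}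
  {Kβ : (i : Fin N) → Matrix (Fin (S.p i)) (Fin q) ℝ} {κ Δ : ℝ}
  {x : (i : Fin N) → ℝ → Vec (S.n i)} {η yhat : Fin N → ℝ → Vec q} {T : Fin N → ℕ → ℝ≥0∞}

theorem add_le_succ (h : IsEventTriggeredRun S f a Kα Kβ κ Δ x η yhat T) (i : Fin N) (k : ℕ) :
    T i k + ENNReal.ofReal Δ ≤ T i (k + 1) := by
  by_cases hk : T i k = ∞
  · rw [h.T_top i k hk]; exact le_top
  · obtain ⟨τ, -, hτ⟩ := h.T_succ i k hk
    rw [hτ]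
    gcongr
    exact le_max_right _ _

theorem mono (h : IsEventTriggeredRun S f a Kα Kβ κ Δ x η yhat T) (i : Fin N) : Monotone (T i) :=
  monotone_nat_of_le_succ fun k => le_self_add.trans (h.add_le_succ i k)

theorem nat_mul_le (h : IsEventTriggeredRun S f a Kα Kβ κ Δ x η yhat T) (i : Fin N) (k : ℕ) :
    ENNReal.ofReal (k * Δ) ≤ T i k := by
  induction k with
  | zero => simp
  | succ k ih =>
    refine le_trans ?_ (h.add_le_succ i k)
    have : ((k + 1 : ℕ) : ℝ) * Δ = k * Δ + Δ := by push_cast; ring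
    rw [this]
    exact ENNReal.ofReal_add_le.trans (by gcongr)

theorem lt_of_T_le (h : IsEventTriggeredRun S f a Kα Kβ κ Δ x η yhat T) (hΔ : 0 < Δ) {i : Fin N}
    {k : ℕ} {b : ℝ} (hk : T i k ≤ ENNReal.ofReal b) : (k : ℝ) ≤ |b| / Δ := by
  have h1 : ENNReal.ofReal (k * Δ) ≤ ENNReal.ofReal |b| :=
    (h.nat_mul_le i k).trans (hk.trans (ENNReal.ofReal_le_ofReal (le_abs_self b)))
  rw [ENNReal.ofReal_le_ofReal_iff (abs_nonneg b)] at h1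
  rwa [le_div_iff₀ hΔ]

theorem finite_broadcasts (h : IsEventTriggeredRun S f a Kα Kβ κ Δ x η yhat T) (hΔ : 0 < Δ)
    (i : Fin N) (b : ℝ) : {k | T i k ≤ ENNReal.ofReal b}.Finite := by
  refine (Set.finite_Iic ⌊|b| / Δ⌋₊).subset fun k hk => ?_
  exact Nat.le_floor (h.lt_of_T_le hΔ hk)

theorem exists_index (h : IsEventTriggeredRun S f a Kα Kβ κ Δ x η yhat T) (hΔ : 0 < Δ)
    (i : Fin N) (t : ℝ) : ∃ k, T i k ≤ ENNReal.ofReal t ∧ ENNReal.ofReal t < T i (k + 1) := by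
  have hex : ∃ k, ENNReal.ofReal t < T i k := by
    by_contra hc
    push Not at hc
    obtain ⟨n, hn⟩ := exists_nat_gt (|t| / Δ)
    exact absurd (h.lt_of_T_le hΔ (hc n)) (not_le.2 hn)
  classical
  obtain ⟨k, hk⟩ : ∃ k, Nat.find hex = k + 1 := by
    refine Nat.exists_eq_succ_of_ne_zero fun h0 => ?_
    have := Nat.find_spec hex
    rw [h0, h.T_zero] at this
    exact absurd this not_lt_zero
  refine ⟨k, not_lt.1 (Nat.find_min hex (by omega)), ?_⟩
  rw [← hk]
  exact Nat.find_spec hex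

theorem index_unique (h : IsEventTriggeredRun S f a Kα Kβ κ Δ x η yhat T) {i : Fin N} {t : ℝ}
    {k l : ℕ} (hk : T i k ≤ ENNReal.ofReal t) (hk' : ENNReal.ofReal t < T i (k + 1))
    (hl : T i l ≤ ENNReal.ofReal t) (hl' : ENNReal.ofReal t < T i (l + 1)) : k = l := by
  rcases lt_trichotomy k l with hlt | heq | hlt
  · exact absurd (hk'.trans_le ((h.mono i hlt).trans hl)) (lt_irrefl _)
  · exact heq
  · exact absurd (hl'.trans_le ((h.mono i hlt).trans hk)) (lt_irrefl _)

theorem output_deriv (h : IsEventTriggeredRun S f a Kα Kβ κ Δ x η yhat T)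
    (hKα : ∀ i, S.C i * S.B i * Kα i = S.C i * S.A i) (hKβ : ∀ i, S.C i * S.B i * Kβ i = 1)
    (i : Fin N) {t : ℝ} (ht : 0 ≤ t) :
    HasDerivWithinAt (S.output x i)
      (-gradient (f i) (S.output x i t) - disagreement a yhat i t - η i t) (Set.Ici t) t := by
  have h1 := (LinearMap.toContinuousLinearMap (Matrix.toEuclideanLin (S.C i))).hasFDerivAt
    |>.comp_hasDerivWithinAt t (h.x_deriv i t ht)
  refine h1.congr_deriv ?_
  set g := -gradient (f i) (S.output x i t) - disagreement a yhat i t - η i t with hg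
  rw [LinearMap.coe_toContinuousLinearMap', map_add, control, ← hg, map_add, map_add, map_neg,
    map_neg]
  have e1 : Matrix.toEuclideanLin (S.C i) (Matrix.toEuclideanLin (S.B i)
      (Matrix.toEuclideanLin (Kα i) (x i t))) =
      Matrix.toEuclideanLin (S.C i) (Matrix.toEuclideanLin (S.A i) (x i t)) := by
    have := congrArg (fun M => Matrix.toEuclideanLin M (x i t)) (hKα i)
    simpa [Matrix.toEuclideanLin, Matrix.toLpLin_mul_same] using this
  have e2 : Matrix.toEuclideanLin (S.C i) (Matrix.toEuclideanLin (S.B i)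
      (Matrix.toEuclideanLin (Kβ i) g)) = g := by
    have := congrArg (fun M => Matrix.toEuclideanLin M g) (hKβ i)
    simpa [Matrix.toEuclideanLin, Matrix.toLpLin_mul_same] using this
  rw [e1, e2]
  abel

theorem output_cont (h : IsEventTriggeredRun S f a Kα Kβ κ Δ x η yhat T) (i : Fin N) :
    ContinuousOn (S.output x i) (Set.Ici 0) :=
  (LinearMap.continuous_of_finiteDimensional _).comp_continuousOn (h.x_cont i)

end IsEventTriggeredRun

end OptimalConsensus

/-! ### Splitting the broadcast error -/

namespace OptimalConsensus

/-- The broadcast error of one agent splits into a part `eA`, present during dwell intervals and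
dissipated by the storage `Z`, and a part `eB` below the trigger threshold. -/
structure ErrorSplit {N q : ℕ} (a : Matrix (Fin N) (Fin N) ℝ) (κ Δ : ℝ) (i : Fin N)
    (y v : ℝ → Vec q) (yhat : Fin N → ℝ → Vec q) (eA eB : ℝ → Vec q) (Z Z' : ℝ → ℝ) : Prop where
  split : ∀ t, 0 ≤ t → yhat i t = y t + eA t + eB t
  below : ∀ t, 0 ≤ t →
    4 * (outDegree a i + κ) * ‖eB t‖ ^ 2 ≤ ∑ j, a i j * ‖yhat i t - yhat j t‖ ^ 2
  nonneg : ∀ t, 0 ≤ t → 0 ≤ Z t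
  le : ∀ t, 0 ≤ t → Z t ≤ 7 * ‖eA t‖ ^ 2
  deriv : ∀ t, 0 ≤ t → HasDerivWithinAt Z (Z' t) (Set.Ici t) t
  dissipation : ∀ t, 0 ≤ t → Z' t ≤ -(5 / (8 * Δ)) * ‖eA t‖ ^ 2 + Δ / 3 * ‖v t‖ ^ 2
  jump : ∀ t, 0 < t → ∀ ε > 0, ∀ᶠ s in 𝓝[<] t, Z t ≤ Z s + ε

namespace IsEventTriggeredRun

variable {N q : ℕ} {S : Agents N q} {f : Fin N → Vec q → ℝ} {a : Matrix (Fin N) (Fin N) ℝ}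
  {Kα : (i : Fin N) → Matrix (Fin (S.p i)) (Fin (S.n i)) ℝ}
  {Kβ : (i : Fin N) → Matrix (Fin (S.p i)) (Fin q) ℝ} {κ Δ : ℝ}
  {x : (i : Fin N) → ℝ → Vec (S.n i)} {η yhat : Fin N → ℝ → Vec q} {T : Fin N → ℕ → ℝ≥0∞}

/-- If the interval does not have length exactly Δ, then the maximum in the trigger rule is τ, so
the whole interval lies before the first crossing; at its left end the error is zero. -/
theorem norm_sq_le_threshold (h : IsEventTriggeredRun S f a Kα Kβ κ Δ x η yhat T)
    (ha : ∀ i j, 0 ≤ a i j) {i : Fin N} (hd : 0 < outDegree a i + κ) {k : ℕ} {t : ℝ} (ht : 0 ≤ t)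
    (hk : T i k ≤ ENNReal.ofReal t) (hk' : ENNReal.ofReal t < T i (k + 1))
    (hB : T i (k + 1) ≠ T i k + ENNReal.ofReal Δ) :
    4 * (outDegree a i + κ) * ‖yhat i t - S.output x i t‖ ^ 2 ≤
      ∑ j, a i j * ‖yhat i t - yhat j t‖ ^ 2 := by
  have hfin : T i k ≠ ∞ := ne_top_of_le_ne_top ENNReal.ofReal_ne_top hk
  have hy := h.hold i k t ht hk hk'
  obtain ⟨τ, ⟨hτ, -⟩, hsucc⟩ := h.T_succ i k hfin
  have hmax : max τ (ENNReal.ofReal Δ) = τ := by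
    rcases max_choice τ (ENNReal.ofReal Δ) with h1 | h1
    · exact h1
    · exact absurd (by rw [hsucc, h1]) hB
  rw [hmax] at hsucc
  have hs : (T i k).toReal ≤ t := ENNReal.toReal_le_of_le_ofReal ht hk
  rw [hy]
  rcases hs.eq_or_lt with h1 | h1
  · rw [h1, sub_self, norm_zero]
    simp only [ne_eq, OfNat.ofNat_ne_zero, not_false_eq_true, zero_pow, mul_zero]
    exact Finset.sum_nonneg fun j _ => mul_nonneg (ha i j) (sq_nonneg _)
  · have h2 : ENNReal.ofReal (t - (T i k).toReal) < τ := by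
      rw [hsucc] at hk'
      rw [ENNReal.ofReal_sub _ ENNReal.toReal_nonneg, ENNReal.ofReal_toReal hfin]
      exact ENNReal.sub_lt_of_lt_add hk (by rwa [add_comm])
    have h3 := (hτ t h1 h2).le
    rw [threshold, one_div_mul_eq_div, le_div_iff₀ (by positivity)] at h3
    linarith

/-- Each interval between broadcasts is assigned as a whole to `eA` or `eB`, according to whether
its length is Δ. The assignment at time t depends on the next broadcast, which is harmless in the
analysis. -/
theorem exists_errorSplit (h : IsEventTriggeredRun S f a Kα Kβ κ Δ x η yhat T) (hΔ : 0 < Δ)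
    (ha : ∀ i j, 0 ≤ a i j) (i : Fin N) (hd : 0 < outDegree a i + κ) {v : ℝ → Vec q}
    (hv : ∀ t, 0 ≤ t → HasDerivWithinAt (S.output x i) (v t) (Set.Ici t) t) :
    ∃ eA eB Z Z', ErrorSplit a κ Δ i (S.output x i) v yhat eA eB Z Z' := by
  classical
  choose idx hidx hidx' using h.exists_index hΔ i
  set y := S.output x i with hy
  set s : ℝ → ℝ := fun t => (T i (idx t)).toReal with hsdef
  set A : ℝ → Prop := fun t => T i (idx t + 1) = T i (idx t) + ENNReal.ofReal Δ with hA
  have hfin : ∀ t, T i (idx t) ≠ ∞ := fun t =>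
    ne_top_of_le_ne_top ENNReal.ofReal_ne_top (hidx t)
  have hs0 : ∀ t, 0 ≤ s t := fun t => ENNReal.toReal_nonneg
  have hst : ∀ t, 0 ≤ t → s t ≤ t := fun t ht => ENNReal.toReal_le_of_le_ofReal ht (hidx t)
  have hyhat : ∀ t, 0 ≤ t → yhat i t = y (s t) := fun t ht =>
    h.hold i (idx t) t ht (hidx t) (hidx' t)
  have hconst : ∀ t u, 0 ≤ t → s t ≤ u → ENNReal.ofReal u < T i (idx t + 1) → idx u = idx t := by
    intro t u ht hu hu'
    refine h.index_unique (hidx u) (hidx' u) ?_ hu'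
    rw [← ENNReal.ofReal_toReal (hfin t)]
    exact ENNReal.ofReal_le_ofReal hu
  have hAlt : ∀ t, 0 ≤ t → A t → t - s t ≤ Δ := by
    intro t ht hAt
    have h1 := hidx' t
    rw [show T i (idx t + 1) = _ from hAt, ← ENNReal.ofReal_toReal (hfin t),
      ← ENNReal.ofReal_add ENNReal.toReal_nonneg hΔ.le] at h1
    have := (ENNReal.ofReal_lt_ofReal_iff_of_nonneg ht).1 h1
    simp only [hsdef]
    linarith
  have hright : ∀ t, 0 ≤ t → ∀ᶠ u in 𝓝[≥] t, idx u = idx t := by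
    intro t ht
    have h1 : ∀ᶠ u in 𝓝 t, ENNReal.ofReal u < T i (idx t + 1) :=
      ENNReal.continuous_ofReal.continuousAt.eventually_lt continuousAt_const (hidx' t)
    filter_upwards [nhdsWithin_le_nhds h1, self_mem_nhdsWithin] with u hu hu'
    exact hconst t u ht ((hst t ht).trans hu') hu
  have hleft : ∀ t, 0 ≤ t → s t < t → ∀ᶠ u in 𝓝[<] t, idx u = idx t := by
    intro t ht hlt
    filter_upwards [Ioo_mem_nhdsLT hlt] with u hu
    exact hconst t u ht hu.1.le
      (lt_of_le_of_lt (ENNReal.ofReal_le_ofReal hu.2.le) (hidx' t))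
  have hnonneg : ∀ t, 0 ≤ t → 0 ≤ (if A t then
      dwellWeight Δ (t - s t) * ‖y (s t) - y t‖ ^ 2 else 0) := by
    intro t ht
    split_ifs with hAt
    · exact mul_nonneg (dwellWeight_nonneg hΔ (by linarith [hst t ht]) (hAlt t ht hAt))
        (sq_nonneg _)
    · exact le_rfl
  refine ⟨fun t => if A t then yhat i t - y t else 0, fun t => if A t then 0 else yhat i t - y t,
    fun t => if A t then dwellWeight Δ (t - s t) * ‖y (s t) - y t‖ ^ 2 else 0,
    fun t => if A t then dwellWeightDeriv Δ (t - s t) * ‖y (s t) - y t‖ ^ 2 +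
      dwellWeight Δ (t - s t) * (2 * inner ℝ (y (s t) - y t) (-v t)) else 0,
    ?_, ?_, hnonneg, ?_, ?_, ?_, ?_⟩
  · intro t ht
    split_ifs <;> abel
  · intro t ht
    split_ifs with hAt
    · rw [norm_zero]
      simp only [ne_eq, OfNat.ofNat_ne_zero, not_false_eq_true, zero_pow, mul_zero]
      exact Finset.sum_nonneg fun j _ => mul_nonneg (ha i j) (sq_nonneg _)
    · exact h.norm_sq_le_threshold ha hd ht (hidx t) (hidx' t) hAt
  · intro t ht
    split_ifs with hAt
    · rw [hyhat t ht]
      exact mul_le_mul_of_nonneg_right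
        (dwellWeight_le hΔ (by linarith [hst t ht]) (hAlt t ht hAt)) (sq_nonneg _)
    · simp
  · intro t ht
    have hev := hright t ht
    by_cases hAt : A t
    · simp only [if_pos hAt]
      have hw : HasDerivWithinAt (fun u => dwellWeight Δ (u - s t)) (dwellWeightDeriv Δ (t - s t))
          (Set.Ici t) t := by
        have h1 := hasDerivAt_dwellWeight hΔ (by linarith [hst t ht]) (hAlt t ht hAt)
        exact (h1.comp_sub_const t (s t)).hasDerivWithinAt
      have he : HasDerivWithinAt (fun u => y (s t) - y u) (-v t) (Set.Ici t) t :=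
        (hv t ht).const_sub _
      have hprod := hw.mul he.norm_sq
      refine HasDerivWithinAt.congr_of_eventuallyEq hprod ?_ ?_
      · filter_upwards [hev] with u hu
        have hAu : A u := by simp only [hA, hu]; exact hAt
        have hsu : s u = s t := by simp only [hsdef, hu]
        simp only [if_pos hAu, hsu, Pi.mul_apply]
      · simp only [if_pos hAt, Pi.mul_apply]
    · simp only [if_neg hAt]
      refine HasDerivWithinAt.congr_of_eventuallyEq (hasDerivWithinAt_const t (Set.Ici t) (0 : ℝ))
        ?_ (by simp only [if_neg hAt])
      filter_upwards [hev] with u hu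
      have hAu : ¬ A u := by simp only [hA, hu]; exact hAt
      simp only [if_neg hAu]
  · intro t ht
    split_ifs with hAt
    · rw [hyhat t ht]
      exact dwell_dissipation hΔ (by linarith [hst t ht]) (hAlt t ht hAt) _ _
    · rw [norm_zero]
      have : 0 ≤ Δ / 3 * ‖v t‖ ^ 2 := by positivity
      linarith
  · intro t ht ε hε
    -- At a broadcast instant the storage is zero and was nonnegative before; at any other time it
    -- is continuous or locally zero.
    rcases (hst t ht.le).eq_or_lt with h1 | h1
    · have hz : (if A t then dwellWeight Δ (t - s t) * ‖y (s t) - y t‖ ^ 2 else 0) = 0 := by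
        rw [h1]; simp
      filter_upwards [Ioo_mem_nhdsLT ht] with u hu
      rw [hz]
      linarith [hnonneg u hu.1.le]
    · by_cases hAt : A t
      · have hcont : ContinuousAt (fun u => dwellWeight Δ (u - s t) * ‖y (s t) - y u‖ ^ 2) t := by
          have c1 := (hasDerivAt_dwellWeight hΔ (by linarith [hst t ht.le])
            (hAlt t ht.le hAt)).comp_sub_const t (s t)
          have c2 : ContinuousAt y t := (h.output_cont i).continuousAt (Ici_mem_nhds ht)
          exact c1.continuousAt.mul ((continuousAt_const.sub c2).norm.pow 2)
        have hev2 := (hcont.tendsto.mono_left nhdsWithin_le_nhds).eventually_const_lt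
          (show dwellWeight Δ (t - s t) * ‖y (s t) - y t‖ ^ 2 - ε < _ from by linarith)
          (l := 𝓝[<] t)
        filter_upwards [hleft t ht.le h1, hev2] with u hu hu2
        have hAu : A u := by simp only [hA, hu]; exact hAt
        have hsu : s u = s t := by simp only [hsdef, hu]
        simp only [if_pos hAu, if_pos hAt, hsu]
        linarith
      · filter_upwards [hleft t ht.le h1] with u hu
        have hAu : ¬ A u := by simp only [hA, hu]; exact hAt
        simp only [if_neg hAu, if_neg hAt]
        linarith

end IsEventTriggeredRun

end OptimalConsensus

namespace OptimalConsensus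

/-! ### Coordinates with respect to Laplacian modes -/

/-- `φ` is an orthonormal basis of eigenvectors of the Laplacian with eigenvalues `μ`. -/
structure LaplacianModes {N : ℕ} (a : Matrix (Fin N) (Fin N) ℝ) (μ : Fin N → ℝ)
    (φ : Fin N → Fin N → ℝ) : Prop where
  parseval : ∀ x y : Fin N → ℝ, ∑ k, (∑ i, φ k i * x i) * (∑ i, φ k i * y i) = ∑ i, x i * y i
  eigen : ∀ k (y : Fin N → ℝ), ∑ i, φ k i * ∑ j, a i j * (y i - y j) = μ k * ∑ i, φ k i * y i
  nonneg : ∀ k, 0 ≤ μ k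
  const : ∀ k, μ k = 0 → ∀ i j, φ k i = φ k j

/-- The `r`-th coordinate of the component of `X` in the `k`-th mode. -/
def modeCoord {N q : ℕ} (φ : Fin N → Fin N → ℝ) (X : Fin N → Vec q) (k : Fin N) (r : Fin q) : ℝ :=
  ∑ i, φ k i * X i r

section

variable {N q : ℕ} {a : Matrix (Fin N) (Fin N) ℝ} {μ : Fin N → ℝ} {φ : Fin N → Fin N → ℝ}

theorem modeCoord_add (X Y : Fin N → Vec q) (k : Fin N) (r : Fin q) :
    modeCoord φ (fun i => X i + Y i) k r = modeCoord φ X k r + modeCoord φ Y k r := by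
  simp [modeCoord, mul_add, Finset.sum_add_distrib]

theorem modeCoord_sub (X Y : Fin N → Vec q) (k : Fin N) (r : Fin q) :
    modeCoord φ (fun i => X i - Y i) k r = modeCoord φ X k r - modeCoord φ Y k r := by
  simp [modeCoord, mul_sub, Finset.sum_sub_distrib]

theorem modeCoord_neg (X : Fin N → Vec q) (k : Fin N) (r : Fin q) :
    modeCoord φ (fun i => -X i) k r = -modeCoord φ X k r := by
  simp [modeCoord]

theorem modeCoord_smul (c : ℝ) (X : Fin N → Vec q) (k : Fin N) (r : Fin q) :
    modeCoord φ (fun i => c • X i) k r = c * modeCoord φ X k r := by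
  simp [modeCoord, Finset.mul_sum, mul_left_comm]

namespace LaplacianModes

theorem sum_modeCoord_mul (M : LaplacianModes a μ φ) (X Y : Fin N → Vec q) :
    ∑ k, ∑ r, modeCoord φ X k r * modeCoord φ Y k r = ∑ i, inner ℝ (X i) (Y i) := by
  simp only [PiLp.inner_apply, RCLike.inner_apply, conj_trivial]
  rw [Finset.sum_comm, Finset.sum_comm (s := Finset.univ (α := Fin N))]
  refine Finset.sum_congr rfl fun r _ => ?_
  unfold modeCoord
  rw [M.parseval (fun i => X i r) (fun i => Y i r)]
  exact Finset.sum_congr rfl fun i _ => mul_comm _ _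

theorem sum_modeCoord_sq (M : LaplacianModes a μ φ) (X : Fin N → Vec q) :
    ∑ k, ∑ r, modeCoord φ X k r ^ 2 = ∑ i, ‖X i‖ ^ 2 := by
  simp only [sq, M.sum_modeCoord_mul X X, real_inner_self_eq_norm_mul_norm]

theorem modeCoord_laplacian (M : LaplacianModes a μ φ) (X : Fin N → Vec q) (k : Fin N)
    (r : Fin q) :
    modeCoord φ (fun i => ∑ j, a i j • (X i - X j)) k r = μ k * modeCoord φ X k r := by
  have := M.eigen k (fun i => X i r)
  simpa [modeCoord] using this

theorem sum_eigen_mul_sq (M : LaplacianModes a μ φ) (ha : IsConnectedAdjacency a)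
    (X : Fin N → Vec q) :
    ∑ k, ∑ r, μ k * modeCoord φ X k r ^ 2 = 1 / 2 * ∑ i, ∑ j, a i j * ‖X i - X j‖ ^ 2 := by
  have h1 : ∑ k, ∑ r, μ k * modeCoord φ X k r ^ 2 =
      ∑ i, inner ℝ (X i) (∑ j, a i j • (X i - X j)) := by
    rw [← M.sum_modeCoord_mul]
    refine Finset.sum_congr rfl fun k _ => Finset.sum_congr rfl fun r _ => ?_
    rw [M.modeCoord_laplacian]; ring
  have h2 : ∀ i j, a i j * ‖X i - X j‖ ^ 2 =
      ∑ r, a i j * ((X i r - X j r) * (X i r - X j r)) := by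
    intro i j
    rw [EuclideanSpace.real_norm_sq_eq, Finset.mul_sum]
    exact Finset.sum_congr rfl fun r _ => by simp [sq]
  have h3 : ∑ i, inner ℝ (X i) (∑ j, a i j • (X i - X j)) =
      ∑ r, ∑ i, X i r * ∑ j, a i j * (X i r - X j r) := by
    rw [Finset.sum_comm]
    refine Finset.sum_congr rfl fun i _ => ?_
    simp only [PiLp.inner_apply, RCLike.inner_apply, conj_trivial]
    refine Finset.sum_congr rfl fun r _ => ?_
    simp [mul_comm]
  rw [h1, h3]
  simp only [h2]
  have h4 : ∑ i, ∑ j, ∑ r, a i j * ((X i r - X j r) * (X i r - X j r)) =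
      ∑ r, ∑ i, ∑ j, a i j * ((X i r - X j r) * (X i r - X j r)) :=
    (Finset.sum_congr rfl fun i _ => Finset.sum_comm).trans Finset.sum_comm
  rw [h4, Finset.mul_sum]
  exact Finset.sum_congr rfl fun r _ => sum_mul_laplacian ha (fun i => X i r) (fun i => X i r)

end LaplacianModes

end

/-- The constants of the Lyapunov function: in the mode `k` it is
`y² / 2 + b k y η + g k η² / 2`. -/
structure LyapunovWeights {N : ℕ} (m p κ Δ : ℝ) (μ b c : Fin N → ℝ) (δ : ℝ) : Prop where
  δ_pos : 0 < δ
  decrease : ∀ k y h η e z,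
    modeForm m p (κ + μ k / 2) (5 / (8 * Δ)) (Δ / 3) (b k) (μ k) y h η e z + c k * (η * z) ≤
      -δ * (y ^ 2 + h ^ 2 + η ^ 2 + e ^ 2 + z ^ 2)
  lower : ∀ k, 0 < μ k → ∀ y η : ℝ,
    δ * (y ^ 2 + η ^ 2) ≤ y ^ 2 / 2 + b k * y * η + (c k / μ k + b k) / 2 * η ^ 2

/-- The weight c/l + b of η²/2 is chosen so that its derivative contributes c·ηz and cancels the
term -b·l·ηz coming from the cross term. For l = 0 the junk value of c/l is multiplied by η = 0. -/
theorem modeForm_dissipation {m p κ Δ l b c y h η e z : ℝ} (hη : l = 0 → η = 0) :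
    (y * (-(h + m * y) - l * z - η) + b * ((-(h + m * y) - l * z - η) * η + y * (l * z)) +
        (c / l + b) * (η * (l * z))) +
      (-(5 / (8 * Δ)) * (z - y - e) ^ 2 + Δ / 3 * (-(h + m * y) - l * z - η) ^ 2) =
    modeForm m p (κ + l / 2) (5 / (8 * Δ)) (Δ / 3) b l y h η e z + c * (η * z) +
      (h ^ 2 / p - y * h) - (l * z ^ 2 / 2 - κ * e ^ 2 - l * e ^ 2 / 2) := by
  have h1 : (c / l + b) * (η * (l * z)) = c * (η * z) + b * (η * (l * z)) := by
    by_cases hl : l = 0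
    · simp [hη hl]
    · field_simp
  rw [h1]
  unfold modeForm
  ring

/-- The sector and threshold conditions hold per agent, not per mode. Only their sums are needed,
and Parseval turns these into sums over the modes, where `modeForm_dissipation` accounts for every
term. -/
theorem network_dissipation {N q : ℕ} {a : Matrix (Fin N) (Fin N) ℝ} {μ : Fin N → ℝ}
    {φ : Fin N → Fin N → ℝ} (ha : IsConnectedAdjacency a) (M : LaplacianModes a μ φ)
    {m p κ Δ δ : ℝ} {b c : Fin N → ℝ} (hp : 0 < p) (W : LyapunovWeights m p κ Δ μ b c δ)
    {Y H E A B z v : Fin N → Vec q}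
    (hz : ∀ i, z i = Y i + A i + B i)
    (hv : ∀ i, v i = -(H i + m • Y i) - ∑ j, a i j • (z i - z j) - E i)
    (hH : ∀ i, ‖H i‖ ^ 2 ≤ p * inner ℝ (Y i) (H i))
    (hB : ∀ i, 4 * (outDegree a i + κ) * ‖B i‖ ^ 2 ≤ ∑ j, a i j * ‖z i - z j‖ ^ 2)
    (hE : ∀ k r, μ k = 0 → modeCoord φ E k r = 0) :
    (∑ k, ∑ r, (modeCoord φ Y k r * modeCoord φ v k r +
        b k * (modeCoord φ v k r * modeCoord φ E k r +
          modeCoord φ Y k r * (μ k * modeCoord φ z k r)) +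
        (c k / μ k + b k) * (modeCoord φ E k r * (μ k * modeCoord φ z k r)))) +
      ∑ i, (-(5 / (8 * Δ)) * ‖A i‖ ^ 2 + Δ / 3 * ‖v i‖ ^ 2) ≤
    -(δ / 4) * ∑ i, (‖Y i‖ ^ 2 + ‖E i‖ ^ 2 + ‖A i‖ ^ 2) := by
  have hvc : ∀ k r, modeCoord φ v k r = -(modeCoord φ H k r + m * modeCoord φ Y k r) -
      μ k * modeCoord φ z k r - modeCoord φ E k r := by
    intro k r
    rw [funext hv, modeCoord_sub, modeCoord_sub, modeCoord_neg, modeCoord_add, modeCoord_smul,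
      M.modeCoord_laplacian]
  have hAc : ∀ k r, modeCoord φ A k r =
      modeCoord φ z k r - modeCoord φ Y k r - modeCoord φ B k r := by
    intro k r
    rw [funext hz, modeCoord_add, modeCoord_add]; ring
  have hsect :
      ∑ k, ∑ r, (modeCoord φ H k r ^ 2 / p - modeCoord φ Y k r * modeCoord φ H k r) ≤ 0 := by
    simp only [Finset.sum_sub_distrib, ← Finset.sum_div]
    rw [M.sum_modeCoord_sq, M.sum_modeCoord_mul, sub_nonpos, div_le_iff₀ hp, Finset.sum_mul]
    exact Finset.sum_le_sum fun i _ => by linarith [hH i]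
  -- The degrees in the threshold are traded for the Laplacian form of B, so the agents' different
  -- degrees disappear from the mode inequalities.
  have hthr : 0 ≤ ∑ k, ∑ r, (μ k * modeCoord φ z k r ^ 2 / 2 - κ * modeCoord φ B k r ^ 2 -
      μ k * modeCoord φ B k r ^ 2 / 2) := by
    simp only [Finset.sum_sub_distrib, ← Finset.sum_div, ← Finset.mul_sum (a := κ)]
    rw [M.sum_eigen_mul_sq ha, M.sum_eigen_mul_sq ha, M.sum_modeCoord_sq]
    have h1 := sum_edges_le_degree ha B
    have h2 : ∑ i, 4 * (outDegree a i + κ) * ‖B i‖ ^ 2 ≤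
        ∑ i, ∑ j, a i j * ‖z i - z j‖ ^ 2 := Finset.sum_le_sum fun i _ => hB i
    have h3 : ∑ i, 4 * (outDegree a i + κ) * ‖B i‖ ^ 2 =
        4 * ∑ i, outDegree a i * ‖B i‖ ^ 2 + 4 * (κ * ∑ i, ‖B i‖ ^ 2) := by
      rw [Finset.mul_sum, Finset.mul_sum, Finset.mul_sum, ← Finset.sum_add_distrib]
      exact Finset.sum_congr rfl fun i _ => by ring
    linarith
  have e1 : ∑ i, (-(5 / (8 * Δ)) * ‖A i‖ ^ 2 + Δ / 3 * ‖v i‖ ^ 2) =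
      ∑ k, ∑ r, (-(5 / (8 * Δ)) * modeCoord φ A k r ^ 2 + Δ / 3 * modeCoord φ v k r ^ 2) := by
    simp only [Finset.sum_add_distrib, ← Finset.mul_sum]
    rw [M.sum_modeCoord_sq, M.sum_modeCoord_sq]
  have e2 : ∑ i, (‖Y i‖ ^ 2 + ‖E i‖ ^ 2 + ‖A i‖ ^ 2) =
      ∑ k, ∑ r, (modeCoord φ Y k r ^ 2 + modeCoord φ E k r ^ 2 + modeCoord φ A k r ^ 2) := by
    simp only [Finset.sum_add_distrib]
    rw [M.sum_modeCoord_sq, M.sum_modeCoord_sq, M.sum_modeCoord_sq]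
  have hmode : ∀ k r, (modeCoord φ Y k r * modeCoord φ v k r +
        b k * (modeCoord φ v k r * modeCoord φ E k r +
          modeCoord φ Y k r * (μ k * modeCoord φ z k r)) +
        (c k / μ k + b k) * (modeCoord φ E k r * (μ k * modeCoord φ z k r))) +
      (-(5 / (8 * Δ)) * modeCoord φ A k r ^ 2 + Δ / 3 * modeCoord φ v k r ^ 2) ≤
      -(δ / 4) * (modeCoord φ Y k r ^ 2 + modeCoord φ E k r ^ 2 + modeCoord φ A k r ^ 2) +
      (modeCoord φ H k r ^ 2 / p - modeCoord φ Y k r * modeCoord φ H k r) -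
      (μ k * modeCoord φ z k r ^ 2 / 2 - κ * modeCoord φ B k r ^ 2 -
        μ k * modeCoord φ B k r ^ 2 / 2) := by
    intro k r
    have hE' := hE k r
    rw [hvc, hAc]
    generalize modeCoord φ Y k r = y at *
    generalize modeCoord φ H k r = h at *
    generalize modeCoord φ E k r = η at *
    generalize modeCoord φ B k r = e at *
    generalize modeCoord φ z k r = z at *
    rw [modeForm_dissipation (p := p) (κ := κ) hE']
    have h1 := W.decrease k y h η e z
    have h2 : y ^ 2 + η ^ 2 + (z - y - e) ^ 2 ≤
        4 * (y ^ 2 + h ^ 2 + η ^ 2 + e ^ 2 + z ^ 2) := by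
      nlinarith [sq_nonneg (z + y), sq_nonneg (z + e), sq_nonneg (y - e), sq_nonneg h,
        sq_nonneg η, sq_nonneg y, sq_nonneg e, sq_nonneg z]
    have h3 := mul_le_mul_of_nonneg_left h2 W.δ_pos.le
    linarith
  rw [e1, e2, ← Finset.sum_add_distrib]
  simp only [← Finset.sum_add_distrib]
  refine (Finset.sum_le_sum fun k _ => Finset.sum_le_sum fun r _ => hmode k r).trans ?_
  simp only [Finset.sum_sub_distrib, Finset.sum_add_distrib, ← Finset.mul_sum] at hsect hthr ⊢
  linarith

end OptimalConsensus

namespace OptimalConsensus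

/-! ### Exponential decay along runs -/

theorem hasDerivWithinAt_modeCoord {N q : ℕ} {φ : Fin N → Fin N → ℝ} {X : Fin N → ℝ → Vec q}
    {X' : Fin N → Vec q} {s : Set ℝ} {t : ℝ} (h : ∀ i, HasDerivWithinAt (X i) (X' i) s t)
    (k : Fin N) (r : Fin q) :
    HasDerivWithinAt (fun t => modeCoord φ (fun i => X i t) k r) (modeCoord φ X' k r) s t := by
  unfold modeCoord
  refine HasDerivWithinAt.fun_sum fun i _ => ?_
  have h1 := (EuclideanSpace.proj (𝕜 := ℝ) r).hasFDerivAt.comp_hasDerivWithinAt t (h i)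
  exact h1.const_mul (φ k i)

theorem continuousAt_modeCoord {N q : ℕ} {φ : Fin N → Fin N → ℝ} {X : Fin N → ℝ → Vec q}
    {t : ℝ} (h : ∀ i, ContinuousAt (X i) t) (k : Fin N) (r : Fin q) :
    ContinuousAt (fun t => modeCoord φ (fun i => X i t) k r) t := by
  unfold modeCoord
  refine tendsto_finsetSum _ fun i _ => ?_
  have h1 := (EuclideanSpace.proj (𝕜 := ℝ) r).continuous.continuousAt.comp (h i)
  exact tendsto_const_nhds.mul h1

/-- A function with downward jumps stays one after multiplication with an exponential. -/
theorem eventually_exp_mul_le {g : ℝ → ℝ} {t γ : ℝ}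
    (h : ∀ ε > 0, ∀ᶠ s in 𝓝[<] t, g t ≤ g s + ε) {ε : ℝ} (hε : 0 < ε) :
    ∀ᶠ s in 𝓝[<] t, Real.exp (γ * t) * g t ≤ Real.exp (γ * s) * g s + ε := by
  have hc : Tendsto (fun s => Real.exp (γ * s)) (𝓝[<] t) (𝓝 (Real.exp (γ * t))) := by
    have : Continuous fun s => Real.exp (γ * s) := by fun_prop
    exact this.continuousAt.tendsto.mono_left nhdsWithin_le_nhds
  have hc1 : ∀ᶠ s in 𝓝[<] t, Real.exp (γ * s) < Real.exp (γ * t) + 1 :=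
    hc.eventually_lt_const (by linarith)
  have hc2 : ∀ᶠ s in 𝓝[<] t, Real.exp (γ * t) * g t - ε / 2 < Real.exp (γ * s) * g t :=
    (hc.mul_const (g t)).eventually_const_lt (by linarith)
  have hpos : 0 < Real.exp (γ * t) + 1 := by positivity
  filter_upwards [hc1, hc2, h (ε / (2 * (Real.exp (γ * t) + 1))) (by positivity)] with s h1 h2 h3
  have h4 := mul_le_mul_of_nonneg_left h3 (Real.exp_pos (γ * s)).le
  have h5 : Real.exp (γ * s) * (ε / (2 * (Real.exp (γ * t) + 1))) ≤ ε / 2 := by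
    calc _ ≤ (Real.exp (γ * t) + 1) * (ε / (2 * (Real.exp (γ * t) + 1))) := by gcongr
      _ = ε / 2 := by field_simp
  linarith

theorem sum_disagreement_eq_zero {N q : ℕ} {a : Matrix (Fin N) (Fin N) ℝ}
    (ha : IsConnectedAdjacency a) (yhat : Fin N → ℝ → Vec q) (t : ℝ) :
    ∑ i, disagreement a yhat i t = 0 := by
  have h1 : ∑ i, disagreement a yhat i t = -∑ i, disagreement a yhat i t := by
    unfold disagreement
    conv_lhs => rw [Finset.sum_comm]
    rw [← Finset.sum_neg_distrib]
    refine Finset.sum_congr rfl fun i _ => ?_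
    rw [← Finset.sum_neg_distrib]
    refine Finset.sum_congr rfl fun j _ => ?_
    rw [ha.symm.apply, ← neg_sub (yhat i t), smul_neg]
  have h2 : (2 : ℝ) • ∑ i, disagreement a yhat i t = 0 := by
    rw [two_smul]
    nth_rewrite 1 [h1]
    exact neg_add_cancel _
  exact (smul_eq_zero.1 h2).resolve_left two_ne_zero

namespace IsEventTriggeredRun

variable {N q : ℕ} {S : Agents N q} {f : Fin N → Vec q → ℝ} {a : Matrix (Fin N) (Fin N) ℝ}
  {Kα : (i : Fin N) → Matrix (Fin (S.p i)) (Fin (S.n i)) ℝ}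
  {Kβ : (i : Fin N) → Matrix (Fin (S.p i)) (Fin q) ℝ} {κ Δ : ℝ}
  {x : (i : Fin N) → ℝ → Vec (S.n i)} {η yhat : Fin N → ℝ → Vec q} {T : Fin N → ℕ → ℝ≥0∞}

theorem sum_integrators_eq_zero (h : IsEventTriggeredRun S f a Kα Kβ κ Δ x η yhat T)
    (ha : IsConnectedAdjacency a) {t : ℝ} (ht : 0 ≤ t) : ∑ i, η i t = 0 := by
  have h1 := constant_of_has_deriv_right_zero (f := fun t => ∑ i, η i t) (a := 0) (b := t)
    (continuousOn_finsetSum _ fun i _ => (h.η_cont i).mono fun s hs => hs.1)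
    (fun s hs => by
      have := HasDerivWithinAt.fun_sum (u := Finset.univ) fun i _ => h.η_deriv i s hs.1
      rwa [sum_disagreement_eq_zero ha] at this)
    t ⟨ht, le_rfl⟩
  simpa [h.η_zero] using h1

/-- The Lyapunov function decays exponentially, hence so does the distance of the outputs to the
optimum. -/
theorem exists_decay_bound (h : IsEventTriggeredRun S f a Kα Kβ κ Δ x η yhat T)
    (ha : IsConnectedAdjacency a) (hΔ : 0 < Δ) (hκ : 0 < κ)
    (hKα : ∀ i, S.C i * S.B i * Kα i = S.C i * S.A i) (hKβ : ∀ i, S.C i * S.B i * Kβ i = 1)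
    {μ : Fin N → ℝ} {φ : Fin N → Fin N → ℝ} (M : LaplacianModes a μ φ) {m p δ C : ℝ}
    {b c : Fin N → ℝ} (hp : 0 < p) (W : LyapunovWeights m p κ Δ μ b c δ) (hC7 : 7 ≤ C)
    (hC : ∀ k, 1 + |b k| + |c k / μ k + b k| ≤ C) {ystar : Vec q}
    (hsum : ∑ i, gradient (f i) ystar = 0)
    (hsec : ∀ i u, ‖gradient (f i) u - gradient (f i) ystar - m • (u - ystar)‖ ^ 2 ≤
      p * inner ℝ (u - ystar) (gradient (f i) u - gradient (f i) ystar - m • (u - ystar))) :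
    ∃ K, ∀ i t, 0 ≤ t → ‖S.output x i t - ystar‖ ≤ K * Real.exp (-(δ / (8 * C)) * t) := by
  have hδ := W.δ_pos
  have hC0 : 0 < C := by linarith
  set v : Fin N → ℝ → Vec q := fun i t =>
    -gradient (f i) (S.output x i t) - disagreement a yhat i t - η i t with hvdef
  have hdeg : ∀ i, 0 ≤ outDegree a i := fun i => Finset.sum_nonneg fun j _ => ha.nonneg j i
  choose eA eB Z Z' hspl using fun i => h.exists_errorSplit hΔ ha.nonneg i
    (by linarith [hdeg i]) (fun t ht => h.output_deriv hKα hKβ i ht)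
  set Y : Fin N → ℝ → Vec q := fun i t => S.output x i t - ystar with hY
  set E : Fin N → ℝ → Vec q := fun i t => η i t + gradient (f i) ystar with hE
  set V : ℝ → ℝ := fun t => ∑ k, ∑ r, (modeCoord φ (fun i => Y i t) k r ^ 2 / 2 +
    b k * (modeCoord φ (fun i => Y i t) k r * modeCoord φ (fun i => E i t) k r) +
    (c k / μ k + b k) / 2 * modeCoord φ (fun i => E i t) k r ^ 2) with hV
  set Wt : ℝ → ℝ := fun t => V t + ∑ i, Z i t with hWt
  set z : ℝ → Fin N → Vec q := fun t i => yhat i t - ystar with hz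
  set V' : ℝ → ℝ := fun t => ∑ k, ∑ r,
      (modeCoord φ (fun i => Y i t) k r * modeCoord φ (fun i => v i t) k r +
        b k * (modeCoord φ (fun i => v i t) k r * modeCoord φ (fun i => E i t) k r +
          modeCoord φ (fun i => Y i t) k r * (μ k * modeCoord φ (z t) k r)) +
        (c k / μ k + b k) * (modeCoord φ (fun i => E i t) k r * (μ k * modeCoord φ (z t) k r)))
    with hV'
  have hYd : ∀ t, 0 ≤ t → ∀ i, HasDerivWithinAt (Y i) (v i t) (Set.Ici t) t := fun t ht i =>
    (h.output_deriv hKα hKβ i ht).sub_const _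
  have hEd : ∀ t, 0 ≤ t → ∀ i, HasDerivWithinAt (E i) (∑ j, a i j • (z t i - z t j))
      (Set.Ici t) t := by
    intro t ht i
    refine ((h.η_deriv i t ht).add_const (gradient (f i) ystar)).congr_deriv ?_
    simp [hz, disagreement]
  -- A zero mode is constant over the agents, and both the integrators and the gradients at the
  -- optimum sum to zero.
  have hzero : ∀ t, 0 ≤ t → ∀ k r, μ k = 0 → modeCoord φ (fun i => E i t) k r = 0 := by
    intro t ht k r hk
    have hsE : ∑ i, E i t = 0 := by
      simp only [hE, Finset.sum_add_distrib, h.sum_integrators_eq_zero ha ht, hsum, add_zero]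
    have hcoord : ∑ i, (E i t) r = 0 := by
      have := congrArg (fun u : Vec q => u r) hsE
      simpa using this
    unfold modeCoord
    rcases isEmpty_or_nonempty (Fin N) with hemp | ⟨⟨i₀⟩⟩
    · simp
    · rw [Finset.sum_congr rfl fun i _ => by rw [M.const k hk i i₀], ← Finset.mul_sum, hcoord,
        mul_zero]
  have hVd : ∀ t, 0 ≤ t → HasDerivWithinAt V (V' t) (Set.Ici t) t := by
    intro t ht
    refine HasDerivWithinAt.fun_sum fun k _ => HasDerivWithinAt.fun_sum fun r _ => ?_
    have h1 := hasDerivWithinAt_modeCoord (φ := φ) (hYd t ht) k r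
    have h2 := hasDerivWithinAt_modeCoord (φ := φ) (hEd t ht) k r
    rw [M.modeCoord_laplacian] at h2
    have h3 := (((h1.fun_pow 2).div_const 2).fun_add ((h1.fun_mul h2).const_mul (b k))).fun_add
      ((h2.fun_pow 2).const_mul ((c k / μ k + b k) / 2))
    refine h3.congr_deriv ?_
    push_cast
    ring
  have hWd : ∀ t, 0 ≤ t → HasDerivWithinAt Wt (V' t + ∑ i, Z' i t) (Set.Ici t) t := fun t ht =>
    (hVd t ht).fun_add (HasDerivWithinAt.fun_sum fun i _ => (hspl i).deriv t ht)
  have hdiss : ∀ t, 0 ≤ t → V' t + ∑ i, Z' i t ≤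
      -(δ / 4) * ∑ i, (‖Y i t‖ ^ 2 + ‖E i t‖ ^ 2 + ‖eA i t‖ ^ 2) := by
    intro t ht
    refine le_trans (add_le_add_right (Finset.sum_le_sum fun i _ =>
      (hspl i).dissipation t ht) _) ?_
    refine network_dissipation ha M hp W (Y := fun i => Y i t) (E := fun i => E i t)
      (H := fun i => gradient (f i) (S.output x i t) - gradient (f i) ystar - m • (Y i t))
      (B := fun i => eB i t) (A := fun i => eA i t) (z := z t) (v := fun i => v i t)
      (fun i => ?_) (fun i => ?_) (fun i => hsec i _) (fun i => ?_) (hzero t ht)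
    · simp only [hz, hY, (hspl i).split t ht]; abel
    · simp only [hvdef, hz, hE, disagreement, sub_sub_sub_cancel_right]; abel
    · simpa [hz] using (hspl i).below t ht
  have hupper : ∀ t, 0 ≤ t → Wt t ≤ C * ∑ i, (‖Y i t‖ ^ 2 + ‖E i t‖ ^ 2 + ‖eA i t‖ ^ 2) := by
    intro t ht
    have h1 : V t ≤ ∑ k, ∑ r, C * (modeCoord φ (fun i => Y i t) k r ^ 2 +
        modeCoord φ (fun i => E i t) k r ^ 2) := by
      refine Finset.sum_le_sum fun k _ => Finset.sum_le_sum fun r _ => ?_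
      generalize modeCoord φ (fun i => Y i t) k r = y
      generalize modeCoord φ (fun i => E i t) k r = e
      have hCk := hC k
      generalize c k / μ k + b k = g at *
      have a1 : b k * (y * e) ≤ |b k| * ((y ^ 2 + e ^ 2) / 2) := by
        refine (le_abs_self _).trans ?_
        rw [abs_mul]
        refine mul_le_mul_of_nonneg_left ?_ (abs_nonneg _)
        rw [abs_le]
        constructor <;> nlinarith [sq_nonneg (y + e), sq_nonneg (y - e)]
      have a2 : g / 2 * e ^ 2 ≤ |g| / 2 * e ^ 2 := by
        have := le_abs_self g
        have := mul_le_mul_of_nonneg_right this (sq_nonneg e)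
        linarith
      have a3 := mul_le_mul_of_nonneg_right hCk (add_nonneg (sq_nonneg y) (sq_nonneg e))
      have a4 : 0 ≤ |b k| * (y ^ 2 + e ^ 2) := by positivity
      have a5 : 0 ≤ |g| * y ^ 2 := by positivity
      have a6 : 0 ≤ |g| * e ^ 2 := by positivity
      nlinarith [sq_nonneg y, sq_nonneg e]
    have h2 : ∑ i, Z i t ≤ ∑ i, C * ‖eA i t‖ ^ 2 := by
      refine Finset.sum_le_sum fun i _ => ((hspl i).le t ht).trans ?_
      exact mul_le_mul_of_nonneg_right hC7 (sq_nonneg _)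
    simp only [← Finset.mul_sum, Finset.sum_add_distrib] at h1 h2 ⊢
    rw [M.sum_modeCoord_sq, M.sum_modeCoord_sq] at h1
    simp only [hWt]
    linarith
  -- In a zero mode only y²/2 is left of the Lyapunov function.
  set δ' := min δ (1 / 2) with hδ'
  have hδ'0 : 0 < δ' := lt_min hδ (by norm_num)
  have hlower : ∀ t, 0 ≤ t → δ' * ∑ i, ‖Y i t‖ ^ 2 ≤ Wt t := by
    intro t ht
    have h1 : δ' * ∑ i, ‖Y i t‖ ^ 2 ≤ V t := by
      rw [← M.sum_modeCoord_sq, Finset.mul_sum]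
      refine Finset.sum_le_sum fun k _ => ?_
      rw [Finset.mul_sum]
      refine Finset.sum_le_sum fun r _ => ?_
      have hz0 := hzero t ht k r
      generalize modeCoord φ (fun i => Y i t) k r = y
      generalize modeCoord φ (fun i => E i t) k r = e at *
      rcases (M.nonneg k).eq_or_lt with hk | hk
      · rw [hz0 hk.symm]
        have := mul_le_mul_of_nonneg_right (min_le_right δ (1 / 2)) (sq_nonneg y)
        simp only [hδ']
        linarith
      · have a1 := W.lower k hk y e
        have a2 := mul_le_mul_of_nonneg_right (min_le_left δ (1 / 2)) (sq_nonneg y)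
        have a3 : 0 ≤ δ * e ^ 2 := by positivity
        simp only [hδ']
        linarith
    have h2 : 0 ≤ ∑ i, Z i t := Finset.sum_nonneg fun i _ => (hspl i).nonneg t ht
    simp only [hWt]
    linarith
  have hjump : ∀ t, 0 < t → ∀ ε > 0, ∀ᶠ s in 𝓝[<] t, Wt t ≤ Wt s + ε := by
    intro t ht ε hε
    have hVc : ContinuousAt V t := by
      have c1 : ∀ k r, ContinuousAt (fun t => modeCoord φ (fun i => Y i t) k r) t :=
        continuousAt_modeCoord fun i =>
          ((h.output_cont i).continuousAt (Ici_mem_nhds ht)).sub continuousAt_const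
      have c2 : ∀ k r, ContinuousAt (fun t => modeCoord φ (fun i => E i t) k r) t :=
        continuousAt_modeCoord fun i =>
          ((h.η_cont i).continuousAt (Ici_mem_nhds ht)).add continuousAt_const
      refine tendsto_finsetSum _ fun k _ => tendsto_finsetSum _ fun r _ => ?_
      exact ((((c1 k r).pow 2).div_const 2).add (((c1 k r).mul (c2 k r)).const_mul (b k))).add
        (((c2 k r).pow 2).const_mul ((c k / μ k + b k) / 2))
    have hV2 : ∀ᶠ s in 𝓝[<] t, V t - ε / 2 < V s :=
      (hVc.tendsto.mono_left nhdsWithin_le_nhds).eventually_const_lt (by linarith)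
    have hZ2 : ∀ᶠ s in 𝓝[<] t, ∀ i, Z i t ≤ Z i s + ε / (2 * (N + 1)) :=
      eventually_all.2 fun i => (hspl i).jump t ht _ (by positivity)
    filter_upwards [hV2, hZ2] with s h1 h2
    have h3 : ∑ i, Z i t ≤ ∑ i, Z i s + ε / 2 := by
      have h4 : ∑ i, Z i t ≤ ∑ i, (Z i s + ε / (2 * (N + 1))) := Finset.sum_le_sum fun i _ => h2 i
      rw [Finset.sum_add_distrib, Finset.sum_const, Finset.card_univ, Fintype.card_fin,
        nsmul_eq_mul] at h4
      have h5 : (N : ℝ) * (ε / (2 * (N + 1))) ≤ ε / 2 := by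
        rw [mul_div_assoc', div_le_div_iff₀ (by positivity) (by norm_num)]
        nlinarith
      linarith
    simp only [hWt]
    linarith
  -- The dissipation constant δ/4 over the upper bound C gives the decay rate of the Lyapunov
  -- function; the norm, being its square root, decays at half this rate.
  set γ := δ / (4 * C) with hγ
  have hdecay : ∀ t, 0 ≤ t → Real.exp (γ * t) * Wt t ≤ Wt 0 := by
    intro t ht
    have h1 := le_initial_of_right_deriv_nonpos (g := fun t => Real.exp (γ * t) * Wt t)
      (g' := fun t => Real.exp (γ * t) * (γ * 1) * Wt t +
        Real.exp (γ * t) * (V' t + ∑ i, Z' i t))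
      (fun t ht => (((hasDerivAt_id t).const_mul γ).exp.hasDerivWithinAt).fun_mul (hWd t ht))
      (fun t ht => by
        have d1 := hdiss t ht
        have d2 := mul_le_mul_of_nonneg_left (hupper t ht) (by positivity : 0 ≤ γ)
        have d3 : γ * (C * ∑ i, (‖Y i t‖ ^ 2 + ‖E i t‖ ^ 2 + ‖eA i t‖ ^ 2)) =
            δ / 4 * ∑ i, (‖Y i t‖ ^ 2 + ‖E i t‖ ^ 2 + ‖eA i t‖ ^ 2) := by
          rw [hγ]; field_simp
        have d4 : γ * Wt t + (V' t + ∑ i, Z' i t) ≤ 0 := by linarith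
        have d5 := mul_nonpos_of_nonneg_of_nonpos (Real.exp_pos (γ * t)).le d4
        linarith)
      (fun t ht ε hε => eventually_exp_mul_le (hjump t ht) hε) ht
    simpa using h1
  have hW0 : 0 ≤ Wt 0 :=
    (mul_nonneg hδ'0.le (Finset.sum_nonneg fun i _ => sq_nonneg _)).trans (hlower 0 le_rfl)
  refine ⟨√(Wt 0 / δ'), fun i t ht => ?_⟩
  have h1 : ‖Y i t‖ ^ 2 ≤ ∑ i, ‖Y i t‖ ^ 2 :=
    Finset.single_le_sum (f := fun i => ‖Y i t‖ ^ 2) (fun _ _ => sq_nonneg _) (Finset.mem_univ i)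
  have h2 : δ' * ‖Y i t‖ ^ 2 ≤ Wt t :=
    (mul_le_mul_of_nonneg_left h1 hδ'0.le).trans (hlower t ht)
  have h3 : Real.exp (γ * t) * (δ' * ‖Y i t‖ ^ 2) ≤ Wt 0 :=
    (mul_le_mul_of_nonneg_left h2 (Real.exp_pos _).le).trans (hdecay t ht)
  have h4 : Real.exp (-(δ / (8 * C)) * t) ^ 2 * Real.exp (γ * t) = 1 := by
    rw [← Real.exp_nat_mul, ← Real.exp_add, Real.exp_eq_one_iff, hγ]
    push_cast
    field_simp
    ring
  refine abs_le_of_sq_le_sq' ?_ (by positivity) |>.2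
  rw [mul_pow, Real.sq_sqrt (by positivity)]
  have h5 : ‖Y i t‖ ^ 2 * Real.exp (γ * t) ≤ Wt 0 / δ' := by
    rw [le_div_iff₀ hδ'0]; linarith
  calc ‖S.output x i t - ystar‖ ^ 2
      = (‖Y i t‖ ^ 2 * Real.exp (γ * t)) * Real.exp (-(δ / (8 * C)) * t) ^ 2 := by
        rw [mul_assoc, mul_comm (Real.exp (γ * t)), h4, mul_one]
    _ ≤ _ := mul_le_mul_of_nonneg_right h5 (sq_nonneg _)

end IsEventTriggeredRun

end OptimalConsensus

namespace OptimalConsensus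

/-! ### Choice of the Lyapunov weights -/

theorem exists_pos_forall_le {N : ℕ} {g : Fin N → ℝ} (hg : ∀ k, 0 < g k) :
    ∃ δ > 0, ∀ k, δ ≤ g k := by
  rcases isEmpty_or_nonempty (Fin N) with h | h
  · exact ⟨1, one_pos, fun k => h.elim k⟩
  · obtain ⟨k, hk⟩ := Finite.exists_min g
    exact ⟨g k, hg k, hk⟩

/-- There are finitely many modes, so one δ serves all of them. The weights depend on the parameters
and the spectrum only, which makes the final rate independent of the run. -/
theorem exists_lyapunovWeights {N : ℕ} {m w κ₀ κ Δ : ℝ} {μ : Fin N → ℝ}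
    (H : ∀ k, GainBounds m w κ₀ (μ k) Δ) (hκ : κ₀ ≤ κ) :
    ∃ b c δ, LyapunovWeights m (w - m) κ Δ μ b c δ := by
  choose c δ hδ hdec using fun k => (H k).exists_mode_decrease hκ
  have hlow : ∀ k, ∃ ν > 0, 0 < μ k → ∀ y η : ℝ, ν * (y ^ 2 + η ^ 2) ≤
      y ^ 2 / 2 + crossWeight m w κ₀ (μ k) Δ * y * η +
        (c k / μ k + crossWeight m w κ₀ (μ k) Δ) / 2 * η ^ 2 := by
    intro k
    rcases (H k).l_nonneg.eq_or_lt with h0 | h0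
    · exact ⟨1, one_pos, fun h => absurd h0 h.ne⟩
    · have hΔ := (H k).Δ_pos
      obtain ⟨ν, hν, hb⟩ := exists_mode_lower_bound h0 (hδ k) (by positivity) (hdec k)
      exact ⟨ν, hν, fun _ => hb⟩
  choose ν hν hlow using hlow
  obtain ⟨δ₀, hδ₀, hle⟩ := exists_pos_forall_le fun k => lt_min (hδ k) (hν k)
  refine ⟨fun k => crossWeight m w κ₀ (μ k) Δ, c, δ₀, hδ₀, fun k y h η e z => ?_,
    fun k hk y η => ?_⟩
  · refine (hdec k y h η e z).trans ?_
    have := (hle k).trans (min_le_left _ _)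
    gcongr
  · refine le_trans ?_ (hlow k hk y η)
    have := (hle k).trans (min_le_right _ _)
    gcongr

/-- A strong convexity constant of a function on a nontrivial space is at most every Lipschitz
constant of its gradient. -/
theorem convexity_le_lipschitz {E : Type*} [NormedAddCommGroup E] [InnerProductSpace ℝ E]
    [Nontrivial E] {g : E → E} {m w : ℝ} (hLip : ∀ u v, ‖g u - g v‖ ≤ w * ‖u - v‖)
    (hconv : ∀ u v, m * ‖u - v‖ ^ 2 ≤ inner ℝ (u - v) (g u - g v)) : m ≤ w := by
  obtain ⟨u, hu⟩ := exists_ne (0 : E)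
  have h1 := hconv u 0
  have h2 := (real_inner_le_norm (u - 0) (g u - g 0)).trans
    (mul_le_mul_of_nonneg_left (hLip u 0) (norm_nonneg _))
  rw [sub_zero] at h1 h2
  have h3 : 0 < ‖u‖ ^ 2 := by positivity
  exact le_of_mul_le_mul_right (h1.trans (h2.trans_eq (by ring))) h3

theorem exists_decay_rate {N q : ℕ} (hN : 0 < N) [Nontrivial (Vec q)] {S : Agents N q}
    {f : Fin N → Vec q → ℝ} {a : Matrix (Fin N) (Fin N) ℝ} (ha : IsConnectedAdjacency a)
    {w : Fin N → ℝ} (hf : ∀ i, Differentiable ℝ (f i))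
    (hLip : ∀ i u v, ‖gradient (f i) u - gradient (f i) v‖ ≤ w i * ‖u - v‖)
    {m : Fin N → ℝ} (hm : ∀ i, 0 < m i)
    (hconv : ∀ i u v, m i * ‖u - v‖ ^ 2 ≤ inner ℝ (u - v) (gradient (f i) u - gradient (f i) v))
    {Kα : (i : Fin N) → Matrix (Fin (S.p i)) (Fin (S.n i)) ℝ}
    (hKα : ∀ i, S.C i * S.B i * Kα i = S.C i * S.A i)
    {Kβ : (i : Fin N) → Matrix (Fin (S.p i)) (Fin q) ℝ}
    (hKβ : ∀ i, S.C i * S.B i * Kβ i = 1) {ξ Δ κ : ℝ}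
    (hξ : (4 * (⨆ i, w i) ^ 2 + 2 * maxLaplacianEigenvalue a ^ 2 + 1) / (8 * ⨅ i, m i) < ξ)
    (hΔ : 0 < Δ) (hΔ' : Δ ≤ tauZero (⨆ i, w i) (maxLaplacianEigenvalue a) (epsilon ξ))
    (hκ : max ((⨆ i, w i) ^ 2 / (4 * ⨅ i, m i)) (1 / 2) < κ) {ystar : Vec q}
    (hsum : ∑ i, gradient (f i) ystar = 0) :
    ∃ c > 0, ∀ (x : (i : Fin N) → ℝ → Vec (S.n i)) (η yhat : Fin N → ℝ → Vec q)
      (T : Fin N → ℕ → ℝ≥0∞), IsEventTriggeredRun S f a Kα Kβ κ Δ x η yhat T →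
        ∃ M, ∀ i t, 0 ≤ t → ‖S.output x i t - ystar‖ ≤ M * Real.exp (-c * t) := by
  have : Nonempty (Fin N) := ⟨⟨0, hN⟩⟩
  have hκ0 : 0 < κ := one_half_pos.trans ((le_max_right _ _).trans_lt hκ)
  have hm_le : ∀ i, ⨅ i, m i ≤ m i := ciInf_le (Finite.bddBelow_range m)
  have hw_le : ∀ i, w i ≤ ⨆ i, w i := le_ciSup (Finite.bddAbove_range w)
  have hm₀ : 0 < ⨅ i, m i := by
    obtain ⟨δ, hδ, h⟩ := exists_pos_forall_le hm
    exact hδ.trans_le (le_ciInf h)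
  have hmw : ⨅ i, m i ≤ ⨆ i, w i :=
    (hm_le ⟨0, hN⟩).trans ((convexity_le_lipschitz (hLip _) (hconv _)).trans (hw_le _))
  obtain ⟨μ, φ, hpar, heig, hμ, hconst⟩ := exists_laplacian_modes ha
  obtain ⟨m', κ₀, hm', hκ', hG⟩ := exists_gainBounds hm₀ hmw
    ((hμ ⟨0, hN⟩).1.trans (hμ _).2) hξ hΔ hΔ' hκ
  have hmw' : m' < ⨆ i, w i := hm'.trans_le hmw
  obtain ⟨b, c, δ, W⟩ := exists_lyapunovWeights (fun k => hG (μ k) (hμ k).1 (hμ k).2) hκ'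
  have hC : ∀ k, 1 + |b k| + |c k / μ k + b k| ≤
      7 + ∑ k, (1 + |b k| + |c k / μ k + b k|) := fun k => by
    have := Finset.single_le_sum (f := fun k => 1 + |b k| + |c k / μ k + b k|)
      (fun i _ => by positivity) (Finset.mem_univ k)
    linarith
  have hC7 : 7 ≤ 7 + ∑ k, (1 + |b k| + |c k / μ k + b k|) :=
    le_add_of_nonneg_right (Finset.sum_nonneg fun k _ => by positivity)
  have hsec : ∀ i u, ‖gradient (f i) u - gradient (f i) ystar - m' • (u - ystar)‖ ^ 2 ≤
      ((⨆ i, w i) - m') *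
        inner ℝ (u - ystar) (gradient (f i) u - gradient (f i) ystar - m' • (u - ystar)) :=
    fun i u => gradient_sector (hf i) hmw'
      (fun u v => (hLip i u v).trans (by gcongr; exact hw_le i))
      (fun u v => le_trans (by gcongr; exact hm'.le.trans (hm_le i)) (hconv i u v)) u ystar
  have hδ := W.δ_pos
  refine ⟨δ / (8 * (7 + ∑ k, (1 + |b k| + |c k / μ k + b k|))), by positivity,
    fun x η yhat T h => ?_⟩
  exact h.exists_decay_bound ha hΔ hκ0 hKα hKβ ⟨hpar, heig, fun k => (hμ k).1, hconst⟩
    (sub_pos.2 hmw') W hC7 hC hsum hsec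

end OptimalConsensus

open OptimalConsensus in
theorem theorem3 {N q : ℕ} (hN : 0 < N) (S : Agents N q) (f : Fin N → Vec q → ℝ)
    (a : Matrix (Fin N) (Fin N) ℝ)
    (ha : IsConnectedAdjacency a)
    (w : Fin N → ℝ) (hw : ∀ i, 0 < w i)
    (hf : ∀ i, Differentiable ℝ (f i))
    (hLip : ∀ i u v, ‖gradient (f i) u - gradient (f i) v‖ ≤ w i * ‖u - v‖)
    (m : Fin N → ℝ) (hm : ∀ i, 0 < m i)
    (hconv : ∀ i u v, m i * ‖u - v‖ ^ 2 ≤ inner ℝ (u - v) (gradient (f i) u - gradient (f i) v))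
    (hctrl : ∀ i, IsControllable (S.A i) (S.B i))
    (hrank : ∀ i, (S.C i * S.B i).rank = q)
    (Kα : (i : Fin N) → Matrix (Fin (S.p i)) (Fin (S.n i)) ℝ)
    (hKα : ∀ i, S.C i * S.B i * Kα i = S.C i * S.A i)
    (Kβ : (i : Fin N) → Matrix (Fin (S.p i)) (Fin q) ℝ)
    (hKβ : ∀ i, S.C i * S.B i * Kβ i = 1)
    (ξ : ℝ)
    (hξ : (4 * (⨆ i, w i) ^ 2 + 2 * maxLaplacianEigenvalue a ^ 2 + 1) / (8 * ⨅ i, m i) < ξ)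
    (Δ : ℝ) (hΔ : 0 < Δ)
    (hΔ' : Δ ≤ tauZero (⨆ i, w i) (maxLaplacianEigenvalue a) (epsilon ξ))
    (κ : ℝ) (hκ : max ((⨆ i, w i) ^ 2 / (4 * ⨅ i, m i)) (1 / 2) < κ) :
    ∃ ystar : Vec q,
      IsOptimalConsensus f (fun _ => ystar) ∧
      (∀ Y, IsOptimalConsensus f Y → Y = fun _ => ystar) ∧
      ∃ c > 0, ∀ (x : (i : Fin N) → ℝ → Vec (S.n i)) (η yhat : Fin N → ℝ → Vec q)
        (T : Fin N → ℕ → ENNReal),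
        IsEventTriggeredRun S f a Kα Kβ κ Δ x η yhat T →
          (∃ M, ∀ i t, 0 ≤ t → ‖S.output x i t - ystar‖ ≤ M * Real.exp (-c * t)) ∧
          (∀ i k, T i k + ENNReal.ofReal Δ ≤ T i (k + 1)) ∧
          (∀ i (b : ℝ), {k | T i k ≤ ENNReal.ofReal b}.Finite) := by
  obtain ⟨ystar, hsum, hopt, huniq⟩ := exists_unique_optimalConsensus hN hf hLip hm hconv
  refine ⟨ystar, hopt, huniq, ?_⟩
  have hrate : ∃ c > 0, ∀ (x : (i : Fin N) → ℝ → Vec (S.n i)) (η yhat : Fin N → ℝ → Vec q)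
      (T : Fin N → ℕ → ENNReal), IsEventTriggeredRun S f a Kα Kβ κ Δ x η yhat T →
        ∃ M, ∀ i t, 0 ≤ t → ‖S.output x i t - ystar‖ ≤ M * Real.exp (-c * t) := by
    -- For q = 0 the convexity constant need not be below the Lipschitz constant, but there is
    -- nothing to prove.
    rcases subsingleton_or_nontrivial (Vec q) with hq | hq
    · refine ⟨1, one_pos, fun x η yhat T _ => ⟨0, fun i t _ => ?_⟩⟩
      rw [Subsingleton.elim (S.output x i t - ystar) 0, norm_zero, zero_mul]
    · exact exists_decay_rate hN ha hf hLip hm hconv hKα hKβ hξ hΔ hΔ' hκ hsum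
  obtain ⟨c, hc, hbound⟩ := hrate
  exact ⟨c, hc, fun x η yhat T h =>
    ⟨hbound x η yhat T h, h.add_le_succ, h.finite_broadcasts hΔ⟩⟩
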